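/- **Schemes.** For a security parameter $n$, $\mathsf{Setup}$ draws a uniformly random pair of distinct $n$-bit primes $p\equiv q\equiv 3 \pmod 4$; the public parameter is $N=pq$, the master secret key is $(p,q)$. Let $\left(\frac{\cdot}{N}\right)$ be the Jacobi symbol, $\mathbb Z_N^*[s]=\{t\in\mathbb Z_N^*:\left(\frac tN\right)=s\}$ for $s=\pm1$, and $\nu(0)=1$, $\nu(1)=-1$. Let $H:\{0,1\}^*\to\mathbb Z_N^*[+1]$ be a hash function, modelled as a random oracle. In both schemes the secret key of an identity $\mathsf{id}$ with $a=H(\mathsf{id})$ is $r=a^{(N+5-p-q)/8}\bmod N$ (so $r^2=\pm a$). - The Cocks IBE encrypts $b\in\{0,1\}$ to $\mathsf{id}$ as $(t_1+at_1^{-1},\,t_2-at_2^{-1})$ with $t_1,t_2$ uniform in $\mathbb Z_N^*[\nu(b)]$. - $\mathsf{xhIBE}$ encrypts $b$ to $\mathsf{id}$ as $(c(x),d(x),a)$ with $$c(x)=(t_1+ag_1^2t_1^{-1})+2g_1x,\qquad d(x)=(t_2-ag_2^2t_2^{-1})+2g_2x\quad\text{in }\mathbb Z_N[x],$$ where $t_1,t_2$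 are uniform in $\mathbb Z_N^*[\nu(b)]$ and $g_1,g_2$ are uniform in $\mathbb Z_N^*$, and the choice is repeated until $\left(\frac{c_0^2-ac_1^2}{N}\right)=1$ and $\left(\frac{d_0^2+ad_1^2}{N}\right)=1$, with $c(x)=c_0+c_1x$ and $d(x)=d_0+d_1x$. **Security.** In the IND-ID-CPA game in the random oracle model, a probabilistic polynomial-time adversary gets $N$ and $n$, and has adaptive access to $H$ and to an oracle for the secret keys of identities. At some point it chooses an identity $\mathsf{id}^*$ whose key it has not extracted and bits $m_0,m_1$, and gets an encryption of $m_b$ to $\mathsf{id}^*$ for a random bit $b$. It continues with its queries, but may not extract the key of $\mathsf{id}^*$, and outputs a guess $b'$. Its advantage is $\Pr[b'=b]-\frac12$, as a function of $n$. A scheme is IND-ID-CPA secure if every such adversary has negligible advantage. **Quadratic residuosity assumption.** For every probabilistic polynomial-time algorithm that gets $n$, the modulus $N$ produced by $\mathsf{Setup}$, and a uniformly random $x\in\mathbb Z_N^*[+1]$, the probability that it decides correctly whether $x$ is a square modulo $N$ differs from $\frac12$ by a negligible function of $n$. **Theorem.** 1. Under the quadratic residuosity assumption, $\mathsf{xhIBE}$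 is IND-ID-CPA secure in the random oracle model. 2. (Without any assumption.) For every probabilistic polynomial-time IND-ID-CPA adversary $\mathcal A$ against $\mathsf{xhIBE}$ there is a probabilistic polynomial-time IND-ID-CPA adversary $\mathcal S$ against the Cocks IBE whose advantage is that of $\mathcal A$ up to a negligible function of $n$. -/

import Mathlib

open Filter

noncomputable section

namespace XhIBE

/-! ### Sampling -/

/-- The uniform distribution on a finite set (a point mass at the default if the set is empty). -/
def uniformOn {α : Type} [Inhabited α] (S : Finset α) : PMF α :=
  if h : S.Nonempty then PMF.uniformOfFinset S h else PMF.pure default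

/-! ### Probabilistic polynomial-time oracle machines

A random access machine over the natural numbers with logarithmic cost: memory consists of arrays
of natural numbers, all initially `0`, and an operation is charged the bit lengths of its operands.
Programs may sample uniformly and may call two oracles. Loops are executed a number of times that
is computed when the loop is entered; a loop with an arbitrary exit condition in a program with
time bound `P` is obtained by running `P` rounds that first test the condition, so that the
functions computable in polynomial time are the usual ones. -/

/-- Binary operations of the machine; comparisons return `0` or `1`. -/
inductive Op
  | add | sub | mul | div | mod | eq | lt

def Op.eval : Op → ℕ → ℕ → ℕ
  | .add, x, y => x + y
  | .sub, x, y => x - y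
  | .mul, x, y => x * y
  | .div, x, y => x / y
  | .mod, x, y => x % y
  | .eq, x, y => if x = y then 1 else 0
  | .lt, x, y => if x < y then 1 else 0

/-- `m k i` is the content of cell `i` of array `k`. -/
abbrev Mem := ℕ → ℕ → ℕ

inductive Expr
  | const (n : ℕ)
  | load (k : ℕ) (i : Expr)
  | bin (o : Op) (e₁ e₂ : Expr)

def Expr.eval (m : Mem) : Expr → ℕ
  | .const n => n
  | .load k i => m k (i.eval m)
  | .bin o e₁ e₂ => o.eval (e₁.eval m) (e₂.eval m)

/-- The time needed to evaluate an expression. -/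
def Expr.cost (m : Mem) : Expr → ℕ
  | .const n => 1 + n.size
  | .load k i => i.cost m + (1 + (i.eval m).size + (m k (i.eval m)).size)
  | .bin _ e₁ e₂ => e₁.cost m + e₂.cost m + (1 + (e₁.eval m).size + (e₂.eval m).size)

/-- The two oracles of a machine: the random oracle and the key extraction oracle. -/
inductive Query
  | hash | key

inductive Prog
  | skip
  /-- cell `i` of array `k` becomes `e` -/
  | set (k : ℕ) (i e : Expr)
  /-- cell `i` of array `k` becomes a uniformly random element of `{0, …, e - 1}` -/
  | rand (k : ℕ) (i e : Expr)
  /-- cell `i` of array `k` becomes the answer of oracle `o` to the query `e` -/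
  | call (o : Query) (k : ℕ) (i e : Expr)
  | seq (P Q : Prog)
  /-- run `P` if `e ≠ 0`, and `Q` otherwise -/
  | ite (e : Expr) (P Q : Prog)
  /-- run `P` as many times as the value of `e` on entry -/
  | loop (e : Expr) (P : Prog)

/-- Memory, state of the oracles, and time elapsed. -/
structure Config (σ : Type) where
  mem : Mem
  orc : σ
  time : ℕ

/-- An oracle with state: it maps a query and its state to a random answer and a new state. -/
abbrev Oracle (σ : Type) := Query → ℕ → σ → PMF (ℕ × σ)

def Mem.put (m : Mem) (k i v : ℕ) : Mem :=
  fun k' i' => if k' = k ∧ i' = i then v else m k' i'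

/-- Write a list of words into array `0`, from cell `0` on. -/
def Mem.write (m : Mem) (l : List ℕ) : Mem :=
  fun k i => if k = 0 ∧ i < l.length then l.getD i 0 else m k i

/-- A uniformly random natural number below `n` (and `0` if `n = 0`). -/
def below (n : ℕ) : PMF ℕ := uniformOn (Finset.range n)

/-- The distribution of the configuration after running a program. -/
def exec {σ : Type} (O : Oracle σ) : Prog → Config σ → PMF (Config σ)
  | .skip, c => PMF.pure ⟨c.mem, c.orc, c.time + 1⟩
  | .set k i e, c =>
      PMF.pure ⟨c.mem.put k (i.eval c.mem) (e.eval c.mem), c.orc,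
        c.time + (1 + i.cost c.mem + e.cost c.mem)⟩
  | .rand k i e, c => (below (e.eval c.mem)).bind fun v =>
      PMF.pure ⟨c.mem.put k (i.eval c.mem) v, c.orc,
        c.time + (1 + i.cost c.mem + e.cost c.mem)⟩
  | .call o k i e, c => (O o (e.eval c.mem) c.orc).bind fun r =>
      PMF.pure ⟨c.mem.put k (i.eval c.mem) r.1, r.2,
        c.time + (1 + i.cost c.mem + e.cost c.mem + r.1.size)⟩
  | .seq P Q, c => (exec O P c).bind (exec O Q)
  | .ite e P Q, c =>
      if e.eval c.mem ≠ 0 then exec O P ⟨c.mem, c.orc, c.time + (1 + e.cost c.mem)⟩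
      else exec O Q ⟨c.mem, c.orc, c.time + (1 + e.cost c.mem)⟩
  | .loop e P, c =>
      Nat.rec (motive := fun _ => PMF (Config σ))
        (PMF.pure ⟨c.mem, c.orc, c.time + (1 + e.cost c.mem)⟩)
        (fun _ μ => μ.bind fun c' => exec O P ⟨c'.mem, c'.orc, c'.time + 1⟩)
        (e.eval c.mem)

/-- The start: all cells are `0`, except that array `0` holds the input. -/
def start {σ : Type} (input : List ℕ) (s : σ) : Config σ :=
  ⟨Mem.write (fun _ _ => 0) input, s, 0⟩

/-- An oracle that can give any answer below `B`. -/
def anyOracle (B : ℕ) : Oracle Unit := fun _ _ _ => (below B).map fun v => (v, ())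

/-- The oracle that always answers `0`, for machines that have no oracle. -/
def noOracle : Oracle Unit := fun _ _ _ => PMF.pure (0, ())

/-! ### Setup, hash function, key generation -/

/-- The pairs of distinct primes `p, q ≡ 3 (mod 4)` with exactly `n` bits. -/
def primePairs (n : ℕ) : Finset (ℕ × ℕ) :=
  (Finset.range (2 ^ n) ×ˢ Finset.range (2 ^ n)).filter fun x =>
    (x.1.Prime ∧ x.1 % 4 = 3 ∧ 2 ^ (n - 1) ≤ x.1) ∧
    (x.2.Prime ∧ x.2 % 4 = 3 ∧ 2 ^ (n - 1) ≤ x.2) ∧ x.1 ≠ x.2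

/-- The expectation of `f p q` for the uniformly random pair of primes `(p, q)` that `Setup` draws
for the security parameter `n` (and `0` in the degenerate case that there are no such primes). -/
def setupMean (n : ℕ) (f : ℕ → ℕ → ℝ) : ℝ :=
  (∑ x ∈ primePairs n, f x.1 x.2) / (primePairs n).card

/-- The encoding `0 ↦ 1`, `1 ↦ -1` of message bits. -/
def nu (b : Bool) : ℤ := if b then -1 else 1

/-- The elements of `ℤ_N` with Jacobi symbol `s`, as representatives in `{0, …, N - 1}`;
for `s = 1` and `s = -1` all of them are units. -/
def jac (N : ℕ) (s : ℤ) : Finset ℕ := (Finset.range N).filter fun t => jacobiSym (t : ℤ) N = s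

/-- The units of `ℤ_N`, as representatives in `{0, …, N - 1}`. -/
def units (N : ℕ) : Finset ℕ := (Finset.range N).filter fun g => g.Coprime N

/-- The state of the challenger: the values of the random oracle fixed so far, and the identities
whose keys have been extracted. An identity is a bit string; the string `w` is represented by the
number `n` for which `n + 1` has the binary expansion `1w`. -/
structure State where
  table : ℕ → Option ℕ
  keys : Finset ℕ

def State.empty : State := ⟨fun _ => none, ∅⟩

/-- The random function `H` from identities to the elements of `ℤ_N` with Jacobi symbol `1`,
sampled lazily. -/
def hashQuery (N id : ℕ) (st : State) : PMF (ℕ × State) :=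
  match st.table id with
  | some a => PMF.pure (a, st)
  | none => (uniformOn (jac N 1)).bind fun a =>
      PMF.pure (a, ⟨fun j => if j = id then some a else st.table j, st.keys⟩)

/-- The secret key `r = a ^ ((N + 5 - p - q) / 8) mod N` of an identity with hash value `a`. -/
def secretKey (p q a : ℕ) : ℕ := a ^ ((p * q + 5 - p - q) / 8) % (p * q)

/-- The oracles of the adversary. Key queries for the challenge identity `target` are refused
(the answer is `0`). -/
def ibeOracle (p q : ℕ) (target : Option ℕ) : Oracle State
  | .hash, id, st => hashQuery (p * q) id st
  | .key, id, st =>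
      if target = some id then PMF.pure (0, st)
      else (hashQuery (p * q) id st).bind fun r =>
        PMF.pure (secretKey p q r.1, ⟨r.2.table, insert id r.2.keys⟩)

/-! ### The two encryption algorithms

Each of them gets the modulus `N`, the hash value `a` of the identity and the message bit `b`. -/

/-- Encryption in the Cocks scheme: `(t₁ + a / t₁, t₂ - a / t₂)`. -/
def cocksEncrypt (N a : ℕ) (b : Bool) : PMF (List ℕ) :=
  (uniformOn (jac N (nu b) ×ˢ jac N (nu b))).map fun t =>
    [((t.1 : ZMod N) + a * (t.1 : ZMod N)⁻¹).val, ((t.2 : ZMod N) - a * (t.2 : ZMod N)⁻¹).val]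

/-- The polynomial `(t + a g² / t) + 2 g x` over `ℤ_N`, as the pair of its coefficients. -/
def cipherPoly (N : ℕ) (a : ZMod N) (t g : ℕ) : ZMod N × ZMod N :=
  ((t : ZMod N) + a * (g : ZMod N) ^ 2 * (t : ZMod N)⁻¹, 2 * (g : ZMod N))

/-- The generalized Galbraith test: the Jacobi symbol of `c₀² - c₁² a` modulo `N`. -/
def galbraith (N : ℕ) (a : ZMod N) (c : ZMod N × ZMod N) : ℤ :=
  jacobiSym ((c.1 ^ 2 - c.2 ^ 2 * a).val : ℤ) N

/-- The random choices `((t₁, t₂), (g₁, g₂))` that the encryption algorithm of `xhIBE` accepts. -/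
def xhCoins (N a : ℕ) (b : Bool) : Finset ((ℕ × ℕ) × (ℕ × ℕ)) :=
  ((jac N (nu b) ×ˢ jac N (nu b)) ×ˢ (units N ×ˢ units N)).filter fun w =>
    galbraith N (a : ZMod N) (cipherPoly N (a : ZMod N) w.1.1 w.2.1) = 1 ∧
    galbraith N (-(a : ZMod N)) (cipherPoly N (-(a : ZMod N)) w.1.2 w.2.2) = 1

/-- Encryption in `xhIBE`: the ciphertext `(c(x), d(x), a)`, where `c(x)` is built from `a` and
`d(x)` from `-a`. Repeating the choice until the Galbraith tests succeed gives the
uniform distribution on the accepted choices. -/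
def xhEncrypt (N a : ℕ) (b : Bool) : PMF (List ℕ) :=
  (uniformOn (xhCoins N a b)).map fun w =>
    let c := cipherPoly N (a : ZMod N) w.1.1 w.2.1
    let d := cipherPoly N (-(a : ZMod N)) w.1.2 w.2.2
    [c.1.val, c.2.val, d.1.val, d.2.val, a]

/-! ### The IND-ID-CPA game in the random oracle model -/

/-- An adversary: a machine for each of the two phases of the game. The memory of the first phase
is passed on to the second one. -/
structure Adversary where
  phase1 : Prog
  phase2 : Prog

/-- The game, for fixed primes `p, q` and security parameter `n`; the result says whether the
adversary wins. The first phase gets `N = p q` and `n`; it leaves `id, m₀, m₁` in the first three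
cells of array `0`. The challenge ciphertext for `id` and a random one of the two messages is
written to array `0`, and the second phase leaves its guess in the first cell. If the key of `id`
was extracted in the first phase, the adversary gets no challenge and its guess counts as `0`. -/
def game (encrypt : ℕ → ℕ → Bool → PMF (List ℕ)) (A : Adversary) (n p q : ℕ) : PMF Bool :=
  (exec (ibeOracle p q none) A.phase1 (start [p * q, n] State.empty)).bind fun c₁ =>
  (PMF.uniformOfFintype Bool).bind fun b =>
    if c₁.mem 0 0 ∈ c₁.orc.keys then PMF.pure (decide (b = false))
    else
      (hashQuery (p * q) (c₁.mem 0 0) c₁.orc).bind fun r =>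
      (encrypt (p * q) r.1 (if b then decide (c₁.mem 0 2 ≠ 0) else decide (c₁.mem 0 1 ≠ 0))).bind
        fun ct =>
      (exec (ibeOracle p q (some (c₁.mem 0 0))) A.phase2 ⟨c₁.mem.write ct, r.2, c₁.time⟩).map
        fun c₂ => decide (b = decide (c₂.mem 0 0 ≠ 0))

/-- The advantage `Pr[A wins] - 1 / 2` as a function of the security parameter. -/
def advantage (encrypt : ℕ → ℕ → Bool → PMF (List ℕ)) (A : Adversary) (n : ℕ) : ℝ :=
  setupMean n fun p q => (game encrypt A n p q true).toReal - 1 / 2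

/-- Polynomial running time of an adversary against a scheme whose ciphertexts have `k` words: some
polynomial in the security parameter bounds the total time of both phases, for all moduli, random
choices, oracle answers and challenges of at most `2 n` bits. -/
def Adversary.PolyTime (A : Adversary) (k : ℕ) : Prop :=
  ∃ P : Polynomial ℕ, ∀ n N : ℕ, N < 2 ^ (2 * n) →
    ∀ c₁ ∈ (exec (anyOracle (2 ^ (2 * n))) A.phase1 (start [N, n] ())).support,
    ∀ ct : List ℕ, ct.length = k → (∀ w ∈ ct, w < 2 ^ (2 * n)) →
    ∀ c₂ ∈ (exec (anyOracle (2 ^ (2 * n))) A.phase2 ⟨c₁.mem.write ct, (), c₁.time⟩).support,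
      c₂.time ≤ P.eval n

/-- A function of the security parameter is negligible if it tends to `0` faster than the
reciprocal of every polynomial. -/
def Negligible (f : ℕ → ℝ) : Prop :=
  Asymptotics.SuperpolynomialDecay atTop (fun n : ℕ => (n : ℝ)) f

/-- IND-ID-CPA security in the random oracle model of the scheme with the given encryption
algorithm, whose ciphertexts have `k` words. -/
def IndIdCpaSecure (encrypt : ℕ → ℕ → Bool → PMF (List ℕ)) (k : ℕ) : Prop :=
  ∀ A : Adversary, A.PolyTime k → Negligible (advantage encrypt A)

/-! ### The quadratic residuosity assumption -/

open Classical in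
/-- A machine gets `N = p q`, the security parameter `n` and a random `x` with Jacobi symbol `1`
modulo `N`; the result says whether it decides correctly if `x` is a square modulo `N`. -/
def qrGame (D : Prog) (n p q : ℕ) : PMF Bool :=
  (uniformOn (jac (p * q) 1)).bind fun x =>
    (exec noOracle D (start [p * q, n, x] ())).map fun c =>
      decide (c.mem 0 0 ≠ 0 ↔ IsSquare (x : ZMod (p * q)))

/-- Polynomial running time of a machine for the quadratic residuosity problem. -/
def QRPolyTime (D : Prog) : Prop :=
  ∃ P : Polynomial ℕ, ∀ n N x : ℕ, N < 2 ^ (2 * n) → x < 2 ^ (2 * n) →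
    ∀ c ∈ (exec noOracle D (start [N, n, x] ())).support, c.time ≤ P.eval n

/-- No probabilistic polynomial-time machine decides quadratic residuosity with non-negligible
advantage over guessing. -/
def QRAssumption : Prop :=
  ∀ D : Prog, QRPolyTime D →
    Negligible fun n => setupMean n fun p q => (qrGame D n p q true).toReal - 1 / 2

end XhIBE

end

/-!
Throughout, `N = p q` is a Blum integer (`Blum p q`), `chi` is the Jacobi symbol modulo `N`, and
`Quad a` is the ring `ℤ_N[x] / (x² - a)`.

**Ciphertexts.** A polynomial of an `xhIBE` ciphertext satisfies
`(t + a g² / t) + 2 g x = (t + g x)² / t` in `Quad a`; the second one, which has `-a` in place of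
`a`, has the same shape in `Quad (-a)`. Here `1 / t` may be any element with the Jacobi symbol
`ν(b)`, and such elements differ from each other by factors `± w²`. So the polynomial is
distributed like `± t₀ y²` for a fixed scalar `t₀` with this symbol and a random `y` in `Quad a`,
apart from the few `y` that violate a unit condition (`Blum.exists_mul_sum_coins`,
`Blum.coeps_mul_sum_coins_le`, `Blum.expect_xhEncrypt_le`). The distribution of `± t₀ y²`, called
`twist`, has two invariance properties. It depends on `t₀` only through its Jacobi symbol
(`Blum.expect_twist_C_congr`), and it does not depend on `t₀` at all if `a` has Jacobi symbol `1`
but is not a square, because then every scalar becomes a square in `Quad a`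
(`Blum.expect_twist_C_of_not_isSquare`). Exactly one of `a` and `-a` is a square, so only one of
the two polynomials carries the message.

**Reduction to the Cocks scheme.** The Cocks ciphertext component `t + a / t` gives the polynomial
`t + a / t + 2 x = (t + x)² / t`. Its product with a random `± y²` is distributed like `± y² / t`,
hence almost like a fresh `xhIBE` polynomial for the same message
(`Blum.expect_xhEncrypt_le_cocks`). The adversary `cocksAdversary` converts the challenge in this
way and otherwise runs the given adversary.

**Reduction from quadratic residuosity.** Given `x` with Jacobi symbol `1`, the program
`distinguisher` runs the adversary and answers its queries itself. New hash values are `± y⁴`, whose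
secret key is `± y²` with a sign that can be read off from `N` (`Blum.secretKey_eq`). For one query,
whose number `j` is guessed, the hash value is `± x y²`. If it belongs to the challenge identity,
with hash value `a`, then the challenge is `mixedEncrypt`: its first polynomial encrypts `m_b` and
its second one the other message, with a random `u` as the scalar for the bit `1`. If `u` has
Jacobi symbol `-1`, this cannot be told from a proper encryption, of `m_b` if `a` is a square and of
the other message if it is not (`Blum.expect_xhEncrypt_le_mixed`). A correct guess of the adversary
therefore tells whether `a`, and so `x`, is a square (`verdict_iff`). If `u` has Jacobi symbol
`1`, the challenge is independent of the messages
(`Blum.expect_mixedEncrypt_of_chi_eq_one`), and the answer is a coin toss. With the hybrid argument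
`Blum.game_le_sum_score` for the guess `j`, the success probability of the program is, up to a
negligible error, the average of that of the adversary and of coin tosses, with a polynomial number
of terms (`Blum.abs_qrGame_sub_le`).

**Comparing programs.** Distributions are compared by inequalities between expectations
`c * expect μ F ≤ expect ν F` for all `F ≥ 0`, with `c` a power of `coeps p q = 1 - eps p q` and
`eps p q = O(2⁻ⁿ)`. A one-sided comparison is enough for distributions on `Bool`, as it bounds both
outcomes from below (`abs_sub_le_of_dominated`). For runs of programs, `Simulation.stepLE` derives
such inequalities from those for single oracle calls, by means of a relation between configurations
and a weight. With weights `coeps p q ^ time` it shows that the simulated oracles lose a factor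
`coeps p q` for each query; with the weight `⊤` it is a statement about possible runs
(`stepLE_top_iff`), and gives the bounds for the running times of the reductions.
-/

open Filter

open scoped ENNReal

noncomputable section

namespace XhIBE

/-! ### Expectations -/

/-- The expectation of a function with values in `[0, ∞]` under a discrete distribution. -/
def expect {α : Type} (μ : PMF α) (f : α → ℝ≥0∞) : ℝ≥0∞ := ∑' a, μ a * f a

section Expect

variable {α β : Type}

@[simp] theorem expect_pure (a : α) (f : α → ℝ≥0∞) : expect (PMF.pure a) f = f a := by
  rw [expect, tsum_eq_single a]
  · simp
  · intro b hb
    simp [PMF.pure_apply, hb]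

theorem expect_bind (μ : PMF α) (k : α → PMF β) (f : β → ℝ≥0∞) :
    expect (μ.bind k) f = expect μ fun a => expect (k a) f := by
  simp only [expect, PMF.bind_apply, ← ENNReal.tsum_mul_right, ← ENNReal.tsum_mul_left]
  rw [ENNReal.tsum_comm]
  simp only [mul_assoc]

theorem expect_map (μ : PMF α) (g : α → β) (f : β → ℝ≥0∞) :
    expect (μ.map g) f = expect μ fun a => f (g a) := by
  rw [PMF.map, expect_bind]
  simp

theorem expect_mono_support {μ : PMF α} {f g : α → ℝ≥0∞} (h : ∀ a ∈ μ.support, f a ≤ g a) :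
    expect μ f ≤ expect μ g := by
  refine ENNReal.tsum_le_tsum fun a => ?_
  by_cases ha : a ∈ μ.support
  · gcongr
    exact h a ha
  · simp [(PMF.apply_eq_zero_iff μ a).2 ha]

theorem expect_mono {μ : PMF α} {f g : α → ℝ≥0∞} (h : ∀ a, f a ≤ g a) :
    expect μ f ≤ expect μ g :=
  expect_mono_support fun a _ => h a

theorem expect_congr_support {μ : PMF α} {f g : α → ℝ≥0∞} (h : ∀ a ∈ μ.support, f a = g a) :
    expect μ f = expect μ g :=
  le_antisymm (expect_mono_support fun a ha => (h a ha).le)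
    (expect_mono_support fun a ha => (h a ha).ge)

theorem expect_const_mul (μ : PMF α) (c : ℝ≥0∞) (f : α → ℝ≥0∞) :
    expect μ (fun a => c * f a) = c * expect μ f := by
  simp only [expect, ← ENNReal.tsum_mul_left]
  exact tsum_congr fun a => by ring

theorem expect_const (μ : PMF α) (c : ℝ≥0∞) : expect μ (fun _ => c) = c := by
  simp [expect, ENNReal.tsum_mul_right, PMF.tsum_coe]

theorem expect_add (μ : PMF α) (f g : α → ℝ≥0∞) :
    expect μ (fun a => f a + g a) = expect μ f + expect μ g := by
  simp only [expect, mul_add]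
  exact ENNReal.tsum_add

theorem expect_sum {ι : Type} (s : Finset ι) (μ : PMF α) (f : ι → α → ℝ≥0∞) :
    expect μ (fun a => ∑ i ∈ s, f i a) = ∑ i ∈ s, expect μ (f i) := by
  classical
  induction s using Finset.induction_on with
  | empty => simp [expect]
  | insert i s hi ih => simp only [Finset.sum_insert hi, expect_add, ih]

theorem expect_indicator (μ : PMF α) [DecidableEq α] (a : α) :
    expect μ (fun b => if b = a then 1 else 0) = μ a := by
  rw [expect, tsum_eq_single a]
  · simp
  · intro b hb
    simp [hb]

theorem expect_ite {p : Prop} [Decidable p] (μ ν : PMF α) (f : α → ℝ≥0∞) :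
    expect (if p then μ else ν) f = if p then expect μ f else expect ν f := by
  split_ifs <;> rfl

theorem expect_bool (μ : PMF Bool) (f : Bool → ℝ≥0∞) :
    expect μ f = μ true * f true + μ false * f false := by
  rw [expect, tsum_bool, add_comm]

theorem expect_coin (f : Bool → ℝ≥0∞) :
    expect (PMF.uniformOfFintype Bool) f = 2⁻¹ * (f true + f false) := by
  rw [expect_bool]
  simp [mul_add]

theorem expect_ne_zero {μ : PMF α} {f : α → ℝ≥0∞} (h : expect μ f ≠ 0) :
    ∃ a ∈ μ.support, f a ≠ 0 := by
  by_contra! hc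
  refine h (le_antisymm ?_ bot_le)
  calc expect μ f ≤ expect μ fun _ => 0 := expect_mono_support fun a ha => (hc a ha).le
    _ = 0 := expect_const μ 0

theorem expect_indicator_support {μ : PMF α} {a : α} (ha : a ∈ μ.support) [DecidableEq α] :
    expect μ (fun b => if b = a then 1 else 0) ≠ 0 := by
  rw [expect_indicator]
  exact ha

theorem expect_uniformOn [Inhabited α] {S : Finset α} (hS : S.Nonempty) (f : α → ℝ≥0∞) :
    expect (uniformOn S) f = (S.card : ℝ≥0∞)⁻¹ * ∑ a ∈ S, f a := by
  classical
  rw [expect, uniformOn, dif_pos hS, tsum_eq_sum (s := S), Finset.mul_sum]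
  · refine Finset.sum_congr rfl fun a ha => ?_
    rw [PMF.uniformOfFinset_apply_of_mem hS ha]
  · intro a ha
    rw [PMF.uniformOfFinset_apply_of_notMem hS ha, zero_mul]

theorem mem_support_uniformOn [Inhabited α] {S : Finset α} (hS : S.Nonempty) {a : α} :
    a ∈ (uniformOn S).support ↔ a ∈ S := by
  rw [uniformOn, dif_pos hS, PMF.mem_support_uniformOfFinset_iff]

theorem expect_below {n : ℕ} (hn : 0 < n) (f : ℕ → ℝ≥0∞) :
    expect (below n) f = (n : ℝ≥0∞)⁻¹ * ∑ a ∈ Finset.range n, f a := by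
  rw [below, expect_uniformOn (by simpa using hn.ne'), Finset.card_range]

theorem below_support {n v : ℕ} (hv : v ∈ (below n).support) : v < n ∨ (n = 0 ∧ v = 0) := by
  rcases Nat.eq_zero_or_pos n with rfl | hn
  · right
    simpa [below, uniformOn] using hv
  · left
    rw [below, mem_support_uniformOn (by simpa using hn.ne')] at hv
    simpa using hv

/-- If a distribution on `Bool` dominates another one up to a factor close to `1`, then the two
are close to each other. -/
theorem abs_sub_le_of_dominated {μ ν : PMF Bool} {ε : ℝ} (hε : 0 ≤ ε)
    (h : ∀ v, ENNReal.ofReal (1 - ε) * μ v ≤ ν v) :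
    |(μ true).toReal - (ν true).toReal| ≤ ε := by
  have sum (ρ : PMF Bool) : (ρ true).toReal + (ρ false).toReal = 1 := by
    rw [← ENNReal.toReal_add (ρ.apply_ne_top _) (ρ.apply_ne_top _), ← ENNReal.toReal_one]
    congr 1
    have := ρ.tsum_coe
    rwa [tsum_bool, add_comm] at this
  have key (v : Bool) : (1 - ε) * (μ v).toReal ≤ (ν v).toReal := by
    have := ENNReal.toReal_mono (ν.apply_ne_top v) (h v)
    rw [ENNReal.toReal_mul] at this
    refine le_trans ?_ this
    rw [ENNReal.toReal_ofReal']
    gcongr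
    exact le_max_left _ _
  have h1 := key true
  have h2 := key false
  have s1 := sum μ
  have s2 := sum ν
  have p1 : 0 ≤ (μ true).toReal := ENNReal.toReal_nonneg
  have p2 : 0 ≤ (μ false).toReal := ENNReal.toReal_nonneg
  rw [abs_le]
  constructor <;> nlinarith

end Expect

/-! ### Execution and expectations -/

section Exec

variable {σ : Type} (O : Oracle σ) (F : Config σ → ℝ≥0∞) (c : Config σ)

theorem expect_skip : expect (exec O .skip c) F = F ⟨c.mem, c.orc, c.time + 1⟩ := by
  simp [exec]

theorem expect_set (k : ℕ) (i e : Expr) : expect (exec O (.set k i e) c) F =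
    F ⟨c.mem.put k (i.eval c.mem) (e.eval c.mem), c.orc,
      c.time + (1 + i.cost c.mem + e.cost c.mem)⟩ := by
  simp [exec]

theorem expect_rand (k : ℕ) (i e : Expr) : expect (exec O (.rand k i e) c) F =
    expect (below (e.eval c.mem)) fun v => F ⟨c.mem.put k (i.eval c.mem) v, c.orc,
      c.time + (1 + i.cost c.mem + e.cost c.mem)⟩ := by
  simp [exec, expect_bind]

theorem expect_call (o : Query) (k : ℕ) (i e : Expr) : expect (exec O (.call o k i e) c) F =
    expect (O o (e.eval c.mem) c.orc) fun r => F ⟨c.mem.put k (i.eval c.mem) r.1, r.2,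
      c.time + (1 + i.cost c.mem + e.cost c.mem + r.1.size)⟩ := by
  simp [exec, expect_bind]

theorem expect_seq (P Q : Prog) : expect (exec O (.seq P Q) c) F =
    expect (exec O P c) fun c' => expect (exec O Q c') F := by
  simp [exec, expect_bind]

theorem expect_exec_ite (e : Expr) (P Q : Prog) : expect (exec O (.ite e P Q) c) F =
    if e.eval c.mem ≠ 0 then expect (exec O P ⟨c.mem, c.orc, c.time + (1 + e.cost c.mem)⟩) F
    else expect (exec O Q ⟨c.mem, c.orc, c.time + (1 + e.cost c.mem)⟩) F := by
  rw [exec, expect_ite]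

end Exec

/-- `loopDist O P c m` is the distribution after `m` rounds of a loop with body `P`. -/
def loopDist {σ : Type} (O : Oracle σ) (P : Prog) (c : Config σ) : ℕ → PMF (Config σ)
  | 0 => PMF.pure c
  | m + 1 => (loopDist O P c m).bind fun c' => exec O P ⟨c'.mem, c'.orc, c'.time + 1⟩

theorem exec_loop {σ : Type} (O : Oracle σ) (e : Expr) (P : Prog) (c : Config σ) :
    exec O (.loop e P) c =
      loopDist O P ⟨c.mem, c.orc, c.time + (1 + e.cost c.mem)⟩ (e.eval c.mem) := by
  rw [exec]
  induction e.eval c.mem with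
  | zero => rfl
  | succ m ih =>
    rw [loopDist, ← ih]

/-! ### Relating two executions -/

/-- Only arrays with index below `K` occur. -/
def Expr.Below (K : ℕ) : Expr → Prop
  | .const _ => True
  | .load k i => k < K ∧ i.Below K
  | .bin _ e₁ e₂ => e₁.Below K ∧ e₂.Below K

/-- Only arrays with index below `K` occur. -/
def Prog.Below (K : ℕ) : Prog → Prop
  | .skip => True
  | .set k i e | .rand k i e | .call _ k i e => k < K ∧ i.Below K ∧ e.Below K
  | .seq P Q => P.Below K ∧ Q.Below K
  | .ite e P Q => e.Below K ∧ P.Below K ∧ Q.Below K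
  | .loop e P => e.Below K ∧ P.Below K

theorem Expr.Below.mono {K L : ℕ} (h : K ≤ L) : ∀ {e : Expr}, e.Below K → e.Below L
  | .const _, _ => trivial
  | .load _ _, he => ⟨he.1.trans_le h, he.2.mono h⟩
  | .bin _ _ _, he => ⟨he.1.mono h, he.2.mono h⟩

theorem Prog.Below.mono {K L : ℕ} (h : K ≤ L) : ∀ {P : Prog}, P.Below K → P.Below L
  | .skip, _ => trivial
  | .set _ _ _, hP | .rand _ _ _, hP | .call _ _ _ _, hP =>
    ⟨hP.1.trans_le h, hP.2.1.mono h, hP.2.2.mono h⟩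
  | .seq _ _, hP => ⟨hP.1.mono h, hP.2.mono h⟩
  | .ite _ _ _, hP => ⟨hP.1.mono h, hP.2.1.mono h, hP.2.2.mono h⟩
  | .loop _ _, hP => ⟨hP.1.mono h, hP.2.mono h⟩

theorem Expr.exists_below (e : Expr) : ∃ K, e.Below K := by
  induction e with
  | const n => exact ⟨0, trivial⟩
  | load k i ih =>
    obtain ⟨K, hK⟩ := ih
    exact ⟨max K (k + 1), by simp, hK.mono (le_max_left _ _)⟩
  | bin o e₁ e₂ ih₁ ih₂ =>
    obtain ⟨K, hK⟩ := ih₁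
    obtain ⟨L, hL⟩ := ih₂
    exact ⟨max K L, hK.mono (le_max_left _ _), hL.mono (le_max_right _ _)⟩

theorem Prog.exists_below (P : Prog) : ∃ K, P.Below K := by
  have access (k : ℕ) (i e : Expr) : ∃ K, k < K ∧ i.Below K ∧ e.Below K := by
    obtain ⟨K, hK⟩ := i.exists_below
    obtain ⟨L, hL⟩ := e.exists_below
    exact ⟨max (k + 1) (max K L), by simp, hK.mono (by simp), hL.mono (by simp)⟩
  induction P with
  | skip => exact ⟨0, trivial⟩
  | set k i e => exact access k i e
  | rand k i e => exact access k i e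
  | call o k i e => exact access k i e
  | seq P Q ihP ihQ =>
    obtain ⟨K, hK⟩ := ihP
    obtain ⟨L, hL⟩ := ihQ
    exact ⟨max K L, hK.mono (by simp), hL.mono (by simp)⟩
  | ite e P Q ihP ihQ =>
    obtain ⟨J, hJ⟩ := e.exists_below
    obtain ⟨K, hK⟩ := ihP
    obtain ⟨L, hL⟩ := ihQ
    exact ⟨max J (max K L), hJ.mono (by simp), hK.mono (by simp), hL.mono (by simp)⟩
  | loop e P ihP =>
    obtain ⟨J, hJ⟩ := e.exists_below
    obtain ⟨K, hK⟩ := ihP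
    exact ⟨max J K, hJ.mono (by simp), hK.mono (by simp)⟩

/-- Two memories have the same contents in all arrays with index below `K`. -/
def Agree (K : ℕ) (m₁ m₂ : Mem) : Prop := ∀ k < K, ∀ i, m₁ k i = m₂ k i

theorem Agree.put {K : ℕ} {m₁ m₂ : Mem} (h : Agree K m₁ m₂) (k i v : ℕ) :
    Agree K (m₁.put k i v) (m₂.put k i v) := by
  intro k' hk' i'
  simp only [Mem.put]
  split_ifs
  · rfl
  · exact h k' hk' i'

theorem Agree.eval_eq {K : ℕ} {m₁ m₂ : Mem} (h : Agree K m₁ m₂) :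
    ∀ {e : Expr}, e.Below K → e.eval m₁ = e.eval m₂
  | .const _, _ => rfl
  | .load k i, he => by rw [Expr.eval, Expr.eval, h.eval_eq he.2, h k he.1]
  | .bin o e₁ e₂, he => by rw [Expr.eval, Expr.eval, h.eval_eq he.1, h.eval_eq he.2]

theorem Agree.cost_eq {K : ℕ} {m₁ m₂ : Mem} (h : Agree K m₁ m₂) :
    ∀ {e : Expr}, e.Below K → e.cost m₁ = e.cost m₂
  | .const _, _ => rfl
  | .load k i, he => by
    rw [Expr.cost, Expr.cost, h.eval_eq he.2, h.cost_eq he.2, h k he.1]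
  | .bin o e₁ e₂, he => by
    rw [Expr.cost, Expr.cost, h.eval_eq he.1, h.eval_eq he.2, h.cost_eq he.1, h.cost_eq he.2]

/-- Replace every oracle call of a program by the program that `f` provides for it. -/
def Prog.subst (f : Query → ℕ → Expr → Expr → Prog) : Prog → Prog
  | .skip => .skip
  | .set k i e => .set k i e
  | .rand k i e => .rand k i e
  | .call o k i e => f o k i e
  | .seq P Q => .seq (P.subst f) (Q.subst f)
  | .ite e P Q => .ite e (P.subst f) (Q.subst f)
  | .loop e P => .loop e (P.subst f)

theorem Prog.subst_call (P : Prog) : P.subst .call = P := by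
  induction P with
  | skip | set | rand | call => rfl
  | seq P Q ihP ihQ => rw [Prog.subst, ihP, ihQ]
  | ite e P Q ihP ihQ => rw [Prog.subst, ihP, ihQ]
  | loop e P ihP => rw [Prog.subst, ihP]

/-- The requirements on a relation `R` between the configurations of two machines, and on a weight
`W`, that allow to follow both machines through all steps other than oracle calls. -/
structure Simulation {σ₁ σ₂ : Type} (K : ℕ) (R : Config σ₁ → Config σ₂ → Prop)
    (W : Config σ₁ → Config σ₂ → ℝ≥0∞) : Prop where
  agree : ∀ {c₁ c₂}, R c₁ c₂ → Agree K c₁.mem c₂.mem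
  tick : ∀ {c₁ c₂}, R c₁ c₂ → ∀ d,
    R ⟨c₁.mem, c₁.orc, c₁.time + d⟩ ⟨c₂.mem, c₂.orc, c₂.time + d⟩ ∧
      W ⟨c₁.mem, c₁.orc, c₁.time + d⟩ ⟨c₂.mem, c₂.orc, c₂.time + d⟩ ≤ W c₁ c₂
  put : ∀ {c₁ c₂}, R c₁ c₂ → ∀ k i v d, k < K → v.size < d →
    R ⟨c₁.mem.put k i v, c₁.orc, c₁.time + d⟩ ⟨c₂.mem.put k i v, c₂.orc, c₂.time + d⟩ ∧
      W ⟨c₁.mem.put k i v, c₁.orc, c₁.time + d⟩ ⟨c₂.mem.put k i v, c₂.orc, c₂.time + d⟩ ≤ W c₁ c₂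

/-- The step from configurations `c₁`, `c₂` to distributions `μ₁`, `μ₂` respects `R` and `W`:
up to the weight, an expectation under `μ₂` is at most the corresponding one under `μ₁`. -/
def StepLE {σ₁ σ₂ : Type} (R : Config σ₁ → Config σ₂ → Prop)
    (W : Config σ₁ → Config σ₂ → ℝ≥0∞) (c₁ : Config σ₁) (c₂ : Config σ₂)
    (μ₁ : PMF (Config σ₁)) (μ₂ : PMF (Config σ₂)) : Prop :=
  ∀ F₁ F₂, (∀ c₁' c₂', R c₁' c₂' → F₂ c₂' ≤ W c₁' c₂' * F₁ c₁') →
    expect μ₂ F₂ ≤ W c₁ c₂ * expect μ₁ F₁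

theorem size_eval_le_cost (m : Mem) : ∀ e : Expr, (e.eval m).size ≤ e.cost m
  | .const n => by simp [Expr.eval, Expr.cost]
  | .load k i => by simp only [Expr.eval, Expr.cost]; omega
  | .bin o e₁ e₂ => by
    have h₁ := size_eval_le_cost m e₁
    have h₂ := size_eval_le_cost m e₂
    have key : (o.eval (e₁.eval m) (e₂.eval m)).size ≤
        (e₁.eval m).size + (e₂.eval m).size + 1 := by
      generalize e₁.eval m = x
      generalize e₂.eval m = y
      have hx := Nat.lt_size_self x
      have hy := Nat.lt_size_self y
      have mono {z : ℕ} (hz : z ≤ x) : z.size ≤ x.size + y.size + 1 :=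
        (Nat.size_le_size hz).trans (by omega)
      cases o with
      | add =>
        rw [Op.eval, Nat.size_le]
        have h1 : 2 ^ x.size ≤ 2 ^ (x.size + y.size) := Nat.pow_le_pow_right (by simp) (by simp)
        have h2 : 2 ^ y.size ≤ 2 ^ (x.size + y.size) := Nat.pow_le_pow_right (by simp) (by simp)
        rw [pow_succ]
        omega
      | sub => exact mono (Nat.sub_le _ _)
      | mul =>
        rw [Op.eval, Nat.size_le, pow_succ, pow_add]
        have : x * y < 2 ^ x.size * 2 ^ y.size := Nat.mul_lt_mul'' hx hy
        omega
      | div => exact mono (Nat.div_le_self _ _)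
      | mod => exact mono (Nat.mod_le _ _)
      | eq | lt =>
        rw [Op.eval]
        split_ifs <;> simp
    simp only [Expr.eval, Expr.cost]
    omega

theorem below_support_size {n v : ℕ} (hv : v ∈ (below n).support) : v.size ≤ n.size := by
  rcases below_support hv with h | ⟨_, rfl⟩
  · exact Nat.size_le_size h.le
  · simp

section Relational

variable {σ₁ σ₂ : Type} {O₁ : Oracle σ₁} {O₂ : Oracle σ₂}
  {f₁ f₂ : Query → ℕ → Expr → Expr → Prog} {K : ℕ}
  {R : Config σ₁ → Config σ₂ → Prop} {W : Config σ₁ → Config σ₂ → ℝ≥0∞}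

/-- The fundamental lemma on pairs of executions: if two ways to answer oracle calls respect a
relation and a weight, then so do complete runs of a program. -/
theorem Simulation.stepLE (hR : Simulation K R W)
    (hcall : ∀ o k i e, k < K → i.Below K → e.Below K → ∀ c₁ c₂, R c₁ c₂ →
      StepLE R W c₁ c₂ (exec O₁ (f₁ o k i e) c₁) (exec O₂ (f₂ o k i e) c₂))
    (P : Prog) (hP : P.Below K) (c₁ : Config σ₁) (c₂ : Config σ₂) (h : R c₁ c₂) :
    StepLE R W c₁ c₂ (exec O₁ (P.subst f₁) c₁) (exec O₂ (P.subst f₂) c₂) := by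
  have pull {c₁ c₂ c₁' c₂'} (x : ℝ≥0∞) (h : W c₁' c₂' ≤ W c₁ c₂) :
      W c₁' c₂' * x ≤ W c₁ c₂ * x := by gcongr
  induction P generalizing c₁ c₂ with
  | skip =>
    intro F₁ F₂ hF
    simp only [Prog.subst, expect_skip]
    exact (hF _ _ (hR.tick h 1).1).trans (pull _ (hR.tick h 1).2)
  | set k i e =>
    intro F₁ F₂ hF
    simp only [Prog.subst, expect_set]
    rw [← (hR.agree h).eval_eq hP.2.1, ← (hR.agree h).eval_eq hP.2.2,
      ← (hR.agree h).cost_eq hP.2.1, ← (hR.agree h).cost_eq hP.2.2]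
    have := hR.put h k (i.eval c₁.mem) (e.eval c₁.mem) (1 + i.cost c₁.mem + e.cost c₁.mem) hP.1
      (by have := size_eval_le_cost c₁.mem e; omega)
    exact (hF _ _ this.1).trans (pull _ this.2)
  | rand k i e =>
    intro F₁ F₂ hF
    simp only [Prog.subst, expect_rand]
    rw [← (hR.agree h).eval_eq hP.2.1, ← (hR.agree h).eval_eq hP.2.2,
      ← (hR.agree h).cost_eq hP.2.1, ← (hR.agree h).cost_eq hP.2.2, ← expect_const_mul]
    refine expect_mono_support fun v hv => ?_
    have := hR.put h k (i.eval c₁.mem) v (1 + i.cost c₁.mem + e.cost c₁.mem) hP.1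
      (by have := size_eval_le_cost c₁.mem e; have := below_support_size hv; omega)
    exact (hF _ _ this.1).trans (pull _ this.2)
  | call o k i e => exact hcall o k i e hP.1 hP.2.1 hP.2.2 c₁ c₂ h
  | seq P Q ihP ihQ =>
    intro F₁ F₂ hF
    simp only [Prog.subst, expect_seq]
    exact ihP hP.1 c₁ c₂ h _ _ fun c₁' c₂' h' => ihQ hP.2 c₁' c₂' h' _ _ hF
  | ite e P Q ihP ihQ =>
    intro F₁ F₂ hF
    simp only [Prog.subst, expect_exec_ite]
    rw [← (hR.agree h).eval_eq hP.1, ← (hR.agree h).cost_eq hP.1]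
    have := hR.tick h (1 + e.cost c₁.mem)
    split_ifs
    · exact (ihP hP.2.1 _ _ this.1 _ _ hF).trans (pull _ this.2)
    · exact (ihQ hP.2.2 _ _ this.1 _ _ hF).trans (pull _ this.2)
  | loop e P ihP =>
    intro F₁ F₂ hF
    simp only [Prog.subst, exec_loop]
    rw [← (hR.agree h).eval_eq hP.1, ← (hR.agree h).cost_eq hP.1]
    have := hR.tick h (1 + e.cost c₁.mem)
    refine le_trans ?_ (pull _ this.2)
    generalize Config.mk c₁.mem c₁.orc (c₁.time + (1 + e.cost c₁.mem)) = d₁ at *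
    generalize Config.mk c₂.mem c₂.orc (c₂.time + (1 + e.cost c₁.mem)) = d₂ at *
    induction e.eval c₁.mem generalizing F₁ F₂ with
    | zero =>
      simp only [loopDist, expect_pure]
      exact hF _ _ this.1
    | succ m ih =>
      simp only [loopDist, expect_bind]
      refine ih _ _ fun c₁' c₂' h' => ?_
      have t := hR.tick h' 1
      exact (ihP hP.2 _ _ t.1 _ _ hF).trans (pull _ t.2)

end Relational

section Relational

variable {σ₁ σ₂ : Type} {R : Config σ₁ → Config σ₂ → Prop} {W : Config σ₁ → Config σ₂ → ℝ≥0∞}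
  {c₁ : Config σ₁} {c₂ : Config σ₂} {μ₁ : PMF (Config σ₁)} {μ₂ : PMF (Config σ₂)}

/-- The functions only need to be compared on the support of the second distribution. -/
theorem StepLE.expect_le (h : StepLE R W c₁ c₂ μ₁ μ₂) {F₁ F₂}
    (hF : ∀ c₁' c₂', R c₁' c₂' → c₂' ∈ μ₂.support → F₂ c₂' ≤ W c₁' c₂' * F₁ c₁') :
    expect μ₂ F₂ ≤ W c₁ c₂ * expect μ₁ F₁ := by
  classical
  have : expect μ₂ F₂ = expect μ₂ fun c => if c ∈ μ₂.support then F₂ c else 0 :=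
    expect_congr_support fun c hc => by rw [if_pos hc]
  rw [this]
  refine h _ _ fun c₁' c₂' h' => ?_
  split_ifs with hc
  · exact hF c₁' c₂' h' hc
  · exact bot_le

/-- With infinite weight, a `StepLE` only compares the supports. -/
theorem stepLE_top_iff : StepLE R (fun _ _ => ⊤) c₁ c₂ μ₁ μ₂ ↔
    ∀ c₂' ∈ μ₂.support, ∃ c₁' ∈ μ₁.support, R c₁' c₂' := by
  classical
  constructor
  · intro h c₂' hc₂'
    have h1 := h (fun c => if R c c₂' then 1 else 0) (fun c => if c = c₂' then 1 else 0)
      fun c d hcd => by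
        split_ifs <;> simp_all
    have h2 := expect_indicator_support hc₂'
    obtain ⟨c₁', h3, h4⟩ := expect_ne_zero (μ := μ₁) (f := fun c => if R c c₂' then 1 else 0)
      fun h0 => h2 (le_antisymm (h1.trans (by rw [h0, mul_zero])) bot_le)
    exact ⟨c₁', h3, by simpa using h4⟩
  · intro h F₁ F₂ hF
    by_cases h0 : expect μ₁ F₁ = 0
    · rw [h0, mul_zero]
      have hz : ∀ c₁' ∈ μ₁.support, F₁ c₁' = 0 := by
        intro c hc
        have := ENNReal.tsum_eq_zero.1 h0 c
        exact (mul_eq_zero.1 this).resolve_left hc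
      refine (expect_mono_support (g := fun _ => 0) fun c₂' hc₂' => ?_).trans (expect_const _ _).le
      obtain ⟨c₁', h1, h2⟩ := h c₂' hc₂'
      simpa [hz c₁' h1] using hF c₁' c₂' h2
    · rw [ENNReal.top_mul h0]
      exact le_top

end Relational

/-- Two runs of a program that uses arrays below `K` only, in memories that agree on these arrays:
the other arrays keep the contents `h₁` and `h₂`, and the clocks differ by a constant. -/
structure Framed {σ : Type} (K : ℕ) (h₁ h₂ : Mem) (d₁ d₂ : ℕ) (c₁ c₂ : Config σ) : Prop where
  agree : Agree K c₁.mem c₂.mem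
  orc : c₁.orc = c₂.orc
  left : ∀ k ≥ K, ∀ i, c₁.mem k i = h₁ k i
  right : ∀ k ≥ K, ∀ i, c₂.mem k i = h₂ k i
  time : c₁.time + d₂ = c₂.time + d₁

theorem Mem.put_of_ne {m : Mem} {k i v k' i' : ℕ} (h : k' ≠ k) : m.put k i v k' i' = m k' i' := by
  simp [Mem.put, h]

theorem framed_simulation {σ : Type} (K : ℕ) (h₁ h₂ : Mem) (d₁ d₂ : ℕ) (w : ℝ≥0∞) :
    Simulation K (Framed (σ := σ) K h₁ h₂ d₁ d₂) fun _ _ => w where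
  agree h := h.agree
  tick h d := ⟨⟨h.agree, h.orc, h.left, h.right, by have := h.time; simp only; omega⟩, le_rfl⟩
  put h k i v d hk _ := ⟨⟨h.agree.put k i v, h.orc,
    fun k' hk' i' => (Mem.put_of_ne (hk.trans_le hk').ne').trans (h.left k' hk' i'),
    fun k' hk' i' => (Mem.put_of_ne (hk.trans_le hk').ne').trans (h.right k' hk' i'),
    by have := h.time; simp only; omega⟩, le_rfl⟩

/-- A program behaves the same in memories that agree on the arrays that it uses. -/
theorem Framed.stepLE {σ : Type} (O : Oracle σ) {K : ℕ} {h₁ h₂ : Mem} {d₁ d₂ : ℕ} (w : ℝ≥0∞)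
    {P : Prog} (hP : P.Below K) {c₁ c₂ : Config σ} (h : Framed K h₁ h₂ d₁ d₂ c₁ c₂) :
    StepLE (Framed K h₁ h₂ d₁ d₂) (fun _ _ => w) c₁ c₂ (exec O P c₁) (exec O P c₂) := by
  have := (framed_simulation K h₁ h₂ d₁ d₂ w).stepLE (O₁ := O) (O₂ := O)
    (f₁ := .call) (f₂ := .call) ?_ P hP c₁ c₂ h
  · rwa [Prog.subst_call] at this
  · intro o k i e hk hi he c₁ c₂ h F₁ F₂ hF
    rw [expect_call, expect_call, ← h.agree.eval_eq hi, ← h.agree.eval_eq he,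
      ← h.agree.cost_eq hi, ← h.agree.cost_eq he, ← h.orc, ← expect_const_mul]
    refine expect_mono fun r => hF _ _ ⟨h.agree.put _ _ _, rfl, fun k' hk' i' => ?_,
      fun k' hk' i' => ?_, ?_⟩
    · exact (Mem.put_of_ne (hk.trans_le hk').ne').trans (h.left k' hk' i')
    · exact (Mem.put_of_ne (hk.trans_le hk').ne').trans (h.right k' hk' i')
    · have := h.time
      simp only
      omega

/-! ### Sizes of memory cells, and programs without loops -/

/-- All cells have at most `L` bits. -/
def MemLE (L : ℕ) (m : Mem) : Prop := ∀ k i, (m k i).size ≤ L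

theorem MemLE.mono {L L' : ℕ} {m : Mem} (h : MemLE L m) (hL : L ≤ L') : MemLE L' m :=
  fun k i => (h k i).trans hL

theorem MemLE.put {L : ℕ} {m : Mem} (h : MemLE L m) {v : ℕ} (hv : v.size ≤ L) (k i : ℕ) :
    MemLE L (m.put k i v) := by
  intro k' i'
  rw [Mem.put]
  split_ifs
  · exact hv
  · exact h k' i'

theorem MemLE.write {L : ℕ} {m : Mem} (h : MemLE L m) {l : List ℕ} (hl : ∀ w ∈ l, w.size ≤ L) :
    MemLE L (m.write l) := by
  intro k i
  rw [Mem.write]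
  split_ifs with hi
  · rw [List.getD_eq_getElem _ _ hi.2]
    exact hl _ (List.getElem_mem _)
  · exact h k i

/-- Time only passes, and writing a number into memory takes at least as much time as the number
has bits. -/
theorem exec_support_mono {σ : Type} (O : Oracle σ) (P : Prog) {c c' : Config σ}
    (hc' : c' ∈ (exec O P c).support) {L : ℕ} (hc : MemLE (c.time + L) c.mem) :
    c.time ≤ c'.time ∧ MemLE (c'.time + L) c'.mem := by
  obtain ⟨K, hK⟩ := P.exists_below
  have hsim : Simulation K (fun c₁ c₂ : Config σ => c₁ = c₂ ∧ c.time ≤ c₂.time ∧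
      MemLE (c₂.time + L) c₂.mem) fun _ _ => ⊤ := by
    constructor
    · rintro c₁ _ ⟨rfl, _⟩ k _ i
      rfl
    · rintro c₁ _ ⟨rfl, h1, h2⟩ d
      exact ⟨⟨rfl, by simp only; omega, h2.mono (by simp only; omega)⟩, le_rfl⟩
    · rintro c₁ _ ⟨rfl, h1, h2⟩ k i v d hk hv
      refine ⟨⟨rfl, by simp only; omega, ?_⟩, le_rfl⟩
      exact (h2.mono (by simp only; omega)).put (by simp only; omega) _ _
  have := hsim.stepLE (O₁ := O) (O₂ := O) (f₁ := .call) (f₂ := .call) ?_ P hK c c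
    ⟨rfl, le_rfl, hc⟩
  · rw [Prog.subst_call, stepLE_top_iff] at this
    obtain ⟨c₁', _, rfl, h⟩ := this c' hc'
    exact h
  · rintro o k i e hk hi he c₁ _ ⟨rfl, h1, h2⟩
    rw [stepLE_top_iff]
    intro c₂' hc₂'
    refine ⟨c₂', hc₂', rfl, ?_⟩
    simp only [exec, PMF.mem_support_bind_iff, PMF.mem_support_pure_iff] at hc₂'
    obtain ⟨r, hr, rfl⟩ := hc₂'
    exact ⟨by simp only; omega, (h2.mono (by simp only; omega)).put (by simp only; omega) _ _⟩

/-- The program contains no loops; it may call oracles. -/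
def Prog.LoopFree : Prog → Prop
  | .seq P Q | .ite _ P Q => P.LoopFree ∧ Q.LoopFree
  | .loop _ _ => False
  | _ => True

theorem Expr.exists_cost_le (e : Expr) :
    ∃ C, ∀ L ≥ 1, ∀ m, MemLE L m → e.cost m ≤ C * L := by
  induction e with
  | const n =>
    refine ⟨1 + n.size, fun L hL m _ => ?_⟩
    rw [Expr.cost]
    exact Nat.le_mul_of_pos_right _ hL
  | load k i ih =>
    obtain ⟨C, hC⟩ := ih
    refine ⟨2 * C + 2, fun L hL m hm => ?_⟩
    rw [Expr.cost]
    have h1 := hC L hL m hm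
    have h2 := size_eval_le_cost m i
    have h3 := hm k (i.eval m)
    nlinarith
  | bin o e₁ e₂ ih₁ ih₂ =>
    obtain ⟨C, hC⟩ := ih₁
    obtain ⟨D, hD⟩ := ih₂
    refine ⟨2 * C + 2 * D + 1, fun L hL m hm => ?_⟩
    rw [Expr.cost]
    have h1 := hC L hL m hm
    have h2 := hD L hL m hm
    have h3 := size_eval_le_cost m e₁
    have h4 := size_eval_le_cost m e₂
    nlinarith

/-- A program without loops runs in linear time. -/
theorem Prog.LoopFree.exists_time_le {P : Prog} (hP : P.LoopFree) :
    ∃ C, 1 ≤ C ∧ ∀ L ≥ 1, ∀ (σ : Type) (O : Oracle σ),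
      (∀ q v s, ∀ r ∈ (O q v s).support, r.1.size ≤ L) →
      ∀ c, MemLE L c.mem → ∀ c' ∈ (exec O P c).support,
        c'.time ≤ c.time + C * L ∧ MemLE (C * L) c'.mem := by
  have access (i e : Expr) : ∃ C, 1 ≤ C ∧ ∀ L ≥ 1, ∀ m, MemLE L m →
      1 + i.cost m + e.cost m + L ≤ C * L ∧ (e.eval m).size ≤ C * L ∧ L ≤ C * L := by
    obtain ⟨C, hC⟩ := i.exists_cost_le
    obtain ⟨D, hD⟩ := e.exists_cost_le
    refine ⟨C + D + 2, by omega, fun L hL m hm => ?_⟩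
    have h1 := hC L hL m hm
    have h2 := hD L hL m hm
    have h3 := size_eval_le_cost m e
    refine ⟨?_, ?_, ?_⟩ <;> nlinarith
  induction P with
  | skip =>
    refine ⟨1, le_rfl, fun L hL σ O hO c hc c' hc' => ?_⟩
    simp only [exec, PMF.mem_support_pure_iff] at hc'
    subst hc'
    exact ⟨by simp only; omega, by simpa using hc⟩
  | set k i e =>
    obtain ⟨C, hC1, hC⟩ := access i e
    refine ⟨C, hC1, fun L hL σ O hO c hc c' hc' => ?_⟩
    simp only [exec, PMF.mem_support_pure_iff] at hc'
    subst hc'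
    obtain ⟨h1, h2, h3⟩ := hC L hL c.mem hc
    exact ⟨by simp only; omega, (hc.mono h3).put h2 _ _⟩
  | rand k i e =>
    obtain ⟨C, hC1, hC⟩ := access i e
    refine ⟨C, hC1, fun L hL σ O hO c hc c' hc' => ?_⟩
    simp only [exec, PMF.mem_support_bind_iff, PMF.mem_support_pure_iff] at hc'
    obtain ⟨v, hv, rfl⟩ := hc'
    obtain ⟨h1, h2, h3⟩ := hC L hL c.mem hc
    exact ⟨by simp only; omega, (hc.mono h3).put ((below_support_size hv).trans h2) _ _⟩
  | call o k i e =>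
    obtain ⟨C, hC1, hC⟩ := access i e
    refine ⟨C, hC1, fun L hL σ O hO c hc c' hc' => ?_⟩
    simp only [exec, PMF.mem_support_bind_iff, PMF.mem_support_pure_iff] at hc'
    obtain ⟨r, hr, rfl⟩ := hc'
    obtain ⟨h1, h2, h3⟩ := hC L hL c.mem hc
    have := hO _ _ _ r hr
    exact ⟨by simp only; omega, (hc.mono h3).put (this.trans h3) _ _⟩
  | seq P Q ihP ihQ =>
    obtain ⟨C, hC1, hC⟩ := ihP hP.1
    obtain ⟨D, hD1, hD⟩ := ihQ hP.2
    refine ⟨C + D * C, by omega, fun L hL σ O hO c hc c' hc' => ?_⟩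
    simp only [exec, PMF.mem_support_bind_iff] at hc'
    obtain ⟨d, hd, hc'⟩ := hc'
    obtain ⟨h1, h2⟩ := hC L hL σ O hO c hc d hd
    have h3 : L ≤ C * L := Nat.le_mul_of_pos_left _ hC1
    obtain ⟨h4, h5⟩ := hD (C * L) (by omega) σ O (fun q v s r hr => (hO q v s r hr).trans h3)
      d h2 c' hc'
    refine ⟨?_, h5.mono ?_⟩ <;> rw [add_mul, mul_assoc] <;> omega
  | ite e P Q ihP ihQ =>
    obtain ⟨C, hC1, hC⟩ := ihP hP.1
    obtain ⟨D, hD1, hD⟩ := ihQ hP.2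
    obtain ⟨B, hB⟩ := e.exists_cost_le
    refine ⟨1 + B + C + D, by omega, fun L hL σ O hO c hc c' hc' => ?_⟩
    have h1 := hB L hL c.mem hc
    rw [exec] at hc'
    split_ifs at hc'
    · obtain ⟨h2, h3⟩ := hC L hL σ O hO ⟨c.mem, c.orc, c.time + (1 + e.cost c.mem)⟩ hc c' hc'
      refine ⟨?_, h3.mono ?_⟩ <;> simp only [add_mul] at * <;> omega
    · obtain ⟨h2, h3⟩ := hD L hL σ O hO ⟨c.mem, c.orc, c.time + (1 + e.cost c.mem)⟩ hc c' hc'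
      refine ⟨?_, h3.mono ?_⟩ <;> simp only [add_mul] at * <;> omega
  | loop e P => exact hP.elim

/-- Polynomials can be evaluated by expressions. -/
theorem exists_expr_polynomial (P : Polynomial ℕ) {K : ℕ} (x : Expr) (hx : x.Below K) :
    ∃ e : Expr, e.Below K ∧ ∀ m, e.eval m = P.eval (x.eval m) := by
  induction P using Polynomial.induction_on' with
  | add P Q hP hQ =>
    obtain ⟨e, he, h⟩ := hP
    obtain ⟨e', he', h'⟩ := hQ
    exact ⟨.bin .add e e', ⟨he, he'⟩, fun m => by
      simp [Expr.eval, Op.eval, h, h']⟩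
  | monomial j a =>
    induction j with
    | zero => exact ⟨.const a, trivial, fun m => by simp [Expr.eval]⟩
    | succ j ih =>
      obtain ⟨e, he, h⟩ := ih
      refine ⟨.bin .mul e x, ⟨he, hx⟩, fun m => ?_⟩
      rw [Expr.eval, Op.eval, h]
      simp [pow_succ, mul_assoc]

/-! ### Arithmetic modulo a Blum integer -/

/-- `p` and `q` are distinct and congruent to `3` modulo `4`; together with primality, `p * q` is
then a Blum integer. -/
structure Blum (p q : ℕ) : Prop where
  left : p % 4 = 3
  right : q % 4 = 3
  ne : p ≠ q

section Arithmetic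

variable {p q : ℕ} [hp : Fact p.Prime] [hq : Fact q.Prime]

/-- The Jacobi symbol on `ℤ_N`. -/
def chi {N : ℕ} (z : ZMod N) : ℤ := jacobiSym (z.val : ℤ) N

theorem Blum.coprime (h : Blum p q) : p.Coprime q :=
  (Nat.coprime_primes hp.out hq.out).2 h.ne

/-- The isomorphism of the Chinese remainder theorem. -/
def Blum.crt (h : Blum p q) : ZMod (p * q) ≃+* ZMod p × ZMod q :=
  ZMod.chineseRemainder h.coprime

instance : NeZero (p * q) := ⟨mul_ne_zero hp.out.ne_zero hq.out.ne_zero⟩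

theorem Blum.isUnit_iff (h : Blum p q) (z : ZMod (p * q)) :
    IsUnit z ↔ (h.crt z).1 ≠ 0 ∧ (h.crt z).2 ≠ 0 := by
  rw [← MulEquiv.isUnit_map h.crt, Prod.isUnit_iff, isUnit_iff_ne_zero, isUnit_iff_ne_zero]

theorem Blum.chi_eq (h : Blum p q) (z : ZMod (p * q)) :
    chi z = quadraticChar (ZMod p) (h.crt z).1 * quadraticChar (ZMod q) (h.crt z).2 := by
  have hz : h.crt z = ((z.val : ZMod p), (z.val : ZMod q)) := by
    conv_lhs => rw [← ZMod.natCast_zmod_val z, map_natCast]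
    rfl
  rw [chi, jacobiSym.mul_right, ← jacobiSym.legendreSym.to_jacobiSym,
    ← jacobiSym.legendreSym.to_jacobiSym, legendreSym, legendreSym, hz]
  simp

theorem Blum.chi_mul (h : Blum p q) (y z : ZMod (p * q)) : chi (y * z) = chi y * chi z := by
  simp only [h.chi_eq, map_mul, Prod.fst_mul, Prod.snd_mul]
  ring

theorem Blum.chi_ne_zero_iff (h : Blum p q) (z : ZMod (p * q)) : chi z ≠ 0 ↔ IsUnit z := by
  rw [h.isUnit_iff, h.chi_eq, mul_ne_zero_iff, Ne, Ne, quadraticChar_eq_zero_iff,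
    quadraticChar_eq_zero_iff]

theorem chi_trichotomy {N : ℕ} (z : ZMod N) : chi z = 0 ∨ chi z = 1 ∨ chi z = -1 :=
  jacobiSym.trichotomy _ _

theorem ringChar_ne_two {p : ℕ} [hp : Fact p.Prime] (h : p % 4 = 3) : ringChar (ZMod p) ≠ 2 := by
  rw [ZMod.ringChar_zmod_n]
  omega

theorem quadraticChar_neg_one_of_three_mod_four {p : ℕ} [hp : Fact p.Prime] (h : p % 4 = 3) :
    quadraticChar (ZMod p) (-1) = -1 := by
  rw [quadraticChar_neg_one (ringChar_ne_two h), ZMod.card, ZMod.χ₄_nat_three_mod_four h]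

theorem quadraticChar_neg_of_three_mod_four {p : ℕ} [hp : Fact p.Prime] (h : p % 4 = 3)
    (x : ZMod p) : quadraticChar (ZMod p) (-x) = - quadraticChar (ZMod p) x := by
  rw [← neg_one_mul, map_mul, quadraticChar_neg_one_of_three_mod_four h, neg_one_mul]

theorem Blum.chi_neg (h : Blum p q) (z : ZMod (p * q)) : chi (-z) = chi z := by
  rw [h.chi_eq, h.chi_eq, map_neg, Prod.fst_neg, Prod.snd_neg,
    quadraticChar_neg_of_three_mod_four h.left, quadraticChar_neg_of_three_mod_four h.right]
  ring

theorem Blum.chi_sq (h : Blum p q) {z : ZMod (p * q)} (hz : IsUnit z) : chi (z ^ 2) = 1 := by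
  have h0 := (h.chi_ne_zero_iff z).2 hz
  rw [sq, h.chi_mul]
  rcases chi_trichotomy z with h1 | h1 | h1 <;> simp_all

theorem Blum.chi_one (h : Blum p q) : chi (1 : ZMod (p * q)) = 1 := by
  simpa using h.chi_sq isUnit_one

theorem Blum.chi_inv (h : Blum p q) {z : ZMod (p * q)} (hz : IsUnit z) : chi z⁻¹ = chi z := by
  have h1 : chi z * chi z⁻¹ = 1 := by
    rw [← h.chi_mul, ZMod.mul_inv_of_unit z hz, h.chi_one]
  rcases chi_trichotomy z with h2 | h2 | h2 <;> rw [h2] at h1 ⊢ <;> omega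

theorem Blum.isSquare_iff (h : Blum p q) {z : ZMod (p * q)} (hz : IsUnit z) :
    IsSquare z ↔ quadraticChar (ZMod p) (h.crt z).1 = 1 ∧
      quadraticChar (ZMod q) (h.crt z).2 = 1 := by
  obtain ⟨h1, h2⟩ := (h.isUnit_iff z).1 hz
  rw [quadraticChar_one_iff_isSquare h1, quadraticChar_one_iff_isSquare h2]
  constructor
  · rintro ⟨y, rfl⟩
    rw [map_mul]
    exact ⟨⟨_, rfl⟩, ⟨_, rfl⟩⟩
  · rintro ⟨⟨x, hx⟩, ⟨y, hy⟩⟩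
    refine ⟨h.crt.symm (x, y), h.crt.injective ?_⟩
    rw [map_mul, RingEquiv.apply_symm_apply]
    exact Prod.ext hx hy

/-- Of a unit with Jacobi symbol `1` and its negative, exactly one is a square. -/
theorem Blum.isSquare_neg_iff (h : Blum p q) {z : ZMod (p * q)} (hz : chi z = 1) :
    IsSquare (-z) ↔ ¬ IsSquare z := by
  have hu : IsUnit z := (h.chi_ne_zero_iff z).1 (by rw [hz]; exact one_ne_zero)
  obtain ⟨h1, h2⟩ := (h.isUnit_iff z).1 hu
  rw [h.isSquare_iff hu, h.isSquare_iff hu.neg, map_neg, Prod.fst_neg, Prod.snd_neg,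
    quadraticChar_neg_of_three_mod_four h.left, quadraticChar_neg_of_three_mod_four h.right]
  rw [h.chi_eq] at hz
  rcases quadraticChar_dichotomy h1 with h3 | h3 <;>
    rcases quadraticChar_dichotomy h2 with h4 | h4 <;> rw [h3, h4] at hz ⊢ <;> simp_all

/-- The square of a unit is a fourth power, because `-1` is not a square modulo `p` and `q`. -/
theorem Blum.exists_sq_eq_pow_four (h : Blum p q) {w : ZMod (p * q)} (hw : IsUnit w) :
    ∃ v, IsUnit v ∧ w ^ 2 = v ^ 4 := by
  obtain ⟨h1, h2⟩ := (h.isUnit_iff w).1 hw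
  have root {r : ℕ} [Fact r.Prime] (hr : r % 4 = 3) {x : ZMod r} (hx : x ≠ 0) :
      ∃ y : ZMod r, x ^ 2 = y ^ 4 := by
    rcases quadraticChar_dichotomy hx with h3 | h3
    · obtain ⟨y, rfl⟩ := (quadraticChar_one_iff_isSquare hx).1 h3
      exact ⟨y, by ring⟩
    · have h4 : quadraticChar (ZMod r) (-x) = 1 := by
        rw [quadraticChar_neg_of_three_mod_four hr, h3, neg_neg]
      obtain ⟨y, hy⟩ := (quadraticChar_one_iff_isSquare (neg_ne_zero.2 hx)).1 h4
      exact ⟨y, by rw [← neg_sq, hy]; ring⟩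
  obtain ⟨x, hx⟩ := root h.left h1
  obtain ⟨y, hy⟩ := root h.right h2
  have hv : w ^ 2 = h.crt.symm (x, y) ^ 4 := by
    apply h.crt.injective
    rw [map_pow, map_pow, RingEquiv.apply_symm_apply]
    exact Prod.ext hx hy
  refine ⟨_, ?_, hv⟩
  have := hw.pow 2
  rw [hv] at this
  exact (isUnit_pow_iff (by norm_num)).1 this

theorem Blum.exists_eq_neg_one_pow_mul_sq (h : Blum p q) {z : ZMod (p * q)} (hz : chi z = 1) :
    ∃ s < 2, ∃ w, IsUnit w ∧ z = (-1) ^ s * w ^ 2 := by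
  have hu : IsUnit z := (h.chi_ne_zero_iff z).1 (by rw [hz]; exact one_ne_zero)
  by_cases hs : IsSquare z
  · obtain ⟨w, rfl⟩ := hs
    exact ⟨0, by norm_num, w, (IsUnit.mul_iff.1 hu).1, by ring⟩
  · obtain ⟨w, hw⟩ := (h.isSquare_neg_iff hz).2 hs
    have hw' := hu.neg
    rw [hw] at hw'
    exact ⟨1, by norm_num, w, (IsUnit.mul_iff.1 hw').1, by rw [← neg_neg z, hw]; ring⟩

theorem Blum.exists_chi_eq_neg_one (h : Blum p q) : ∃ t : ZMod (p * q), chi t = -1 := by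
  refine ⟨h.crt.symm (-1, 1), ?_⟩
  rw [h.chi_eq, RingEquiv.apply_symm_apply]
  simp [quadraticChar_neg_one_of_three_mod_four h.left]

/-! ### Sums over residue classes with given Jacobi symbol -/

/-- The values `t * f g` of a homomorphism `f` run through a coset, and each element of the coset is
attained equally often, namely as often as the kernel has elements. -/
theorem sum_comp_hom {G U : Type} [Group G] [Fintype G] [CommGroup U] [DecidableEq U]
    (f : G →* U) : ∃ m : ℕ, m ≠ 0 ∧ ∀ (t : U) (S : Finset U), (∀ z, z ∈ S ↔ ∃ g, t * f g = z) →
      ∀ H : U → ℝ≥0∞, ∑ g, H (t * f g) = m * ∑ z ∈ S, H z := by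
  refine ⟨(Finset.univ.filter fun g => f g = 1).card, ?_, fun t S hS H => ?_⟩
  · exact (Finset.card_pos.2 ⟨1, by simp⟩).ne'
  · rw [← Finset.sum_fiberwise_of_maps_to (s := Finset.univ) (t := S) (g := fun g => t * f g)
      fun g _ => (hS _).2 ⟨g, rfl⟩, Finset.mul_sum]
    refine Finset.sum_congr rfl fun z hz => ?_
    obtain ⟨g₀, rfl⟩ := (hS z).1 hz
    have hconst : ∀ g ∈ Finset.univ.filter (fun g => t * f g = t * f g₀),
        H (t * f g) = H (t * f g₀) := fun g hg => by rw [(Finset.mem_filter.1 hg).2]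
    rw [Finset.sum_congr rfl hconst, Finset.sum_const, nsmul_eq_mul]
    congr 2
    simp only [mul_right_inj]
    exact MonoidHom.card_fiber_eq_of_mem_range f ⟨g₀, rfl⟩ ⟨1, map_one f⟩

/-- The elements of `ℤ_N` with Jacobi symbol `s`. -/
def chiSet (N : ℕ) [NeZero N] (s : ℤ) : Finset (ZMod N) := Finset.univ.filter fun z => chi z = s

/-- The units of `ℤ_N`. -/
def unitSet (N : ℕ) [NeZero N] : Finset (ZMod N) := by
  classical exact Finset.univ.filter fun z => IsUnit z

theorem mem_chiSet {N : ℕ} [NeZero N] {s : ℤ} {z : ZMod N} : z ∈ chiSet N s ↔ chi z = s := by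
  simp [chiSet]

theorem mem_unitSet {N : ℕ} [NeZero N] {z : ZMod N} : z ∈ unitSet N ↔ IsUnit z := by
  simp [unitSet]

theorem sum_unitSet {N : ℕ} [NeZero N] (H : ZMod N → ℝ≥0∞) :
    ∑ z ∈ unitSet N, H z = ∑ u : (ZMod N)ˣ, H u := by
  symm
  refine Finset.sum_bij (fun u _ => (u : ZMod N)) ?_ ?_ ?_ ?_
  · exact fun u _ => mem_unitSet.2 u.isUnit
  · exact fun u _ v _ h => Units.ext h
  · rintro z hz
    obtain ⟨u, rfl⟩ := mem_unitSet.1 hz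
    exact ⟨u, Finset.mem_univ _, rfl⟩
  · exact fun u _ => rfl

theorem sum_intUnits (f : ℤˣ → ℝ≥0∞) : ∑ s : ℤˣ, f s = ∑ s ∈ Finset.range 2, f ((-1) ^ s) := by
  rw [Finset.sum_range_succ, Finset.sum_range_one]
  simp [UnitsInt.univ]

/-- If `f` is a power map such that `± f y` runs over all elements with Jacobi symbol `1`, then
`± t f y` is equidistributed among the elements with the same symbol as `t`. -/
theorem Blum.sum_signed_pow (h : Blum p q) (k : ℕ)
    (hk : ∀ z : ZMod (p * q), chi z = 1 ↔ ∃ s < 2, ∃ w, IsUnit w ∧ z = (-1) ^ s * w ^ k) :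
    ∃ m : ℕ, m ≠ 0 ∧ ∀ t : ZMod (p * q), IsUnit t → ∀ H : ZMod (p * q) → ℝ≥0∞,
      ∑ s ∈ Finset.range 2, ∑ y ∈ unitSet (p * q), H ((-1) ^ s * t * y ^ k) =
        m * ∑ z ∈ chiSet (p * q) (chi t), H z := by
  classical
  let f : ℤˣ × (ZMod (p * q))ˣ →* (ZMod (p * q))ˣ :=
    { toFun := fun x => Units.map (Int.castRingHom (ZMod (p * q))).toMonoidHom x.1 * x.2 ^ k
      map_one' := by simp
      map_mul' := fun x y => by
        rw [Prod.fst_mul, Prod.snd_mul, map_mul, mul_pow]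
        exact mul_mul_mul_comm _ _ _ _ }
  -- by `hk`, the coset `t * f` consists of the elements with the same Jacobi symbol as `t`
  obtain ⟨m, hm0, hm⟩ := sum_comp_hom f
  refine ⟨m, hm0, ?_⟩
  rintro _ ⟨t, rfl⟩ H
  have hf (s : ℕ) (u : (ZMod (p * q))ˣ) :
      ((t * f ((-1) ^ s, u) : (ZMod (p * q))ˣ) : ZMod (p * q)) = (-1) ^ s * t * u ^ k := by
    simp [f]
    ring
  have := hm t (Finset.univ.filter fun z => chi (z : ZMod (p * q)) = chi (t : ZMod (p * q))) ?_
    fun u => H u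
  · rw [Fintype.sum_prod_type, sum_intUnits] at this
    simp only [hf] at this
    simp only [sum_unitSet]
    rw [this]
    congr 1
    refine Finset.sum_bij (fun u _ => (u : ZMod (p * q))) ?_ ?_ ?_ ?_
    · exact fun u hu => mem_chiSet.2 (Finset.mem_filter.1 hu).2
    · exact fun u _ v _ h => Units.ext h
    · intro z hz
      rw [mem_chiSet] at hz
      obtain ⟨u, rfl⟩ := (h.chi_ne_zero_iff z).1
        (by rw [hz]; exact (h.chi_ne_zero_iff _).2 t.isUnit)
      exact ⟨u, by simpa using hz, rfl⟩
    · exact fun u _ => rfl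
  · intro z
    have h1 : chi (z : ZMod (p * q)) = chi (t : ZMod (p * q)) ↔
        chi ((t⁻¹ * z : (ZMod (p * q))ˣ) : ZMod (p * q)) = 1 := by
      have h2 : chi (z : ZMod (p * q)) =
          chi (t : ZMod (p * q)) * chi ((t⁻¹ * z : (ZMod (p * q))ˣ) : ZMod (p * q)) := by
        rw [← h.chi_mul, ← Units.val_mul, mul_inv_cancel_left]
      have h3 := (h.chi_ne_zero_iff _).2 t.isUnit
      rw [h2]
      exact mul_eq_left₀ h3
    simp only [Finset.mem_filter, Finset.mem_univ, true_and]
    rw [h1, hk]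
    constructor
    · rintro ⟨s, hs, _, ⟨w, rfl⟩, hw⟩
      refine ⟨((-1) ^ s, w), ?_⟩
      rw [← mul_inv_cancel_left t z, mul_right_inj]
      ext
      rw [hw]
      simp [f]
    · rintro ⟨⟨s, w⟩, rfl⟩
      rw [inv_mul_cancel_left]
      rcases Int.units_eq_one_or s with rfl | rfl
      · exact ⟨0, by norm_num, w, w.isUnit, by simp [f]⟩
      · exact ⟨1, by norm_num, w, w.isUnit, by simp [f]⟩

theorem Blum.sum_signed_sq (h : Blum p q) :
    ∃ m : ℕ, m ≠ 0 ∧ ∀ t : ZMod (p * q), IsUnit t → ∀ H : ZMod (p * q) → ℝ≥0∞,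
      ∑ s ∈ Finset.range 2, ∑ y ∈ unitSet (p * q), H ((-1) ^ s * t * y ^ 2) =
        m * ∑ z ∈ chiSet (p * q) (chi t), H z := by
  refine h.sum_signed_pow 2 fun z => ⟨h.exists_eq_neg_one_pow_mul_sq, ?_⟩
  rintro ⟨s, hs, w, hw, rfl⟩
  interval_cases s <;> simp [h.chi_neg, h.chi_sq hw]

theorem Blum.sum_signed_pow_four (h : Blum p q) :
    ∃ m : ℕ, m ≠ 0 ∧ ∀ t : ZMod (p * q), IsUnit t → ∀ H : ZMod (p * q) → ℝ≥0∞,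
      ∑ s ∈ Finset.range 2, ∑ y ∈ unitSet (p * q), H ((-1) ^ s * t * y ^ 4) =
        m * ∑ z ∈ chiSet (p * q) (chi t), H z := by
  refine h.sum_signed_pow 4 fun z => ⟨fun hz => ?_, ?_⟩
  · obtain ⟨s, hs, w, hw, rfl⟩ := h.exists_eq_neg_one_pow_mul_sq hz
    obtain ⟨v, hv, hwv⟩ := h.exists_sq_eq_pow_four hw
    exact ⟨s, hs, v, hv, by rw [hwv]⟩
  · rintro ⟨s, hs, w, hw, rfl⟩
    have : w ^ 4 = (w ^ 2) ^ 2 := by ring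
    rw [this]
    interval_cases s <;> simp [h.chi_neg, h.chi_sq (hw.pow 2)]

theorem Blum.card_unitSet : (unitSet (p * q)).card = (p * q).totient := by
  have := sum_unitSet (N := p * q) fun _ => 1
  simp only [Finset.sum_const, nsmul_eq_mul, mul_one, Finset.card_univ,
    ZMod.card_units_eq_totient] at this
  exact_mod_cast this

theorem Blum.card_chiSet (h : Blum p q) {s : ℤ} (hs : s = 1 ∨ s = -1) :
    2 * (chiSet (p * q) s).card = (p * q).totient := by
  obtain ⟨m, hm0, hm⟩ := h.sum_signed_sq
  obtain ⟨t, ht⟩ := h.exists_chi_eq_neg_one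
  have htu : IsUnit t := (h.chi_ne_zero_iff t).1 (by rw [ht]; norm_num)
  have h1 := hm 1 isUnit_one fun _ => 1
  have h2 := hm t htu fun _ => 1
  rw [h.chi_one] at h1
  rw [ht] at h2
  simp only [Finset.sum_const, nsmul_eq_mul, mul_one, Finset.card_range] at h1 h2
  have h3 : (chiSet (p * q) 1).card = (chiSet (p * q) (-1)).card := by
    have h4 := h1.symm.trans h2
    have h5 : m * (chiSet (p * q) 1).card = m * (chiSet (p * q) (-1)).card := by
      exact_mod_cast h4
    exact Nat.eq_of_mul_eq_mul_left (Nat.pos_of_ne_zero hm0) h5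
  have h6 : (chiSet (p * q) 1).card + (chiSet (p * q) (-1)).card = (p * q).totient := by
    rw [← Blum.card_unitSet, ← Finset.card_union_of_disjoint]
    · congr 1
      ext z
      rw [Finset.mem_union, mem_chiSet, mem_chiSet, mem_unitSet, ← h.chi_ne_zero_iff]
      rcases chi_trichotomy z with h7 | h7 | h7 <;> simp [h7]
    · rw [Finset.disjoint_left]
      intro z h7 h8
      rw [mem_chiSet] at h7 h8
      omega
  rcases hs with rfl | rfl <;> omega

theorem sum_jac {N : ℕ} [NeZero N] (s : ℤ) (F : ℕ → ℝ≥0∞) :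
    ∑ t ∈ jac N s, F t = ∑ z ∈ chiSet N s, F z.val := by
  refine Finset.sum_bij' (fun t _ => (t : ZMod N)) (fun z _ => z.val) ?_ ?_ ?_ ?_ ?_
  · intro t ht
    obtain ⟨h1, h2⟩ := Finset.mem_filter.1 ht
    rw [mem_chiSet, chi, ZMod.val_natCast_of_lt (Finset.mem_range.1 h1), h2]
  · intro z hz
    rw [mem_chiSet] at hz
    exact Finset.mem_filter.2 ⟨Finset.mem_range.2 (ZMod.val_lt z), hz⟩
  · intro t ht
    exact ZMod.val_natCast_of_lt (Finset.mem_range.1 (Finset.mem_filter.1 ht).1)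
  · intro z _
    exact ZMod.natCast_zmod_val z
  · intro t ht
    rw [ZMod.val_natCast_of_lt (Finset.mem_range.1 (Finset.mem_filter.1 ht).1)]

theorem card_jac {N : ℕ} [NeZero N] (s : ℤ) : (jac N s).card = (chiSet N s).card := by
  have := sum_jac (N := N) s fun _ => 1
  simp only [Finset.sum_const, nsmul_eq_mul, mul_one] at this
  exact_mod_cast this

theorem sum_units {N : ℕ} [NeZero N] (F : ℕ → ℝ≥0∞) :
    ∑ t ∈ units N, F t = ∑ z ∈ unitSet N, F z.val := by
  refine Finset.sum_bij' (fun t _ => (t : ZMod N)) (fun z _ => z.val) ?_ ?_ ?_ ?_ ?_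
  · intro t ht
    exact mem_unitSet.2 ((ZMod.isUnit_iff_coprime t N).2 (Finset.mem_filter.1 ht).2)
  · intro z hz
    rw [mem_unitSet, ← ZMod.natCast_zmod_val z, ZMod.isUnit_iff_coprime] at hz
    exact Finset.mem_filter.2 ⟨Finset.mem_range.2 (ZMod.val_lt z), hz⟩
  · intro t ht
    exact ZMod.val_natCast_of_lt (Finset.mem_range.1 (Finset.mem_filter.1 ht).1)
  · intro z _
    exact ZMod.natCast_zmod_val z
  · intro t ht
    rw [ZMod.val_natCast_of_lt (Finset.mem_range.1 (Finset.mem_filter.1 ht).1)]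

theorem sum_range_eq_sum_zmod {N : ℕ} [NeZero N] (F : ℕ → ℝ≥0∞) :
    ∑ t ∈ Finset.range N, F t = ∑ z : ZMod N, F z.val := by
  refine Finset.sum_bij' (fun t _ => (t : ZMod N)) (fun z _ => z.val) ?_ ?_ ?_ ?_ ?_
  · exact fun t _ => Finset.mem_univ _
  · exact fun z _ => Finset.mem_range.2 (ZMod.val_lt z)
  · exact fun t ht => ZMod.val_natCast_of_lt (Finset.mem_range.1 ht)
  · exact fun z _ => ZMod.natCast_zmod_val z
  · intro t ht
    rw [ZMod.val_natCast_of_lt (Finset.mem_range.1 ht)]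

end Arithmetic

/-! ### The ring `ℤ_N[x] / (x² - a)` -/

/-- The ring `ℤ_N[x] / (x² - a)`. -/
abbrev Quad {N : ℕ} (a : ZMod N) : Type := QuadraticAlgebra (ZMod N) a 0

instance {N : ℕ} [NeZero N] (a : ZMod N) : Fintype (Quad a) :=
  Fintype.ofEquiv _ (QuadraticAlgebra.equivProd a 0).symm

theorem sum_quad {N : ℕ} [NeZero N] {a : ZMod N} (F : Quad a → ℝ≥0∞) :
    ∑ y, F y = ∑ y₀, ∑ y₁, F ⟨y₀, y₁⟩ := by
  rw [← Fintype.sum_prod_type', ← (QuadraticAlgebra.equivProd a 0).symm.sum_comp]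
  rfl

/-- The distribution of `± P y²` for a random sign and a random `y` in `ℤ_N[x] / (x² - a)`. -/
def twist {N : ℕ} {a : ZMod N} (P : Quad a) : PMF (Quad a) :=
  (below 2).bind fun s => (below N).bind fun y₀ => (below N).map fun y₁ : ℕ =>
    (-1) ^ s * P * (⟨(y₀ : ZMod N), (y₁ : ZMod N)⟩ : Quad a) ^ 2

theorem expect_twist {N : ℕ} [NeZero N] {a : ZMod N} (P : Quad a) (F : Quad a → ℝ≥0∞) :
    expect (twist P) F =
      (2 * N * N : ℝ≥0∞)⁻¹ * ∑ s ∈ Finset.range 2, ∑ y, F ((-1) ^ s * P * y ^ 2) := by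
  have hN : 0 < N := NeZero.pos N
  have hN' : (N : ℝ≥0∞) ≠ 0 := by exact_mod_cast hN.ne'
  have hinv : (2 * N * N : ℝ≥0∞)⁻¹ = 2⁻¹ * (N : ℝ≥0∞)⁻¹ * (N : ℝ≥0∞)⁻¹ := by
    rw [ENNReal.mul_inv (Or.inr (by simp)) (Or.inr hN'),
      ENNReal.mul_inv (Or.inr (by simp)) (Or.inr hN')]
  simp only [twist, expect_bind, expect_map, expect_below hN, expect_below two_pos,
    sum_range_eq_sum_zmod (N := N), ZMod.natCast_zmod_val, sum_quad, ← Finset.mul_sum]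
  rw [hinv, Nat.cast_ofNat]
  ring

/-- Multiplication by `z` permutes the elements `y`, so a factor `z²` can be absorbed in `y²`. -/
theorem expect_twist_mul_sq {N : ℕ} [NeZero N] {a : ZMod N} (P : Quad a) {z : Quad a}
    (hz : IsUnit z) (F : Quad a → ℝ≥0∞) :
    expect (twist (P * z ^ 2)) F = expect (twist P) F := by
  obtain ⟨u, rfl⟩ := hz
  rw [expect_twist, expect_twist]
  congr 1
  refine Finset.sum_congr rfl fun s _ => ?_
  rw [← Equiv.sum_comp (Units.mulLeft u) fun y => F ((-1) ^ s * P * y ^ 2)]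
  refine Finset.sum_congr rfl fun y _ => ?_
  rw [Units.mulLeft_apply, mul_pow]
  congr 1
  ring

theorem expect_twist_neg {N : ℕ} [NeZero N] {a : ZMod N} (P : Quad a) (F : Quad a → ℝ≥0∞) :
    expect (twist (-P)) F = expect (twist P) F := by
  rw [expect_twist, expect_twist]
  simp [Finset.sum_range_succ, add_comm]

/-- The error bound for events that only happen for few residue classes modulo `p` or `q`. -/
def eps (p q : ℕ) : ℝ := 16 * ((p : ℝ)⁻¹ + (q : ℝ)⁻¹)

theorem eps_nonneg (p q : ℕ) : 0 ≤ eps p q := by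
  unfold eps
  positivity

/-- The complementary probability to `eps p q`. -/
def coeps (p q : ℕ) : ℝ≥0∞ := ENNReal.ofReal (1 - eps p q)

theorem coeps_le_one (p q : ℕ) : coeps p q ≤ 1 := by
  rw [coeps, ← ENNReal.ofReal_one]
  exact ENNReal.ofReal_le_ofReal (by linarith [eps_nonneg p q])

theorem coeps_mul_le {p q A B : ℕ} (h : (A : ℝ) ≤ B + eps p q * A) : coeps p q * A ≤ B := by
  rw [coeps, ← ENNReal.ofReal_natCast, ← ENNReal.ofReal_natCast,
    ← ENNReal.ofReal_mul' (Nat.cast_nonneg A)]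
  exact ENNReal.ofReal_le_ofReal (by linarith)

section Arithmetic

variable {p q : ℕ} [hp : Fact p.Prime] [hq : Fact q.Prime]

theorem isUnit_C {N : ℕ} {a t : ZMod N} (ht : IsUnit t) :
    IsUnit (QuadraticAlgebra.C t : Quad a) := by
  rw [QuadraticAlgebra.isUnit_iff_norm_isUnit]
  simpa [QuadraticAlgebra.norm_def] using ht.mul ht

/-- The distribution of `± t y²` only depends on the Jacobi symbol of the scalar `t`. -/
theorem Blum.expect_twist_C_congr (h : Blum p q) {a t t' : ZMod (p * q)} (ht : IsUnit t)
    (htt' : chi t = chi t') (F : Quad a → ℝ≥0∞) :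
    expect (twist (.C t : Quad a)) F = expect (twist (.C t' : Quad a)) F := by
  have h1 : chi (t⁻¹ * t') = 1 := by
    rw [h.chi_mul, ← htt', ← h.chi_mul, ZMod.inv_mul_of_unit t ht, h.chi_one]
  obtain ⟨s, hs, w, hw, hz⟩ := h.exists_eq_neg_one_pow_mul_sq h1
  have h2 : t' = (-1) ^ s * t * w ^ 2 := by
    calc t' = t * (t⁻¹ * t') := by rw [← mul_assoc, ZMod.mul_inv_of_unit t ht, one_mul]
      _ = _ := by rw [hz, mul_left_comm, mul_assoc]
  have h3 : (QuadraticAlgebra.C t' : Quad a) =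
      (-1) ^ s * QuadraticAlgebra.C t * (QuadraticAlgebra.C w) ^ 2 := by
    rw [h2]
    simp [QuadraticAlgebra.C_mul, QuadraticAlgebra.C_pow]
  rw [h3, expect_twist_mul_sq _ (isUnit_C hw)]
  interval_cases s
  · simp
  · rw [pow_one, neg_one_mul, expect_twist_neg]

/-- If `a` is not a square modulo `p` and modulo `q`, then every scalar becomes a square in
`ℤ_N[x] / (x² - a)`. -/
theorem Blum.exists_sq_eq_C (h : Blum p q) {a t : ZMod (p * q)} (ha : chi a = 1)
    (hsq : ¬ IsSquare a) (ht : IsUnit t) : ∃ z : Quad a, IsUnit z ∧ z ^ 2 = .C t := by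
  have hau : IsUnit a := (h.chi_ne_zero_iff a).1 (by rw [ha]; exact one_ne_zero)
  obtain ⟨ha1, ha2⟩ := (h.isUnit_iff a).1 hau
  obtain ⟨ht1, ht2⟩ := (h.isUnit_iff t).1 ht
  rw [← h.isSquare_neg_iff ha, h.isSquare_iff hau.neg, map_neg, Prod.fst_neg, Prod.snd_neg,
    quadraticChar_neg_of_three_mod_four h.left, quadraticChar_neg_of_three_mod_four h.right] at hsq
  -- modulo each prime, the scalar `u` or `u / b` is a square, so `u` is the square of an element
  -- with one coordinate `0`
  have root {r : ℕ} [Fact r.Prime] {b u : ZMod r} (hb : b ≠ 0) (hu : u ≠ 0)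
      (hn : -quadraticChar (ZMod r) b = 1) :
      ∃ x y : ZMod r, x * x + b * (y * y) = u ∧ x * y = 0 := by
    rcases quadraticChar_dichotomy hu with h3 | h3
    · obtain ⟨x, hx⟩ := (quadraticChar_one_iff_isSquare hu).1 h3
      exact ⟨x, 0, by simp [hx], by simp⟩
    · have h4 : quadraticChar (ZMod r) (u * b) = 1 := by
        rw [map_mul, h3]
        omega
      obtain ⟨y, hy⟩ := (quadraticChar_one_iff_isSquare (mul_ne_zero hu hb)).1 h4
      refine ⟨0, y * b⁻¹, ?_, by simp⟩
      field_simp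
      linear_combination -hy
  obtain ⟨x₁, y₁, h1, h2⟩ := root ha1 ht1 hsq.1
  obtain ⟨x₂, y₂, h3, h4⟩ := root ha2 ht2 hsq.2
  have hz : (⟨h.crt.symm (x₁, x₂), h.crt.symm (y₁, y₂)⟩ : Quad a) ^ 2 = .C t := by
    rw [sq]
    ext
    · apply h.crt.injective
      simp only [QuadraticAlgebra.re_mul, QuadraticAlgebra.re_C, map_add, map_mul,
        RingEquiv.apply_symm_apply]
      refine Prod.ext ?_ ?_
      · simpa [mul_assoc] using h1
      · simpa [mul_assoc] using h3
    · apply h.crt.injective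
      simp only [QuadraticAlgebra.im_mul, QuadraticAlgebra.im_C, map_add, map_mul, map_zero,
        RingEquiv.apply_symm_apply]
      refine Prod.ext ?_ ?_
      · simp only [Prod.fst_add, Prod.fst_mul, Prod.fst_zero]
        linear_combination 2 * h2
      · simp only [Prod.snd_add, Prod.snd_mul, Prod.snd_zero]
        linear_combination 2 * h4
  refine ⟨_, ?_, hz⟩
  have := isUnit_C (a := a) ht
  rw [← hz] at this
  exact (isUnit_pow_iff two_ne_zero).1 this

/-- If `a` is not a square modulo `p` and modulo `q`, then the distribution of `± t y²` does not
depend on the scalar `t`. -/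
theorem Blum.expect_twist_C_of_not_isSquare (h : Blum p q) {a t t' : ZMod (p * q)}
    (ha : chi a = 1) (hsq : ¬ IsSquare a) (ht : IsUnit t) (ht' : IsUnit t') (F : Quad a → ℝ≥0∞) :
    expect (twist (.C t : Quad a)) F = expect (twist (.C t' : Quad a)) F := by
  have key {u : ZMod (p * q)} (hu : IsUnit u) :
      expect (twist (.C u : Quad a)) F = expect (twist (1 : Quad a)) F := by
    obtain ⟨z, hz, hzu⟩ := h.exists_sq_eq_C ha hsq hu
    rw [← hzu, ← one_mul (z ^ 2), expect_twist_mul_sq _ hz]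
  rw [key ht, key ht']

/-! ### Counting exceptional residue classes -/

theorem Blum.card_filter_crt_fst (h : Blum p q) (S : Finset (ZMod p)) :
    (Finset.univ.filter fun z => (h.crt z).1 ∈ S).card = S.card * q := by
  have : (Finset.univ.filter fun z => (h.crt z).1 ∈ S) =
      (S ×ˢ (Finset.univ : Finset (ZMod q))).map h.crt.symm.toEquiv.toEmbedding := by
    ext z
    simp only [Finset.mem_filter, Finset.mem_univ, true_and, Finset.mem_map, Finset.mem_product,
      and_true]
    constructor
    · exact fun hz => ⟨h.crt z, hz, h.crt.symm_apply_apply z⟩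
    · rintro ⟨x, hx, rfl⟩
      simpa using hx
  rw [this, Finset.card_map, Finset.card_product, Finset.card_univ, ZMod.card]

theorem Blum.card_filter_crt_snd (h : Blum p q) (S : Finset (ZMod q)) :
    (Finset.univ.filter fun z => (h.crt z).2 ∈ S).card = p * S.card := by
  have : (Finset.univ.filter fun z => (h.crt z).2 ∈ S) =
      ((Finset.univ : Finset (ZMod p)) ×ˢ S).map h.crt.symm.toEquiv.toEmbedding := by
    ext z
    simp only [Finset.mem_filter, Finset.mem_univ, true_and, Finset.mem_map, Finset.mem_product]
    constructor
    · exact fun hz => ⟨h.crt z, hz, h.crt.symm_apply_apply z⟩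
    · rintro ⟨x, hx, rfl⟩
      simpa using hx
  rw [this, Finset.card_map, Finset.card_product, Finset.card_univ, ZMod.card]

theorem card_filter_sq_eq_le {r : ℕ} [Fact r.Prime] (c : ZMod r) :
    (Finset.univ.filter fun x : ZMod r => x ^ 2 = c).card ≤ 2 := by
  rcases (Finset.univ.filter fun x : ZMod r => x ^ 2 = c).eq_empty_or_nonempty with h | ⟨x, hx⟩
  · simp [h]
  · refine (Finset.card_le_card (t := {x, -x}) fun y hy => ?_).trans Finset.card_le_two
    simp only [Finset.mem_filter, Finset.mem_univ, true_and] at hx hy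
    rw [← hx, sq_eq_sq_iff_eq_or_eq_neg] at hy
    simpa using hy

open Classical in
theorem Blum.card_not_isUnit_le (h : Blum p q) :
    (Finset.univ.filter fun z : ZMod (p * q) => ¬ IsUnit z).card ≤ p + q := by
  calc _ ≤ ((Finset.univ.filter fun z => (h.crt z).1 ∈ ({0} : Finset (ZMod p))) ∪
          Finset.univ.filter fun z => (h.crt z).2 ∈ ({0} : Finset (ZMod q))).card := by
        refine Finset.card_le_card fun z hz => ?_
        simp only [Finset.mem_filter, Finset.mem_univ, true_and, h.isUnit_iff] at hz
        simp only [Finset.mem_union, Finset.mem_filter, Finset.mem_univ, true_and,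
          Finset.mem_singleton]
        tauto
    _ ≤ _ := Finset.card_union_le _ _
    _ = p + q := by
        rw [h.card_filter_crt_fst, h.card_filter_crt_snd]
        simp [add_comm]

open Classical in
theorem Blum.card_not_isUnit_sq_sub_le (h : Blum p q) (c : ZMod (p * q)) :
    (Finset.univ.filter fun z : ZMod (p * q) => ¬ IsUnit (z ^ 2 - c)).card ≤ 2 * (p + q) := by
  calc _ ≤ ((Finset.univ.filter fun z => (h.crt z).1 ∈
            (Finset.univ.filter fun x : ZMod p => x ^ 2 = (h.crt c).1)) ∪
          Finset.univ.filter fun z => (h.crt z).2 ∈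
            (Finset.univ.filter fun x : ZMod q => x ^ 2 = (h.crt c).2)).card := by
        refine Finset.card_le_card fun z hz => ?_
        simp only [Finset.mem_filter, Finset.mem_univ, true_and, h.isUnit_iff, map_sub, map_pow,
          Prod.fst_sub, Prod.snd_sub, Prod.pow_fst, Prod.pow_snd, sub_ne_zero] at hz
        simp only [Finset.mem_union, Finset.mem_filter, Finset.mem_univ, true_and]
        tauto
    _ ≤ _ := Finset.card_union_le _ _
    _ ≤ 2 * q + p * 2 := by
        rw [h.card_filter_crt_fst, h.card_filter_crt_snd]
        gcongr <;> exact card_filter_sq_eq_le _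
    _ = 2 * (p + q) := by ring

theorem eps_mul_eq : eps p q * (p * q : ℕ) = 16 * (p + q) := by
  have := hp.out.ne_zero
  have := hq.out.ne_zero
  rw [eps]
  push_cast
  field_simp
  ring

theorem Blum.add_le_totient_add (h : Blum p q) : p * q ≤ (p * q).totient + (p + q) := by
  have := h.card_not_isUnit_le
  rw [← Blum.card_unitSet (p := p) (q := q)]
  have h2 := Finset.card_filter_add_card_filter_not (s := (Finset.univ : Finset (ZMod (p * q))))
    (fun z => IsUnit z)
  rw [Finset.card_univ, ZMod.card] at h2
  have h3 : unitSet (p * q) = Finset.univ.filter fun z => IsUnit z := by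
    ext z
    simp [mem_unitSet]
  rw [h3]
  convert (show p * q ≤ _ from (h2.symm.le.trans (Nat.add_le_add_left this _))) using 3

end Arithmetic

/-! ### Ciphertexts as random multiples of squares -/

/-- Comparison of a mean over `B` choices with a mean over `D` choices, if the first sum occurs `m`
times within the second one and `m * B` is almost `D`. -/
theorem mul_inv_mul_le {c X Y : ℝ≥0∞} {m B D : ℕ} (hD : D ≠ 0) (hc : c * D ≤ m * B)
    (hXY : m * X ≤ Y) : c * ((B : ℝ≥0∞)⁻¹ * X) ≤ (D : ℝ≥0∞)⁻¹ * Y := by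
  have hD' : (D : ℝ≥0∞) ≠ 0 := by exact_mod_cast hD
  have hc' : c ≤ m * B * (D : ℝ≥0∞)⁻¹ := by
    rw [← div_eq_mul_inv, ENNReal.le_div_iff_mul_le (Or.inl hD') (Or.inl (by simp))]
    exact hc
  rcases Nat.eq_zero_or_pos B with rfl | hB
  · have : c = 0 := by simpa using hc'
    rw [this, zero_mul]
    exact bot_le
  have hB' : (B : ℝ≥0∞) * (B : ℝ≥0∞)⁻¹ = 1 :=
    ENNReal.mul_inv_cancel (by exact_mod_cast hB.ne') (by simp)
  calc c * ((B : ℝ≥0∞)⁻¹ * X) ≤ m * B * (D : ℝ≥0∞)⁻¹ * ((B : ℝ≥0∞)⁻¹ * X) := by gcongr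
    _ = (B : ℝ≥0∞) * (B : ℝ≥0∞)⁻¹ * ((D : ℝ≥0∞)⁻¹ * (m * X)) := by ring
    _ ≤ (D : ℝ≥0∞)⁻¹ * Y := by
      rw [hB', one_mul]
      gcongr

/-- The random choices `(t, g)` for one of the two polynomials of an `xhIBE` ciphertext. -/
def coins (N : ℕ) (a : ZMod N) (b : Bool) : Finset (ℕ × ℕ) :=
  (jac N (nu b) ×ˢ units N).filter fun w => galbraith N a (cipherPoly N a w.1 w.2) = 1

theorem sum_xhCoins (N a : ℕ) (b : Bool) (F : (ℕ × ℕ) × (ℕ × ℕ) → ℝ≥0∞) :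
    ∑ w ∈ xhCoins N a b, F w =
      ∑ w ∈ coins N (a : ZMod N) b, ∑ w' ∈ coins N (-(a : ZMod N)) b,
        F ((w.1, w'.1), (w.2, w'.2)) := by
  rw [← Finset.sum_product']
  refine Finset.sum_bij' (fun w _ => ((w.1.1, w.2.1), (w.1.2, w.2.2)))
    (fun w _ => ((w.1.1, w.2.1), (w.1.2, w.2.2))) ?_ ?_ ?_ ?_ ?_
  · intro w hw
    simp only [xhCoins, coins, Finset.mem_filter, Finset.mem_product] at hw ⊢
    tauto
  · intro w hw
    simp only [xhCoins, coins, Finset.mem_filter, Finset.mem_product] at hw ⊢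
    tauto
  · exact fun w _ => rfl
  · exact fun w _ => rfl
  · exact fun w _ => rfl

theorem card_xhCoins (N a : ℕ) (b : Bool) : (xhCoins N a b).card =
    (coins N (a : ZMod N) b).card * (coins N (-(a : ZMod N)) b).card := by
  have := sum_xhCoins N a b fun _ => 1
  simp only [Finset.sum_const, nsmul_eq_mul, mul_one] at this
  exact_mod_cast this

section Arithmetic

variable {p q : ℕ} [hp : Fact p.Prime] [hq : Fact q.Prime]

/-- The Galbraith test of `(t + a g² / t) + 2 g x` is a test whether `t² - a g²` is a unit. -/
theorem Blum.galbraith_iff (h : Blum p q) {a t g : ZMod (p * q)} (ht : IsUnit t) :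
    chi ((t + a * g ^ 2 * t⁻¹) ^ 2 - (2 * g) ^ 2 * a) = 1 ↔ IsUnit (t ^ 2 - a * g ^ 2) := by
  have h1 : t⁻¹ * t = 1 := ZMod.inv_mul_of_unit t ht
  have h2 : IsUnit t⁻¹ := IsUnit.of_mul_eq_one t h1
  have h3 : (t + a * g ^ 2 * t⁻¹) ^ 2 - (2 * g) ^ 2 * a = (t⁻¹ * (t ^ 2 - a * g ^ 2)) ^ 2 := by
    linear_combination (-t ^ 2 * (1 + t⁻¹ * t) + 4 * a * g ^ 2 + 2 * a * g ^ 2 * t⁻¹ * t) * h1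
  rw [h3]
  constructor
  · intro h4
    have h5 := (h.chi_ne_zero_iff _).1 (h4.trans_ne one_ne_zero)
    exact (IsUnit.mul_iff.1 ((isUnit_pow_iff two_ne_zero).1 h5)).2
  · exact fun h4 => h.chi_sq (h2.mul h4)

theorem sum_unitSet_mul {N : ℕ} [NeZero N] (u : (ZMod N)ˣ) (H : ZMod N → ℝ≥0∞) :
    ∑ z ∈ unitSet N, H z = ∑ z ∈ unitSet N, H (u * z) := by
  rw [sum_unitSet, sum_unitSet, ← Equiv.sum_comp (Equiv.mulLeft u)]
  simp

open Classical in
/-- The accepted random choices of the encryption as a sum over residue classes, with the test of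
`Blum.galbraith_iff`. -/
theorem Blum.sum_coins (h : Blum p q) (a : ZMod (p * q)) (b : Bool)
    (F : ZMod (p * q) × ZMod (p * q) → ℝ≥0∞) :
    ∑ w ∈ coins (p * q) a b, F (cipherPoly (p * q) a w.1 w.2) =
      ∑ t ∈ chiSet (p * q) (nu b), ∑ g ∈ unitSet (p * q),
        if IsUnit (t ^ 2 - a * g ^ 2) then F (t + a * g ^ 2 * t⁻¹, 2 * g) else 0 := by
  rw [coins, Finset.sum_filter, Finset.sum_product, sum_jac]
  refine Finset.sum_congr rfl fun t ht => ?_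
  rw [sum_units]
  refine Finset.sum_congr rfl fun g _ => ?_
  have htu : IsUnit t := by
    rw [mem_chiSet] at ht
    rw [← h.chi_ne_zero_iff, ht]
    cases b <;> simp [nu]
  simp only [galbraith, cipherPoly, ZMod.natCast_zmod_val]
  exact if_congr (h.galbraith_iff htu) rfl rfl

open Classical in
/-- The random choices `(t, g)` are equidistributed images of pairs of a sign `s` and an element
`y` of `ℤ_N[x] / (x² - a)`, in such a way that the ciphertext becomes `s t₀ y²`. -/
theorem Blum.exists_mul_sum_coins (h : Blum p q) :
    ∃ m : ℕ, m ≠ 0 ∧ ∀ (a : ZMod (p * q)) (b : Bool) (t₀ : ZMod (p * q)), chi t₀ = nu b →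
      ∀ F : ZMod (p * q) × ZMod (p * q) → ℝ≥0∞,
      m * ∑ w ∈ coins (p * q) a b, F (cipherPoly (p * q) a w.1 w.2) =
        ∑ s ∈ Finset.range 2, ∑ y : Quad a,
          if IsUnit y.re ∧ IsUnit y.im ∧ IsUnit (y.re ^ 2 - a * y.im ^ 2) then
            F (((-1) ^ s * .C t₀ * y ^ 2 : Quad a).re, ((-1) ^ s * .C t₀ * y ^ 2 : Quad a).im)
          else 0 := by
  obtain ⟨m, hm0, hm⟩ := h.sum_signed_sq
  refine ⟨m, hm0, fun a b t₀ ht₀ F => ?_⟩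
  have ht₀u : IsUnit t₀ := by
    rw [← h.chi_ne_zero_iff, ht₀]
    cases b <;> simp [nu]
  rw [h.sum_coins, ← ht₀, ← hm t₀ ht₀u]
  refine Finset.sum_congr rfl fun s _ => ?_
  rw [sum_quad, unitSet, Finset.sum_filter]
  refine Finset.sum_congr rfl fun y₀ _ => ?_
  split_ifs with hy₀
  · -- `t = ± t₀ y₀²` and `g = ± t₀ y₀ y₁`, so that `(t + g x)² / t = ± t₀ (y₀ + y₁ x)²`
    have hs : IsUnit ((-1 : ZMod (p * q)) ^ s) := isUnit_one.neg.pow s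
    obtain ⟨u, hu⟩ : IsUnit ((-1) ^ s * t₀ * y₀) := (hs.mul ht₀u).mul hy₀
    rw [← unitSet, sum_unitSet_mul u, unitSet, Finset.sum_filter]
    refine Finset.sum_congr rfl fun y₁ _ => ?_
    by_cases hy₁ : IsUnit y₁
    · have h1 : ((-1) ^ s * t₀ * y₀ ^ 2) ^ 2 - a * (u * y₁) ^ 2 =
          (u : ZMod (p * q)) ^ 2 * (y₀ ^ 2 - a * y₁ ^ 2) := by
        rw [hu]
        ring
      have h2 : IsUnit ((u : ZMod (p * q)) ^ 2 * (y₀ ^ 2 - a * y₁ ^ 2)) ↔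
          IsUnit (y₀ ^ 2 - a * y₁ ^ 2) := by
        rw [IsUnit.mul_iff]
        exact and_iff_right (u.isUnit.pow 2)
      rw [if_pos hy₁, h1]
      simp only [hy₀, hy₁, true_and]
      have h3 : ((-1) ^ s * t₀ * y₀ ^ 2) * ((-1) ^ s * t₀ * y₀ ^ 2)⁻¹ = 1 :=
        ZMod.mul_inv_of_unit _ ((hs.mul ht₀u).mul (hy₀.pow 2))
      have h4 : ((-1) ^ s : Quad a) = .C ((-1) ^ s) := by
        simp [QuadraticAlgebra.C_pow, QuadraticAlgebra.C_neg]
      have h5 : (-1 : ZMod (p * q)) ^ s * t₀ * y₀ ^ 2 +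
          a * (u * y₁) ^ 2 * ((-1) ^ s * t₀ * y₀ ^ 2)⁻¹ =
            ((-1) ^ s * .C t₀ * (⟨y₀, y₁⟩ : Quad a) ^ 2 : Quad a).re := by
        rw [h4, sq (QuadraticAlgebra.mk y₀ y₁)]
        simp only [QuadraticAlgebra.re_mul, QuadraticAlgebra.im_mul, QuadraticAlgebra.re_C,
          QuadraticAlgebra.im_C]
        rw [hu]
        linear_combination a * (-1) ^ s * t₀ * y₁ ^ 2 * h3
      have h6 : 2 * ((u : ZMod (p * q)) * y₁) =
            ((-1) ^ s * .C t₀ * (⟨y₀, y₁⟩ : Quad a) ^ 2 : Quad a).im := by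
        rw [h4, sq (QuadraticAlgebra.mk y₀ y₁)]
        simp only [QuadraticAlgebra.re_mul, QuadraticAlgebra.im_mul, QuadraticAlgebra.re_C,
          QuadraticAlgebra.im_C]
        rw [hu]
        ring
      refine if_congr h2 ?_ rfl
      rw [h5, h6]
    · simp [hy₁]
  · simp [hy₀]

open Classical in
/-- All but few elements of `ℤ_N[x] / (x² - a)` satisfy the unit conditions of
`Blum.exists_mul_sum_coins`: each of them excludes at most `2 (p + q)` elements on every line in a
suitable coordinate direction. -/
theorem Blum.card_good_quad (h : Blum p q) (a : ZMod (p * q)) :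
    p * q * (p * q) ≤ (Finset.univ.filter fun y : Quad a =>
      IsUnit y.re ∧ IsUnit y.im ∧ IsUnit (y.re ^ 2 - a * y.im ^ 2)).card +
        4 * (p + q) * (p * q) := by
  have hN : Fintype.card (ZMod (p * q)) = p * q := ZMod.card _
  have hQ : (Finset.univ : Finset (Quad a)).card = p * q * (p * q) := by
    rw [Finset.card_univ, Fintype.card_congr (QuadraticAlgebra.equivProd a 0), Fintype.card_prod,
      hN]
  have section_le (S : Finset (Quad a)) (k : ℕ)
      (hS : ∀ y₁, (Finset.univ.filter fun y₀ => (⟨y₀, y₁⟩ : Quad a) ∈ S).card ≤ k) :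
      S.card ≤ k * (p * q) := by
    have := Finset.card_le_mul_card_image (f := fun y : Quad a => y.im) S k fun y₁ _ => by
      refine le_trans ?_ (hS y₁)
      refine Finset.card_le_card_of_injOn (fun y => y.re) ?_ ?_
      · intro y hy
        obtain ⟨h1, rfl⟩ := Finset.mem_filter.1 hy
        exact Finset.mem_filter.2 ⟨Finset.mem_univ _, h1⟩
      · intro y hy z hz hyz
        obtain ⟨_, h1⟩ := Finset.mem_filter.1 hy
        obtain ⟨_, h2⟩ := Finset.mem_filter.1 hz
        exact QuadraticAlgebra.ext hyz (h1.trans h2.symm)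
    refine this.trans ?_
    gcongr
    exact (Finset.card_le_univ _).trans hN.le
  have section_le' (S : Finset (Quad a)) (k : ℕ)
      (hS : ∀ y₀, (Finset.univ.filter fun y₁ => (⟨y₀, y₁⟩ : Quad a) ∈ S).card ≤ k) :
      S.card ≤ k * (p * q) := by
    have := Finset.card_le_mul_card_image (f := fun y : Quad a => y.re) S k fun y₀ _ => by
      refine le_trans ?_ (hS y₀)
      refine Finset.card_le_card_of_injOn (fun y => y.im) ?_ ?_
      · intro y hy
        obtain ⟨h1, rfl⟩ := Finset.mem_filter.1 hy
        exact Finset.mem_filter.2 ⟨Finset.mem_univ _, h1⟩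
      · intro y hy z hz hyz
        obtain ⟨_, h1⟩ := Finset.mem_filter.1 hy
        obtain ⟨_, h2⟩ := Finset.mem_filter.1 hz
        exact QuadraticAlgebra.ext (h1.trans h2.symm) hyz
    refine this.trans ?_
    gcongr
    exact (Finset.card_le_univ _).trans hN.le
  have h1 := section_le (Finset.univ.filter fun y => ¬ IsUnit y.re) (p + q) fun y₁ => by
    simpa using h.card_not_isUnit_le
  have h2 := section_le' (Finset.univ.filter fun y => ¬ IsUnit y.im) (p + q) fun y₁ => by
    simpa using h.card_not_isUnit_le
  have h3 := section_le (Finset.univ.filter fun y => ¬ IsUnit (y.re ^ 2 - a * y.im ^ 2))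
    (2 * (p + q)) fun y₁ => by
      simpa using h.card_not_isUnit_sq_sub_le (a * y₁ ^ 2)
  have h4 : (Finset.univ : Finset (Quad a)) ⊆
      (Finset.univ.filter fun y : Quad a =>
        IsUnit y.re ∧ IsUnit y.im ∧ IsUnit (y.re ^ 2 - a * y.im ^ 2)) ∪
      ((Finset.univ.filter fun y => ¬ IsUnit y.re) ∪ ((Finset.univ.filter fun y => ¬ IsUnit y.im) ∪
        Finset.univ.filter fun y => ¬ IsUnit (y.re ^ 2 - a * y.im ^ 2))) := by
    intro y _
    simp only [Finset.mem_union, Finset.mem_filter, Finset.mem_univ, true_and]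
    tauto
  have h5 := Finset.card_le_card h4
  rw [hQ] at h5
  have h6 := h5.trans ((Finset.card_union_le _ _).trans (Nat.add_le_add_left
    ((Finset.card_union_le _ _).trans (Nat.add_le_add_left (Finset.card_union_le _ _) _)) _))
  nlinarith

open Classical in
/-- Few choices of `(s, y)` are excluded in the identity of `Blum.exists_mul_sum_coins`. -/
theorem Blum.coeps_mul_card_le (h : Blum p q) {m : ℕ}
    (hm : ∀ (a : ZMod (p * q)) (b : Bool) (t₀ : ZMod (p * q)), chi t₀ = nu b →
      ∀ F : ZMod (p * q) × ZMod (p * q) → ℝ≥0∞,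
      m * ∑ w ∈ coins (p * q) a b, F (cipherPoly (p * q) a w.1 w.2) =
        ∑ s ∈ Finset.range 2, ∑ y : Quad a,
          if IsUnit y.re ∧ IsUnit y.im ∧ IsUnit (y.re ^ 2 - a * y.im ^ 2) then
            F (((-1) ^ s * .C t₀ * y ^ 2 : Quad a).re, ((-1) ^ s * .C t₀ * y ^ 2 : Quad a).im)
          else 0)
    (a : ZMod (p * q)) (b : Bool) {t₀ : ZMod (p * q)} (ht₀ : chi t₀ = nu b) :
    coeps p q * (2 * (p * q) * (p * q) : ℕ) ≤ m * (coins (p * q) a b).card := by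
  have h1 := hm a b t₀ ht₀ fun _ => 1
  simp only [Finset.sum_const, nsmul_eq_mul, mul_one, Finset.sum_boole, Finset.card_range] at h1
  have h2 : m * (coins (p * q) a b).card = 2 * (Finset.univ.filter fun y : Quad a =>
    IsUnit y.re ∧ IsUnit y.im ∧ IsUnit (y.re ^ 2 - a * y.im ^ 2)).card := by exact_mod_cast h1
  rw [← Nat.cast_mul, h2]
  apply coeps_mul_le
  have h3 := h.card_good_quad a
  have h4 := eps_mul_eq (p := p) (q := q)
  have h5 : ((p * q * (p * q) : ℕ) : ℝ) ≤ (Finset.univ.filter fun y : Quad a =>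
    IsUnit y.re ∧ IsUnit y.im ∧ IsUnit (y.re ^ 2 - a * y.im ^ 2)).card +
      4 * (p + q) * (p * q : ℕ) := by exact_mod_cast h3
  have h6 : eps p q * ((2 * (p * q) * (p * q) : ℕ) : ℝ) =
      2 * (16 * (p + q)) * (p * q : ℕ) := by
    rw [← h4]
    push_cast
    ring
  rw [h6]
  push_cast at h5 ⊢
  have h7 : (0 : ℝ) ≤ (p + q) * (p * q) := by positivity
  linarith

/-- One polynomial of an `xhIBE` ciphertext is distributed almost like `± t₀ y²`. -/
theorem Blum.coeps_mul_sum_coins_le (h : Blum p q) (a : ZMod (p * q)) (b : Bool)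
    {t₀ : ZMod (p * q)} (ht₀ : chi t₀ = nu b) (F : ZMod (p * q) × ZMod (p * q) → ℝ≥0∞) :
    coeps p q * (((coins (p * q) a b).card : ℝ≥0∞)⁻¹ *
      ∑ w ∈ coins (p * q) a b, F (cipherPoly (p * q) a w.1 w.2)) ≤
      expect (twist (.C t₀ : Quad a)) fun y => F (y.re, y.im) := by
  classical
  obtain ⟨m, hm0, hm⟩ := h.exists_mul_sum_coins
  rw [expect_twist]
  have hD : (2 * (p * q : ℕ) * (p * q : ℕ) : ℝ≥0∞) = ((2 * (p * q) * (p * q) : ℕ) : ℝ≥0∞) := by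
    push_cast
    ring
  rw [hD]
  refine mul_inv_mul_le (m := m) (mul_ne_zero (mul_ne_zero two_ne_zero (NeZero.ne (p * q)))
    (NeZero.ne (p * q))) (h.coeps_mul_card_le hm a b ht₀) ?_
  rw [hm a b t₀ ht₀]
  refine Finset.sum_le_sum fun s _ => Finset.sum_le_sum fun y _ => ?_
  split_ifs
  · exact le_rfl
  · exact bot_le

/-- The words of the ciphertext `(c, d, a)`. -/
def words {N : ℕ} (a : ℕ) (c : Quad (a : ZMod N)) (d : Quad (-(a : ZMod N))) : List ℕ :=
  [c.re.val, c.im.val, d.re.val, d.im.val, a]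

/-- The ciphertext `(± P y², ± Q z², a)` for random signs and random `y`, `z`. -/
def twistEncrypt {N : ℕ} (a : ℕ) (P : Quad (a : ZMod N)) (Q : Quad (-(a : ZMod N))) :
    PMF (List ℕ) :=
  (twist P).bind fun c => (twist Q).map fun d => words a c d

theorem expect_twistEncrypt {N : ℕ} (a : ℕ) (P : Quad (a : ZMod N)) (Q : Quad (-(a : ZMod N)))
    (F : List ℕ → ℝ≥0∞) : expect (twistEncrypt a P Q) F =
      expect (twist P) fun c => expect (twist Q) fun d => F (words a c d) := by
  simp only [twistEncrypt, expect_bind, expect_map]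

/-- Encryption in `xhIBE` is almost the same as `twistEncrypt` with scalars whose Jacobi symbol
encodes the message. -/
theorem Blum.expect_xhEncrypt_le (h : Blum p q) (a : ℕ) (b : Bool) {t t' : ZMod (p * q)}
    (ht : chi t = nu b) (ht' : chi t' = nu b) (F : List ℕ → ℝ≥0∞) :
    coeps p q * coeps p q * expect (xhEncrypt (p * q) a b) F ≤
      expect (twistEncrypt a (.C t : Quad (a : ZMod (p * q))) (.C t')) F := by
  rcases (xhCoins (p * q) a b).eq_empty_or_nonempty with hE | hE
  · -- without accepted choices, the error bound exceeds `1`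
    have h1 := congrArg Finset.card hE
    rw [card_xhCoins, Finset.card_empty, mul_eq_zero] at h1
    have h2 : coeps p q = 0 := by
      have key {c : ZMod (p * q)} (hc : (coins (p * q) c b).card = 0) : coeps p q = 0 := by
        obtain ⟨m, hm0, hm⟩ := h.exists_mul_sum_coins
        have h3 := h.coeps_mul_card_le hm c b ht
        rw [hc] at h3
        simpa [NeZero.ne (p * q), hp.out.ne_zero, hq.out.ne_zero] using h3
      exact h1.elim key key
    rw [h2]
    simp
  rw [xhEncrypt, expect_map, expect_uniformOn hE, sum_xhCoins, card_xhCoins, expect_twistEncrypt,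
    Nat.cast_mul, ENNReal.mul_inv (Or.inr (by simp)) (Or.inl (by simp))]
  let G (c : ZMod (p * q) × ZMod (p * q)) (d : ZMod (p * q) × ZMod (p * q)) : ℝ≥0∞ :=
    F (words a ⟨c.1, c.2⟩ ⟨d.1, d.2⟩)
  calc _ = coeps p q * (((coins (p * q) (a : ZMod (p * q)) b).card : ℝ≥0∞)⁻¹ *
        ∑ w ∈ coins (p * q) (a : ZMod (p * q)) b, coeps p q *
          (((coins (p * q) (-(a : ZMod (p * q))) b).card : ℝ≥0∞)⁻¹ *
            ∑ w' ∈ coins (p * q) (-(a : ZMod (p * q))) b,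
              G (cipherPoly (p * q) (a : ZMod (p * q)) w.1 w.2)
                (cipherPoly (p * q) (-(a : ZMod (p * q))) w'.1 w'.2))) := by
        simp only [← Finset.mul_sum]
        simp only [G, words]
        ring
    _ ≤ coeps p q * (((coins (p * q) (a : ZMod (p * q)) b).card : ℝ≥0∞)⁻¹ *
        ∑ w ∈ coins (p * q) (a : ZMod (p * q)) b,
          expect (twist (.C t' : Quad (-(a : ZMod (p * q))))) fun d =>
            G (cipherPoly (p * q) (a : ZMod (p * q)) w.1 w.2) (d.re, d.im)) := by
        gcongr with w hw
        exact h.coeps_mul_sum_coins_le _ b ht' _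
    _ ≤ _ := h.coeps_mul_sum_coins_le _ b ht fun c =>
        expect (twist (.C t' : Quad (-(a : ZMod (p * q))))) fun d => G c (d.re, d.im)

end Arithmetic

/-- Completing the polynomial of a Cocks ciphertext `t + a / t` to `t + a / t + 2 x`. -/
theorem expect_twist_cocks {N : ℕ} [NeZero N] {a t : ZMod N} (ht : IsUnit t)
    (hta : IsUnit (t ^ 2 - a)) (F : Quad a → ℝ≥0∞) :
    expect (twist (⟨t + a * t⁻¹, 2⟩ : Quad a)) F = expect (twist (.C t⁻¹ : Quad a)) F := by
  have h1 : t * t⁻¹ = 1 := ZMod.mul_inv_of_unit t ht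
  have h2 : (⟨t + a * t⁻¹, 2⟩ : Quad a) = .C t⁻¹ * ⟨t, 1⟩ ^ 2 := by
    rw [sq]
    ext
    · simp only [QuadraticAlgebra.re_mul, QuadraticAlgebra.im_mul, QuadraticAlgebra.re_C,
        QuadraticAlgebra.im_C]
      linear_combination -t * h1
    · simp only [QuadraticAlgebra.re_mul, QuadraticAlgebra.im_mul, QuadraticAlgebra.re_C,
        QuadraticAlgebra.im_C]
      linear_combination -2 * h1
  rw [h2, expect_twist_mul_sq]
  rw [QuadraticAlgebra.isUnit_iff_norm_isUnit, QuadraticAlgebra.norm_def]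
  convert hta using 1
  simp only
  ring

/-- A double sum is bounded below by its terms with `P` and `Q`, which hold for almost all elements.
-/
theorem coeps_sq_mul_le_sum_sum {p q : ℕ} {S T : Finset ℕ} {P Q : ℕ → Prop}
    [DecidablePred P] [DecidablePred Q] {X : ℝ≥0∞}
    {G : ℕ → ℕ → ℝ≥0∞} (hS : coeps p q * S.card ≤ (S.filter P).card)
    (hT : coeps p q * T.card ≤ (T.filter Q).card)
    (hG : ∀ t ∈ S, P t → ∀ t' ∈ T, Q t' → X ≤ G t t') :
    coeps p q * coeps p q * (S.card * T.card * X) ≤ ∑ t ∈ S, ∑ t' ∈ T, G t t' :=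
  calc _ = (coeps p q * S.card) * (coeps p q * T.card) * X := by ring
    _ ≤ (S.filter P).card * (T.filter Q).card * X := by gcongr
    _ = ∑ t ∈ S.filter P, ∑ t' ∈ T.filter Q, X := by
      simp only [Finset.sum_const, nsmul_eq_mul]
      ring
    _ ≤ ∑ t ∈ S.filter P, ∑ t' ∈ T.filter Q, G t t' := by
      refine Finset.sum_le_sum fun t ht => Finset.sum_le_sum fun t' ht' => ?_
      rw [Finset.mem_filter] at ht ht'
      exact hG t ht.1 ht.2 t' ht'.1 ht'.2
    _ ≤ ∑ t ∈ S.filter P, ∑ t' ∈ T, G t t' :=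
      Finset.sum_le_sum fun t _ => Finset.sum_le_sum_of_subset (Finset.filter_subset _ _)
    _ ≤ _ := Finset.sum_le_sum_of_subset (Finset.filter_subset _ _)

section Arithmetic

variable {p q : ℕ} [hp : Fact p.Prime] [hq : Fact q.Prime]

theorem Blum.le_card_chiSet (h : Blum p q) {s : ℤ} (hs : s = 1 ∨ s = -1) :
    p * q ≤ 8 * (chiSet (p * q) s).card := by
  have h1 := h.card_chiSet hs
  rw [Nat.totient_mul h.coprime, Nat.totient_prime hp.out, Nat.totient_prime hq.out] at h1
  have h2 := hp.out.two_le
  have h3 := hq.out.two_le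
  have h4 : p * q ≤ (2 * (p - 1)) * (2 * (q - 1)) := Nat.mul_le_mul (by omega) (by omega)
  calc p * q ≤ (2 * (p - 1)) * (2 * (q - 1)) := h4
    _ = 4 * ((p - 1) * (q - 1)) := by ring
    _ = 8 * (chiSet (p * q) s).card := by rw [← h1]; ring

open Classical in
/-- For almost all `t` with given Jacobi symbol, `t² - a` is a unit. -/
theorem Blum.coeps_mul_card_jac_le (h : Blum p q) (a : ZMod (p * q)) {s : ℤ}
    (hs : s = 1 ∨ s = -1) : coeps p q * (jac (p * q) s).card ≤
      ((jac (p * q) s).filter fun t : ℕ => IsUnit ((t : ZMod (p * q)) ^ 2 - a)).card := by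
  apply coeps_mul_le
  have h1 : ((jac (p * q) s).filter fun t : ℕ => ¬ IsUnit ((t : ZMod (p * q)) ^ 2 - a)).card ≤
      2 * (p + q) := by
    refine le_trans ?_ (h.card_not_isUnit_sq_sub_le a)
    refine Finset.card_le_card_of_injOn (fun t => (t : ZMod (p * q))) ?_ ?_
    · intro t ht
      exact Finset.mem_filter.2 ⟨Finset.mem_univ _, (Finset.mem_filter.1 ht).2⟩
    · intro t ht t' ht' htt'
      have lt {x : ℕ} (hx : x ∈ (jac (p * q) s).filter
          fun t : ℕ => ¬ IsUnit ((t : ZMod (p * q)) ^ 2 - a)) : x < p * q :=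
        Finset.mem_range.1 (Finset.mem_filter.1 (Finset.mem_filter.1 hx).1).1
      rw [← ZMod.val_natCast_of_lt (lt ht), ← ZMod.val_natCast_of_lt (lt ht')]
      exact congrArg _ htt'
  have h2 := Finset.card_filter_add_card_filter_not (s := jac (p * q) s)
    (fun t : ℕ => IsUnit ((t : ZMod (p * q)) ^ 2 - a))
  have h3 := h.le_card_chiSet hs
  rw [← card_jac] at h3
  have h4 := eps_mul_eq (p := p) (q := q)
  have h5 : ((p * q : ℕ) : ℝ) ≤ 8 * (jac (p * q) s).card := by exact_mod_cast h3
  have h6 := mul_le_mul_of_nonneg_left h5 (eps_nonneg p q)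
  rw [h4] at h6
  have h7 : ((jac (p * q) s).card : ℝ) ≤
      ((jac (p * q) s).filter fun t : ℕ => IsUnit ((t : ZMod (p * q)) ^ 2 - a)).card +
        2 * (p + q) := by exact_mod_cast h2.symm.le.trans (Nat.add_le_add_left h1 _)
  linarith

theorem nu_eq_or (b : Bool) : nu b = 1 ∨ nu b = -1 := by
  cases b <;> simp [nu]

theorem Blum.isUnit_of_chi_eq_nu (h : Blum p q) {b : Bool} {t : ZMod (p * q)}
    (ht : chi t = nu b) : IsUnit t := by
  rw [← h.chi_ne_zero_iff, ht]
  cases b <;> simp [nu]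

theorem Blum.jac_nonempty (h : Blum p q) {s : ℤ} (hs : s = 1 ∨ s = -1) :
    (jac (p * q) s).Nonempty := by
  rw [← Finset.card_pos, card_jac]
  have := h.le_card_chiSet hs
  have := Nat.pos_of_ne_zero (NeZero.ne (p * q))
  omega

theorem mem_jac {N : ℕ} {s : ℤ} {t : ℕ} (ht : t ∈ jac N s) :
    t < N ∧ chi (t : ZMod N) = s := by
  obtain ⟨h1, h2⟩ := Finset.mem_filter.1 ht
  rw [Finset.mem_range] at h1
  exact ⟨h1, by rw [chi, ZMod.val_natCast_of_lt h1, h2]⟩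

/-- For almost all choices `t`, `t'`, an `xhIBE` ciphertext is obtained from the completed
polynomials `t + a / t + 2 x` and `t' - a / t' + 2 x` of a Cocks ciphertext. -/
theorem Blum.expect_xhEncrypt_le_completed (h : Blum p q) {a : ℕ} {b : Bool} {t t' : ℕ}
    (ht : t ∈ jac (p * q) (nu b)) (hta : IsUnit ((t : ZMod (p * q)) ^ 2 - a))
    (ht' : t' ∈ jac (p * q) (nu b)) (hta' : IsUnit ((t' : ZMod (p * q)) ^ 2 - -(a : ZMod (p * q))))
    (F : List ℕ → ℝ≥0∞) :
    coeps p q * coeps p q * expect (xhEncrypt (p * q) a b) F ≤ expect (twistEncrypt a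
      (⟨((t : ZMod (p * q)) + a * (t : ZMod (p * q))⁻¹), 2⟩ : Quad (a : ZMod (p * q)))
      ⟨((t' : ZMod (p * q)) - a * (t' : ZMod (p * q))⁻¹), 2⟩) F := by
  have hu := h.isUnit_of_chi_eq_nu (mem_jac ht).2
  have hu' := h.isUnit_of_chi_eq_nu (mem_jac ht').2
  refine (h.expect_xhEncrypt_le a b ((h.chi_inv hu).trans (mem_jac ht).2)
    ((h.chi_inv hu').trans (mem_jac ht').2) F).trans (le_of_eq ?_)
  have h1 : (t' : ZMod (p * q)) - a * (t' : ZMod (p * q))⁻¹ =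
    (t' : ZMod (p * q)) + -(a : ZMod (p * q)) * (t' : ZMod (p * q))⁻¹ := by ring
  rw [expect_twistEncrypt, expect_twistEncrypt, expect_twist_cocks hu hta, h1]
  congr 1
  funext c
  rw [expect_twist_cocks hu' hta']

/-- An `xhIBE` ciphertext can be computed from a Cocks ciphertext for the same message. -/
theorem Blum.expect_xhEncrypt_le_cocks (h : Blum p q) (a : ℕ) (b : Bool) (F : List ℕ → ℝ≥0∞) :
    coeps p q ^ 4 * expect (xhEncrypt (p * q) a b) F ≤
      expect (cocksEncrypt (p * q) a b) fun l =>
        expect (twistEncrypt a (⟨(l.getD 0 0 : ℕ), 2⟩ : Quad (a : ZMod (p * q)))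
          ⟨(l.getD 1 0 : ℕ), 2⟩) F := by
  classical
  have hJ := h.jac_nonempty (nu_eq_or b)
  rw [cocksEncrypt, expect_map, expect_uniformOn (hJ.product hJ), Finset.sum_product,
    Finset.card_product]
  have hJ0 : ((jac (p * q) (nu b)).card : ℝ≥0∞) ≠ 0 := by
    exact_mod_cast (Finset.card_pos.2 hJ).ne'
  simp only [List.getD_cons_zero, List.getD_cons_succ, ZMod.natCast_zmod_val]
  have h1 := coeps_sq_mul_le_sum_sum (p := p) (q := q)
    (h.coeps_mul_card_jac_le (a : ZMod (p * q)) (nu_eq_or b))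
    (h.coeps_mul_card_jac_le (-(a : ZMod (p * q))) (nu_eq_or b))
    fun t ht hta t' ht' hta' => h.expect_xhEncrypt_le_completed ht hta ht' hta' F
  rw [Nat.cast_mul, ENNReal.mul_inv (Or.inr (by simp)) (Or.inr hJ0)]
  set J : ℝ≥0∞ := ((jac (p * q) (nu b)).card : ℝ≥0∞)
  have hJ1 : J⁻¹ * J = 1 := ENNReal.inv_mul_cancel hJ0 (by simp [J])
  calc _ = (J⁻¹ * J) * (J⁻¹ * J) * (coeps p q ^ 4 * expect (xhEncrypt (p * q) a b) F) := by
        rw [hJ1, one_mul, one_mul]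
    _ = J⁻¹ * J⁻¹ * (coeps p q * coeps p q *
          (J * J * (coeps p q * coeps p q * expect (xhEncrypt (p * q) a b) F))) := by ring
    _ ≤ _ := mul_le_mul_right h1 _

/-- The ciphertext in which the first polynomial encrypts `b` and the second one encrypts `b'`,
if `u` has Jacobi symbol `-1`. -/
def mixedEncrypt {N : ℕ} (u : ZMod N) (a : ℕ) (b b' : Bool) : PMF (List ℕ) :=
  twistEncrypt a (.C (if b then u else 1)) (.C (if b' then u else 1))

theorem Blum.chi_ite (h : Blum p q) {u : ZMod (p * q)} (hu : chi u = -1) (b : Bool) :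
    chi (if b then u else 1) = nu b := by
  cases b <;> simp [nu, h.chi_one, hu]

theorem Blum.isUnit_ite (h : Blum p q) {u : ZMod (p * q)} (hu : chi u ≠ 0) (b : Bool) :
    IsUnit (if b then u else 1) := by
  cases b
  · simp
  · simpa using (h.chi_ne_zero_iff u).1 hu

/-- If `a` is a square, then the second polynomial of a ciphertext hides its message; otherwise
the first one does, since `-a` is a square. -/
theorem Blum.expect_xhEncrypt_le_mixed (h : Blum p q) {a : ℕ} (ha : chi (a : ZMod (p * q)) = 1)
    {u : ZMod (p * q)} (hu : chi u = -1) {b b' c : Bool}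
    (hc : IsSquare (a : ZMod (p * q)) ∧ c = b ∨ ¬ IsSquare (a : ZMod (p * q)) ∧ c = b')
    (F : List ℕ → ℝ≥0∞) :
    coeps p q * coeps p q * expect (xhEncrypt (p * q) a c) F ≤
      expect (mixedEncrypt u a b b') F := by
  refine (h.expect_xhEncrypt_le a c (h.chi_ite hu c) (h.chi_ite hu c) F).trans (le_of_eq ?_)
  have hu0 : chi u ≠ 0 := by rw [hu]; norm_num
  rw [mixedEncrypt, expect_twistEncrypt, expect_twistEncrypt]
  rcases hc with ⟨hs, rfl⟩ | ⟨hs, rfl⟩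
  · have hs' : ¬ IsSquare (-(a : ZMod (p * q))) := by
      rw [h.isSquare_neg_iff ha]
      exact not_not.2 hs
    simp only [h.expect_twist_C_of_not_isSquare ((h.chi_neg _).trans ha) hs'
      (h.isUnit_ite hu0 c) (h.isUnit_ite hu0 b')]
  · rw [h.expect_twist_C_of_not_isSquare ha hs (h.isUnit_ite hu0 c) (h.isUnit_ite hu0 b)]

/-- If `u` has Jacobi symbol `1`, then `mixedEncrypt` does not depend on the messages. -/
theorem Blum.expect_mixedEncrypt_of_chi_eq_one (h : Blum p q) {a : ℕ} {u : ZMod (p * q)}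
    (hu : chi u = 1) (b b' c c' : Bool) (F : List ℕ → ℝ≥0∞) :
    expect (mixedEncrypt u a b b') F = expect (mixedEncrypt u a c c') F := by
  have hu0 : chi u ≠ 0 := by rw [hu]; norm_num
  have h1 (b : Bool) : chi (if b then u else 1) = 1 := by
    cases b <;> simp [h.chi_one, hu]
  rw [mixedEncrypt, mixedEncrypt, expect_twistEncrypt, expect_twistEncrypt,
    h.expect_twist_C_congr (h.isUnit_ite hu0 b) ((h1 b).trans (h1 c).symm)]
  simp only [h.expect_twist_C_congr (h.isUnit_ite hu0 b') ((h1 b').trans (h1 c').symm)]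

/-! ### Simulating the hash function and the key extraction -/

theorem Blum.coeps_mul_le_two_mul_totient (h : Blum p q) :
    coeps p q * (2 * (p * q) : ℕ) ≤ (2 * (p * q).totient : ℕ) := by
  apply coeps_mul_le
  have h1 := h.add_le_totient_add
  have h2 := eps_mul_eq (p := p) (q := q)
  have h3 : ((p * q : ℕ) : ℝ) ≤ (p * q).totient + (p + q) := by exact_mod_cast h1
  have h4 : eps p q * ((2 * (p * q) : ℕ) : ℝ) = 2 * (16 * (p + q)) := by
    rw [← h2]
    push_cast
    ring
  rw [h4]
  push_cast at h3 ⊢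
  have h5 : (0 : ℝ) ≤ p + q := by positivity
  linarith

/-- If `± t y ^ k` is uniform on the elements with Jacobi symbol `1` for a random unit `y`, then
hash values can be replaced by `± t y ^ k` for a random residue `y`: most residues are units. -/
theorem Blum.coeps_mul_hash_le (h : Blum p q) {k m : ℕ} {t : ZMod (p * q)}
    (hm : ∀ H : ZMod (p * q) → ℝ≥0∞,
      ∑ s ∈ Finset.range 2, ∑ y ∈ unitSet (p * q), H ((-1) ^ s * t * y ^ k) =
        m * ∑ z ∈ chiSet (p * q) 1, H z)
    {F₁ : ℕ → ℕ → ℝ≥0∞} {F₂ : ℕ → ℝ≥0∞}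
    (hF : ∀ s < 2, ∀ y : ℕ, y.Coprime (p * q) →
      F₂ ((-1) ^ s * t * (y : ZMod (p * q)) ^ k).val ≤ F₁ s y) :
    coeps p q * expect (uniformOn (jac (p * q) 1)) F₂ ≤
      expect (below 2) fun s => expect (below (p * q)) fun y => F₁ s y := by
  classical
  have hN0 : p * q ≠ 0 := NeZero.ne _
  have hN0' : ((p * q : ℕ) : ℝ≥0∞) ≠ 0 := by exact_mod_cast hN0
  have h1 := hm fun _ => 1
  simp only [Finset.sum_const, nsmul_eq_mul, mul_one, Finset.card_range, Blum.card_unitSet] at h1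
  rw [expect_uniformOn (h.jac_nonempty (Or.inl rfl)), expect_below two_pos]
  simp only [expect_below (Nat.pos_of_ne_zero hN0), ← Finset.mul_sum]
  have h2 := mul_inv_mul_le (c := coeps p q) (m := m) (B := (jac (p * q) 1).card)
    (D := 2 * (p * q)) (X := ∑ t ∈ jac (p * q) 1, F₂ t)
    (Y := ∑ s ∈ Finset.range 2, ∑ y ∈ Finset.range (p * q), F₁ s y) (by omega) ?_ ?_
  · refine h2.trans (le_of_eq ?_)
    push_cast at hN0' ⊢
    rw [ENNReal.mul_inv (Or.inr (ENNReal.mul_ne_top (by simp) (by simp))) (Or.inr hN0'), mul_assoc]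
  · refine h.coeps_mul_le_two_mul_totient.trans (le_of_eq ?_)
    rw [card_jac, ← h1]
    push_cast
    rfl
  · rw [sum_jac, ← hm fun z => F₂ z.val]
    refine Finset.sum_le_sum fun s hs => ?_
    rw [sum_range_eq_sum_zmod, unitSet, Finset.sum_filter]
    refine Finset.sum_le_sum fun y _ => ?_
    split_ifs with hy
    · have := hF s (Finset.mem_range.1 hs) y.val ((ZMod.isUnit_iff_coprime y.val _).1
        (by rwa [ZMod.natCast_zmod_val]))
      rwa [ZMod.natCast_zmod_val] at this
    · exact bot_le

/-- The random oracle can be simulated by signed fourth powers. -/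
theorem Blum.coeps_mul_hash_le_pow_four (h : Blum p q) {F₁ : ℕ → ℕ → ℝ≥0∞} {F₂ : ℕ → ℝ≥0∞}
    (hF : ∀ s < 2, ∀ y : ℕ, y.Coprime (p * q) →
      F₂ ((-1) ^ s * (y : ZMod (p * q)) ^ 4).val ≤ F₁ s y) :
    coeps p q * expect (uniformOn (jac (p * q) 1)) F₂ ≤
      expect (below 2) fun s => expect (below (p * q)) fun y => F₁ s y := by
  obtain ⟨m, -, hm⟩ := h.sum_signed_pow_four
  refine h.coeps_mul_hash_le (k := 4) (t := 1) (m := m) (fun H => ?_) (by simpa using hF)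
  rw [hm 1 isUnit_one, h.chi_one]

/-- The random oracle can be simulated by signed multiples of squares. -/
theorem Blum.coeps_mul_hash_le_mul_sq (h : Blum p q) {x : ZMod (p * q)} (hx : chi x = 1)
    {F₁ : ℕ → ℕ → ℝ≥0∞} {F₂ : ℕ → ℝ≥0∞}
    (hF : ∀ s < 2, ∀ y : ℕ, y.Coprime (p * q) →
      F₂ ((-1) ^ s * x * (y : ZMod (p * q)) ^ 2).val ≤ F₁ s y) :
    coeps p q * expect (uniformOn (jac (p * q) 1)) F₂ ≤
      expect (below 2) fun s => expect (below (p * q)) fun y => F₁ s y := by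
  obtain ⟨m, -, hm⟩ := h.sum_signed_sq
  refine h.coeps_mul_hash_le (k := 2) (t := x) (m := m) (fun H => ?_) hF
  rw [hm x ((h.chi_ne_zero_iff x).1 (by rw [hx]; norm_num)), hx]

/-- The secret key that belongs to the hash value `± v⁴` is `± v²`; the second sign depends on the
parity of the exponent of the key extraction, which can be read off from `N`. -/
theorem Blum.secretKey_eq (h : Blum p q) {v : ZMod (p * q)} (hv : IsUnit v) {s : ℕ} (hs : s < 2) :
    secretKey p q ((-1) ^ s * v ^ 4).val =
      ((-1) ^ (if s = 1 ∧ p * q % 8 = 1 then 1 else 0) * v ^ 2).val := by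
  obtain ⟨i, hi⟩ : ∃ i, p = 4 * i + 3 := ⟨p / 4, by have := h.left; omega⟩
  obtain ⟨j, hj⟩ : ∃ j, q = 4 * j + 3 := ⟨q / 4, by have := h.right; omega⟩
  have hm : (p * q + 5 - p - q) / 8 = 2 * (i * j) + i + j + 1 := by
    have : p * q = 16 * (i * j) + 12 * i + 12 * j + 9 := by
      rw [hi, hj]
      ring
    omega
  -- the sign survives if the exponent is odd
  have hN : p * q % 8 = 1 ↔ Odd (2 * (i * j) + i + j + 1) := by
    have : p * q = 16 * (i * j) + 12 * i + 12 * j + 9 := by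
      rw [hi, hj]
      ring
    rw [Nat.odd_iff]
    omega
  -- by Fermat, since four times the exponent is `2` modulo `p - 1` and modulo `q - 1`
  have hv4 : v ^ (4 * (2 * (i * j) + i + j + 1)) = v ^ 2 := by
    obtain ⟨h1, h2⟩ := (h.isUnit_iff v).1 hv
    have e1 : 4 * (2 * (i * j) + i + j + 1) = (p - 1) * (2 * j + 1) + 2 := by
      rw [hi, Nat.add_sub_assoc (by norm_num)]
      ring
    have e2 : 4 * (2 * (i * j) + i + j + 1) = (q - 1) * (2 * i + 1) + 2 := by
      rw [hj, Nat.add_sub_assoc (by norm_num)]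
      ring
    apply h.crt.injective
    rw [map_pow, map_pow]
    refine Prod.ext ?_ ?_
    · rw [Prod.pow_fst, Prod.pow_fst, e1, pow_add, pow_mul, ZMod.pow_card_sub_one_eq_one h1,
        one_pow, one_mul]
    · rw [Prod.pow_snd, Prod.pow_snd, e2, pow_add, pow_mul, ZMod.pow_card_sub_one_eq_one h2,
        one_pow, one_mul]
  have key : secretKey p q ((-1) ^ s * v ^ 4).val =
      (((-1) ^ s * v ^ 4) ^ (2 * (i * j) + i + j + 1)).val := by
    rw [secretKey, hm, ← ZMod.val_natCast, Nat.cast_pow, ZMod.natCast_zmod_val]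
  rw [key, mul_pow, ← pow_mul, ← pow_mul, hv4]
  congr 2
  interval_cases s
  · simp
  · rw [one_mul]
    by_cases ho : Odd (2 * (i * j) + i + j + 1)
    · rw [if_pos ⟨rfl, hN.2 ho⟩, ho.neg_one_pow, pow_one]
    · rw [if_neg fun hc => ho (hN.1 hc.2), (Nat.not_odd_iff_even.1 ho).neg_one_pow, pow_zero]

end Arithmetic

/-! ### Computing ciphertexts on the machine -/

/-- A way to obtain the possible results of a program from a lower bound for expectations. -/
theorem forall_support_of_one_le {α : Type} {μ : PMF α} {p : α → Prop} [DecidablePred p]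
    (h : 1 ≤ expect μ fun a => if p a then 1 else 0) : ∀ a ∈ μ.support, p a := by
  have h1 : expect μ (fun a => if p a then 1 else 0) + expect μ (fun a => if p a then 0 else 1) =
      1 := by
    rw [← expect_add]
    refine Eq.trans ?_ (expect_const μ 1)
    congr 1
    funext a
    split_ifs <;> simp
  have h2 : expect μ (fun a => if p a then 0 else 1) = 0 := by
    have h3 : 1 + expect μ (fun a => if p a then 0 else 1) ≤ 1 + 0 := by
      rw [add_zero]
      exact (add_le_add_left h _).trans h1.le
    exact le_antisymm (ENNReal.le_of_add_le_add_left (by simp) h3) bot_le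
  intro a ha
  by_contra hpa
  have h4 := ENNReal.tsum_eq_zero.1 h2 a
  exact ha (by simpa [hpa] using h4)

/-- Cell `j` of the array `K`, which serves as a register. -/
abbrev reg (K j : ℕ) : Expr := .load K (.const j)

/-- The modulus, which is kept in register `0`. -/
abbrev modulus (K : ℕ) : Expr := reg K 0

/-- The residue class `(-1) ^ s` for a bit `s`. -/
def signExpr (K : ℕ) (s : Expr) : Expr :=
  .bin .add (.bin .sub (.const 1) s) (.bin .mul s (.bin .sub (modulus K) (.const 1)))

/-- Write the coefficients of `± (P₀ + P₁ x) y²` in `ℤ_M[x] / (x² - a)`, for a random sign and a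
random `y`, into the cells `i` and `i + 1` of array `0`. -/
def twistProg (K : ℕ) (a P₀ P₁ : Expr) (i : ℕ) : Prog :=
  let y₀ := reg K 6
  let y₁ := reg K 7
  let sq₀ : Expr := .bin .add (.bin .mul y₀ y₀) (.bin .mul a (.bin .mul y₁ y₁))
  let sq₁ : Expr := .bin .mul (.const 2) (.bin .mul y₀ y₁)
  .seq (.rand K (.const 5) (.const 2)) <|
  .seq (.rand K (.const 6) (modulus K)) <|
  .seq (.rand K (.const 7) (modulus K)) <|
  .seq (.set 0 (.const i) (.bin .mod (.bin .mul (signExpr K (reg K 5))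
    (.bin .add (.bin .mul P₀ sq₀) (.bin .mul a (.bin .mul P₁ sq₁)))) (modulus K)))
  (.set 0 (.const (i + 1)) (.bin .mod (.bin .mul (signExpr K (reg K 5))
    (.bin .add (.bin .mul P₀ sq₁) (.bin .mul P₁ sq₀))) (modulus K)))

/-- Write the ciphertext `(± (P + e x) y², ± (Q + e x) z², a)` into array `0`, where `a`, `P`, `Q`
are the contents of the registers `2`, `3`, `4`. -/
def cipherProg (K e : ℕ) : Prog :=
  .seq (twistProg K (reg K 2) (reg K 3) (.const e) 0) <|
  .seq (twistProg K (.bin .mul (.bin .sub (modulus K) (.const 1)) (reg K 2)) (reg K 4) (.const e) 2)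
  (.set 0 (.const 4) (reg K 2))

/-- The memory `m'` arises from `m` by changes of array `0`, and of the registers from `5` on. -/
def Scratch (K : ℕ) (m m' : Mem) : Prop :=
  ∀ k i, k ≠ 0 → (k = K → i < 5) → m' k i = m k i

theorem cast_sign {M s : ℕ} [NeZero M] (hs : s < 2) :
    ((1 - s + s * (M - 1) : ℕ) : ZMod M) = (-1) ^ s := by
  have hM := NeZero.pos M
  interval_cases s
  · simp
  · simp [Nat.cast_sub (Nat.succ_le_of_lt hM)]

theorem twist_congr {M : ℕ} {a a' : ZMod M} (h : a = a') (β₀ β₁ : ZMod M)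
    (G : ZMod M → ZMod M → ℝ≥0∞) :
    expect (twist (⟨β₀, β₁⟩ : Quad a)) (fun z => G z.re z.im) =
      expect (twist (⟨β₀, β₁⟩ : Quad a')) (fun z => G z.re z.im) := by
  subst h
  rfl

section CipherProg

variable {σ : Type} (O : Oracle σ) {K M : ℕ} [NeZero M]

/-- The machine samples `twist`: the function `F₁` of its final configuration is bounded below by
the function `F₂` of the polynomial that it stores in the cells `i` and `i + 1` of array `0`. -/
theorem expect_twistProg (hK : 0 < K) {c : Config σ} (hM : c.mem K 0 = M) {a P₀ P₁ : Expr}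
    {α β₀ β₁ : ℕ} (i : ℕ)
    (ha : ∀ m, Scratch K c.mem m → a.eval m = α) (hP₀ : ∀ m, Scratch K c.mem m → P₀.eval m = β₀)
    (hP₁ : ∀ m, Scratch K c.mem m → P₁.eval m = β₁)
    {F₁ : Config σ → ℝ≥0∞} {F₂ : Quad (α : ZMod M) → ℝ≥0∞}
    (hF : ∀ z c', c'.orc = c.orc → Scratch K c.mem c'.mem →
      (∀ j, c'.mem 0 j = if j = i + 1 then z.im.val else if j = i then z.re.val else c.mem 0 j) →
      F₂ z ≤ F₁ c') :
    expect (twist (⟨(β₀ : ZMod M), (β₁ : ZMod M)⟩ : Quad (α : ZMod M))) F₂ ≤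
      expect (exec O (twistProg K a P₀ P₁ i) c) F₁ := by
  have hK' : K ≠ 0 := hK.ne'
  simp only [twistProg, expect_seq, expect_rand, expect_set, twist, expect_bind, expect_map]
  have e2 (m : Mem) : Expr.eval m (.const 2) = 2 := rfl
  rw [e2]
  refine expect_mono_support fun s hs => ?_
  have hs2 : s < 2 := (below_support hs).resolve_right (by simp)
  have e3 : Expr.eval (c.mem.put K (Expr.eval c.mem (.const 5)) s) (modulus K) = M := by
    simp [Expr.eval, Mem.put, hM]
  rw [e3]
  refine expect_mono fun y₀ => ?_
  have e4 : Expr.eval ((c.mem.put K (Expr.eval c.mem (.const 5)) s).put K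
      (Expr.eval (c.mem.put K (Expr.eval c.mem (.const 5)) s) (.const 6)) y₀) (modulus K) = M := by
    simp [Expr.eval, Mem.put, hM]
  rw [e4]
  refine expect_mono fun y₁ => ?_
  simp only [Expr.eval]
  set m := ((c.mem.put K 5 s).put K 6 y₀).put K 7 y₁ with hm
  have hscr : Scratch K c.mem m := by
    intro k j hk hj
    simp only [hm, Mem.put]
    by_cases hkK : k = K
    · have := hj hkK
      simp [show j ≠ 5 by omega, show j ≠ 6 by omega, show j ≠ 7 by omega]
    · simp [hkK]
  have hput (v : ℕ) : Scratch K c.mem (m.put 0 i v) := by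
    intro k j hk hj
    simp only [Mem.put, hk, false_and, if_false]
    exact hscr k j hk hj
  have m0 : m K 0 = M := by simp [hm, Mem.put, hM]
  have m5 : m K 5 = s := by simp [hm, Mem.put]
  have m6 : m K 6 = y₀ := by simp [hm, Mem.put]
  have m7 : m K 7 = y₁ := by simp [hm, Mem.put]
  have mz (j : ℕ) : m 0 j = c.mem 0 j := by simp [hm, Mem.put, hK'.symm]
  have put_ne (v j : ℕ) : m.put 0 i v K j = m K j := Mem.put_of_ne hK'
  simp only [ha m hscr, hP₀ m hscr, hP₁ m hscr, ha _ (hput _), hP₀ _ (hput _), hP₁ _ (hput _),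
    signExpr, Expr.eval, put_ne, m0, m5, m6, m7, Op.eval]
  refine hF _ _ rfl ?_ ?_
  · intro k j hk hj
    simp only [Mem.put, hk, false_and, if_false]
    exact hscr k j hk hj
  · intro j
    simp only [Mem.put, true_and, mz]
    have hpow : ((-1) ^ s : Quad (α : ZMod M)) = .C ((-1) ^ s) := by
      simp [QuadraticAlgebra.C_pow, QuadraticAlgebra.C_neg]
    have him : ((-1) ^ s * (⟨(β₀ : ZMod M), (β₁ : ZMod M)⟩ : Quad (α : ZMod M)) *
        (⟨(y₀ : ZMod M), (y₁ : ZMod M)⟩ : Quad (α : ZMod M)) ^ 2).im.val =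
        (1 - s + s * (M - 1)) * (β₀ * (2 * (y₀ * y₁)) + β₁ * (y₀ * y₀ + α * (y₁ * y₁))) % M := by
      rw [← ZMod.val_natCast, Nat.cast_mul, cast_sign hs2, hpow,
        sq (QuadraticAlgebra.mk (y₀ : ZMod M) (y₁ : ZMod M))]
      congr 1
      simp only [QuadraticAlgebra.re_mul, QuadraticAlgebra.im_mul, QuadraticAlgebra.re_C,
        QuadraticAlgebra.im_C]
      push_cast
      ring
    have hre : ((-1) ^ s * (⟨(β₀ : ZMod M), (β₁ : ZMod M)⟩ : Quad (α : ZMod M)) *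
        (⟨(y₀ : ZMod M), (y₁ : ZMod M)⟩ : Quad (α : ZMod M)) ^ 2).re.val =
        (1 - s + s * (M - 1)) *
          (β₀ * (y₀ * y₀ + α * (y₁ * y₁)) + α * (β₁ * (2 * (y₀ * y₁)))) % M := by
      rw [← ZMod.val_natCast, Nat.cast_mul, cast_sign hs2, hpow,
        sq (QuadraticAlgebra.mk (y₀ : ZMod M) (y₁ : ZMod M))]
      congr 1
      simp only [QuadraticAlgebra.re_mul, QuadraticAlgebra.im_mul, QuadraticAlgebra.re_C,
        QuadraticAlgebra.im_C]
      push_cast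
      ring
    rw [him, hre]

/-- The machine samples `twistEncrypt`, and writes the ciphertext to array `0`. -/
theorem expect_cipherProg (hK : 0 < K) {c : Config σ} (hM : c.mem K 0 = M) {a P Q e : ℕ}
    (ha : c.mem K 2 = a) (hP : c.mem K 3 = P) (hQ : c.mem K 4 = Q)
    {F₁ : Config σ → ℝ≥0∞} {F₂ : List ℕ → ℝ≥0∞}
    (hF : ∀ (z : Quad (a : ZMod M)) z' c', c'.orc = c.orc → Scratch K c.mem c'.mem →
      (∀ j, c'.mem 0 j = c.mem.write (words a z z') 0 j) → F₂ (words a z z') ≤ F₁ c') :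
    expect (twistEncrypt a (⟨(P : ZMod M), (e : ZMod M)⟩ : Quad (a : ZMod M))
      ⟨(Q : ZMod M), (e : ZMod M)⟩) F₂ ≤ expect (exec O (cipherProg K e) c) F₁ := by
  have hK' : K ≠ 0 := hK.ne'
  have reg_eq {m m' : Mem} (h : Scratch K m m') {j : ℕ} (hj : j < 5) : m' K j = m K j :=
    h K j hK' fun _ => hj
  have trans {m m' m'' : Mem} (h : Scratch K m m') (h' : Scratch K m' m'') : Scratch K m m'' :=
    fun k i hk hi => (h' k i hk hi).trans (h k i hk hi)
  rw [expect_twistEncrypt, cipherProg, expect_seq]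
  refine expect_twistProg O hK hM 0 (fun m hm => ?_) (fun m hm => ?_) (fun m hm => rfl)
    fun z c₁ ho₁ hc₁ hz₁ => ?_
  · simp [Expr.eval, reg_eq hm (show 2 < 5 by norm_num), ha]
  · simp [Expr.eval, reg_eq hm (show 3 < 5 by norm_num), hP]
  have hneg : -(a : ZMod M) = (((M - 1) * a : ℕ) : ZMod M) := by
    rw [Nat.cast_mul, Nat.cast_sub (NeZero.pos M)]
    simp
  rw [expect_seq]
  simp only [words]
  rw [twist_congr hneg _ _ fun x y => F₂ [z.re.val, z.im.val, x.val, y.val, a]]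
  refine expect_twistProg O hK ((reg_eq hc₁ (by norm_num)).trans hM) 2 (fun m hm => ?_)
    (fun m hm => ?_) (fun m hm => rfl) fun z' c₂ ho₂ hc₂ hz₂ => ?_
  · have := trans hc₁ hm
    simp [Expr.eval, Op.eval, reg_eq this (show 2 < 5 by norm_num),
      reg_eq this (show 0 < 5 by norm_num), ha, hM]
  · simp [Expr.eval, reg_eq (trans hc₁ hm) (show 4 < 5 by norm_num), hQ]
  rw [expect_set]
  have h2 : c₂.mem K 2 = a := (reg_eq (trans hc₁ hc₂) (by norm_num)).trans ha
  refine hF z ⟨z'.re, z'.im⟩ _ (ho₂.trans ho₁) ?_ ?_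
  · intro k j hk hj
    simp only [Mem.put, hk, false_and, if_false]
    exact trans hc₁ hc₂ k j hk hj
  · intro j
    simp only [Expr.eval, Mem.put, Mem.write, true_and, words, h2, hz₂, hz₁, List.length_cons,
      List.length_nil]
    by_cases hj : j < 5
    · interval_cases j <;> simp
    · simp [hj, show j ≠ 0 by omega, show j ≠ 1 by omega, show j ≠ 2 by omega,
        show j ≠ 3 by omega, show j ≠ 4 by omega]

/-- The possible results of `cipherProg`. -/
theorem support_cipherProg (hK : 0 < K) {c : Config σ} (hM : c.mem K 0 = M) {e : ℕ}
    {c' : Config σ} (hc' : c' ∈ (exec O (cipherProg K e) c).support) :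
    ∃ l : List ℕ, l.length = 5 ∧ (∀ w ∈ l, w < M ∨ w = c.mem K 2) ∧ c'.orc = c.orc ∧
      Scratch K c.mem c'.mem ∧ ∀ j, c'.mem 0 j = c.mem.write l 0 j := by
  classical
  refine forall_support_of_one_le (p := fun c' : Config σ => ∃ l : List ℕ, l.length = 5 ∧
    (∀ w ∈ l, w < M ∨ w = c.mem K 2) ∧ c'.orc = c.orc ∧ Scratch K c.mem c'.mem ∧
    ∀ j, c'.mem 0 j = c.mem.write l 0 j) ?_ c' hc'
  refine (expect_const _ 1).ge.trans (expect_cipherProg O hK hM rfl rfl rfl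
    (F₂ := fun _ => 1) fun z z' c' h1 h2 h3 => ?_)
  rw [if_pos]
  refine ⟨words _ z z', rfl, ?_, h1, h2, h3⟩
  simp [words, ZMod.val_lt]

end CipherProg

/-! ### The reduction to the Cocks scheme -/

/-- Save the modulus (replaced by `1` if it is `0`) in register `0`. -/
def saveModulus (K : ℕ) : Prog :=
  .set K (.const 0) (.bin .add (.load 0 (.const 0)) (.bin .eq (.load 0 (.const 0)) (.const 0)))

/-- Convert a ciphertext of the Cocks scheme for the identity in register `1`. -/
def convertProg (K : ℕ) : Prog :=
  .seq (.set K (.const 3) (.load 0 (.const 0))) <|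
  .seq (.set K (.const 4) (.load 0 (.const 1))) <|
  .seq (.call .hash K (.const 2) (reg K 1)) (cipherProg K 2)

/-- The adversary against the Cocks scheme that is made from an adversary against `xhIBE`. -/
def cocksAdversary (K : ℕ) (A : Adversary) : Adversary where
  phase1 := .seq (saveModulus K) (.seq A.phase1 (.set K (.const 1) (.load 0 (.const 0))))
  phase2 := .seq (convertProg K) A.phase2

theorem expect_hashQuery_congr (N id : ℕ) (st : State) {F G : ℕ × State → ℝ≥0∞}
    (h : ∀ a st', st'.table id = some a → st'.keys = st.keys → F (a, st') ≤ G (a, st')) :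
    expect (hashQuery N id st) F ≤ expect (hashQuery N id st) G := by
  unfold hashQuery
  split
  · next a ha =>
    simpa using h a st ha rfl
  · simp only [expect_bind, expect_pure]
    exact expect_mono fun a => h a _ (by simp) rfl

theorem hashQuery_of_table {N id a : ℕ} {st : State} (h : st.table id = some a) :
    hashQuery N id st = PMF.pure (a, st) := by
  simp [hashQuery, h]

/-- The conversion of a Cocks ciphertext multiplies its completed polynomials by random `± y²`. The
hash value `a` comes from the random oracle, which has fixed it already. -/
theorem expect_convertProg {p q : ℕ} [NeZero (p * q)] {K : ℕ} (hK : 0 < K) (target : Option ℕ)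
    {c : Config State} (hN : c.mem K 0 = p * q) {a : ℕ}
    (ha : c.orc.table (c.mem K 1) = some a) {F₁ : Config State → ℝ≥0∞} {F₂ : List ℕ → ℝ≥0∞}
    (hF : ∀ l c', l.length = 5 → c'.orc = c.orc →
      (∀ k < K, ∀ i, c'.mem k i = c.mem.write l k i) → F₂ l ≤ F₁ c') :
    expect (twistEncrypt a (⟨(c.mem 0 0 : ZMod (p * q)), 2⟩ : Quad (a : ZMod (p * q)))
      ⟨(c.mem 0 1 : ZMod (p * q)), 2⟩) F₂ ≤
      expect (exec (ibeOracle p q target) (convertProg K) c) F₁ := by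
  have hK' : K ≠ 0 := hK.ne'
  have hK0 : (0 : ℕ) ≠ K := hK.ne
  have e0 (v i j : ℕ) (m : Mem) : m.put K i v 0 j = m 0 j := Mem.put_of_ne hK0
  rw [convertProg]
  simp only [expect_seq, expect_set, expect_call, Expr.eval, e0]
  have h1 : ((c.mem.put K 3 (c.mem 0 0)).put K 4 (c.mem 0 1)) K 1 = c.mem K 1 := by
    simp [Mem.put]
  rw [h1, ibeOracle, hashQuery_of_table ha, expect_pure]
  have h2 : (2 : ZMod (p * q)) = ((2 : ℕ) : ZMod (p * q)) := by norm_num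
  rw [h2]
  refine expect_cipherProg _ hK (by simp [Mem.put, hN]) (by simp [Mem.put])
    (by simp [Mem.put]) (by simp [Mem.put]) fun z z' c' h3 h4 h5 => ?_
  refine hF _ c' rfl h3 fun k hk i => ?_
  rcases eq_or_ne k 0 with rfl | hk0
  · rw [h5]
    simp [Mem.write, Mem.put, hK0]
  · rw [h4 k i hk0 fun h => absurd h hk.ne]
    simp [Mem.write, Mem.put, hk.ne, hk0]

/-- The part of the game after the first phase. -/
def gameTail (encrypt : ℕ → ℕ → Bool → PMF (List ℕ)) (A : Adversary) (p q : ℕ)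
    (c₁ : Config State) : PMF Bool :=
  (PMF.uniformOfFintype Bool).bind fun b =>
    if c₁.mem 0 0 ∈ c₁.orc.keys then PMF.pure (decide (b = false))
    else
      (hashQuery (p * q) (c₁.mem 0 0) c₁.orc).bind fun r =>
      (encrypt (p * q) r.1 (if b then decide (c₁.mem 0 2 ≠ 0) else decide (c₁.mem 0 1 ≠ 0))).bind
        fun ct =>
      (exec (ibeOracle p q (some (c₁.mem 0 0))) A.phase2 ⟨c₁.mem.write ct, r.2, c₁.time⟩).map
        fun c₂ => decide (b = decide (c₂.mem 0 0 ≠ 0))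

theorem length_cocksEncrypt {N a : ℕ} {b : Bool} {l : List ℕ}
    (hl : l ∈ (cocksEncrypt N a b).support) : l.length = 2 := by
  rw [cocksEncrypt, PMF.mem_support_map_iff] at hl
  obtain ⟨t, -, rfl⟩ := hl
  rfl

section Reduction

variable {p q : ℕ} [hp : Fact p.Prime] [hq : Fact q.Prime]

/-- After the first phase, the game of the adversary against `xhIBE` is bounded, up to the error of
the conversion, by the game of the converted adversary against the Cocks scheme. -/
theorem Blum.expect_gameTail_le (h : Blum p q) {K : ℕ} (hK : 0 < K) {A : Adversary}
    (hA : A.phase2.Below K) {c₁ c₂ : Config State} (hc : Agree K c₁.mem c₂.mem)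
    (horc : c₁.orc = c₂.orc) (hN : c₁.mem K 0 = p * q) (hid : c₁.mem K 1 = c₁.mem 0 0)
    (F : Bool → ℝ≥0∞) :
    coeps p q ^ 4 * expect (gameTail xhEncrypt A p q c₂) F ≤
      expect (gameTail cocksEncrypt (cocksAdversary K A) p q c₁) F := by
  rw [gameTail, gameTail, expect_bind, expect_bind, ← expect_const_mul, hc 0 hK, hc 0 hK, hc 0 hK,
    horc]
  refine expect_mono fun b => ?_
  by_cases hkeys : c₂.mem 0 0 ∈ c₂.orc.keys
  · rw [if_pos hkeys, if_pos hkeys]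
    exact mul_le_of_le_one_left' (pow_le_one₀ bot_le (coeps_le_one p q))
  rw [if_neg hkeys, if_neg hkeys, expect_bind, expect_bind, ← expect_const_mul]
  refine expect_hashQuery_congr _ _ _ fun a st hst _ => ?_
  rw [expect_bind, expect_bind]
  refine (h.expect_xhEncrypt_le_cocks _ _ _).trans (expect_mono_support fun l hl => ?_)
  have hl2 := length_cocksEncrypt hl
  simp only [expect_map]
  rw [cocksAdversary, expect_seq]
  have w0 (m : Mem) : m.write l K = m K := by
    funext i
    simp [Mem.write, hK.ne']
  have wl (m : Mem) {i : ℕ} (hi : i < 2) : m.write l 0 i = l.getD i 0 := by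
    simp only [Mem.write, hl2, hi, and_self, if_true]
  have key := expect_convertProg (p := p) (q := q) hK (some (c₂.mem 0 0))
    (c := ⟨c₁.mem.write l, st, c₁.time⟩) (by simp only [w0, hN]) (a := a)
    (by simp only [w0, hid, hc 0 hK, hst])
    (F₂ := fun ct => expect (exec (ibeOracle p q (some (c₂.mem 0 0))) A.phase2
        ⟨c₂.mem.write ct, st, c₂.time⟩) fun c => F (decide (b = decide (c.mem 0 0 ≠ 0))))
    (F₁ := fun c' => expect (exec (ibeOracle p q (some (c₂.mem 0 0))) A.phase2 c') fun c =>
        F (decide (b = decide (c.mem 0 0 ≠ 0)))) ?_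
  · simpa only [wl _ zero_lt_two, wl _ one_lt_two] using key
  intro ct c' hct horc' hc'
  have hf : Framed K c'.mem (c₂.mem.write ct) c'.time c₂.time c'
      ⟨c₂.mem.write ct, st, c₂.time⟩ := by
    refine ⟨fun k hk i => ?_, horc', fun _ _ _ => rfl, fun _ _ _ => rfl, ?_⟩
    · rw [hc' k hk i]
      simp only [Mem.write, hc k hk i, hl2, hct]
      split_ifs <;> first | rfl | omega
    · simp only
      omega
  refine (hf.stepLE (ibeOracle p q (some (c₂.mem 0 0))) 1 hA _ _ fun d₁ d₂ hd => ?_).trans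
    (one_mul _).le
  rw [hd.agree 0 hK, one_mul]

/-- The whole game against `xhIBE` is bounded by that of the converted adversary. -/
theorem Blum.expect_game_le (h : Blum p q) {K : ℕ} (hK : 0 < K) {A : Adversary}
    (hA₁ : A.phase1.Below K) (hA₂ : A.phase2.Below K) (n : ℕ) (F : Bool → ℝ≥0∞) :
    coeps p q ^ 4 * expect (game xhEncrypt A n p q) F ≤
      expect (game cocksEncrypt (cocksAdversary K A) n p q) F := by
  have hN : p * q ≠ 0 := NeZero.ne _
  have e1 (encrypt) (B : Adversary) : expect (game encrypt B n p q) F =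
      expect (exec (ibeOracle p q none) B.phase1 (start [p * q, n] State.empty)) fun c =>
        expect (gameTail encrypt B p q c) F := expect_bind _ _ _
  have e2 : (cocksAdversary K A).phase1 = .seq (saveModulus K)
      (.seq A.phase1 (.set K (.const 1) (.load 0 (.const 0)))) := rfl
  rw [e1, e1, e2, expect_seq, saveModulus, expect_set, expect_seq, ← expect_const_mul]
  have h0 : (start [p * q, n] State.empty).mem 0 0 = p * q := by simp [start, Mem.write]
  simp only [Expr.eval, h0, Op.eval, if_neg hN, add_zero]
  set c₀ : Config State := start [p * q, n] State.empty
  have hput (m : Mem) (i v : ℕ) : Agree K (m.put K i v) m := fun k hk j => Mem.put_of_ne hk.ne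
  generalize c₀.time + _ = t
  have hf : Framed K (c₀.mem.put K 0 (p * q)) c₀.mem t c₀.time ⟨c₀.mem.put K 0 (p * q), c₀.orc, t⟩
      c₀ := ⟨hput _ _ _, rfl, fun _ _ _ => rfl, fun _ _ _ => rfl, Nat.add_comm _ _⟩
  refine (hf.stepLE (ibeOracle p q none) 1 hA₁ _ _ fun c₁ c₂ hc => ?_).trans (one_mul _).le
  rw [one_mul, expect_set]
  refine h.expect_gameTail_le hK hA₂ ?_ ?_ ?_ ?_ F
  · intro k hk i
    rw [← hc.agree k hk i]
    exact hput _ _ _ k hk i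
  · exact hc.orc
  · simp [Expr.eval, Mem.put, hc.left K le_rfl]
  · simp [Expr.eval, Mem.put, hK.ne]

/-- For each modulus, the success probabilities differ by at most `4 * eps p q`. -/
theorem Blum.abs_game_sub_le (h : Blum p q) {K : ℕ} (hK : 0 < K) {A : Adversary}
    (hA₁ : A.phase1.Below K) (hA₂ : A.phase2.Below K) (n : ℕ) :
    |(game xhEncrypt A n p q true).toReal -
      (game cocksEncrypt (cocksAdversary K A) n p q true).toReal| ≤ 4 * eps p q := by
  have he := eps_nonneg p q
  refine abs_sub_le_of_dominated (by positivity) fun v => ?_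
  have h1 := h.expect_game_le hK hA₁ hA₂ n fun b => if b = v then 1 else 0
  rw [expect_indicator, expect_indicator] at h1
  refine le_trans ?_ h1
  gcongr
  rw [coeps]
  rcases le_total 1 (eps p q) with h2 | h2
  · rw [ENNReal.ofReal_of_nonpos (by linarith)]
    exact bot_le
  · rw [← ENNReal.ofReal_pow (by linarith)]
    refine ENNReal.ofReal_le_ofReal ?_
    have := one_add_mul_le_pow (a := -eps p q) (by linarith) 4
    norm_num at this ⊢
    linarith [this, sub_eq_add_neg 1 (eps p q)]

end Reduction

theorem memLE_start {σ : Type} {input : List ℕ} {L : ℕ} (h : ∀ w ∈ input, w.size ≤ L) (s : σ) :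
    MemLE L (start input s).mem :=
  MemLE.write (fun _ _ => by simp) h

theorem size_le_of_lt_two_pow {w L : ℕ} (h : w < 2 ^ L) : w.size ≤ L := Nat.size_le.2 h

theorem memLE_start_pair {n N : ℕ} (hN : N < 2 ^ (2 * n)) {σ : Type} (s : σ) :
    MemLE (2 * n + 1) (start [N, n] s).mem := by
  refine memLE_start (fun w hw => ?_) s
  have h1 := size_le_of_lt_two_pow hN
  have h2 := Nat.size_le.2 (Nat.lt_two_pow_self (n := n))
  simp only [List.mem_cons, List.not_mem_nil, or_false] at hw
  rcases hw with rfl | rfl <;> omega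

/-- `P` bounds the running time of `A` on moduli and ciphertexts of the right size. -/
def Adversary.TimeBound (A : Adversary) (k : ℕ) (P : Polynomial ℕ) : Prop :=
  ∀ n N : ℕ, N < 2 ^ (2 * n) →
    ∀ c₁ ∈ (exec (anyOracle (2 ^ (2 * n))) A.phase1 (start [N, n] ())).support,
    ∀ ct : List ℕ, ct.length = k → (∀ w ∈ ct, w < 2 ^ (2 * n)) →
    ∀ c₂ ∈ (exec (anyOracle (2 ^ (2 * n))) A.phase2 ⟨c₁.mem.write ct, (), c₁.time⟩).support,
      c₂.time ≤ P.eval n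

theorem anyOracle_size {n : ℕ} {q : Query} {v : ℕ} {s : Unit} {r : ℕ × Unit}
    (hr : r ∈ (anyOracle (2 ^ (2 * n)) q v s).support) : r.1 < 2 ^ (2 * n) := by
  rw [anyOracle, PMF.mem_support_map_iff] at hr
  obtain ⟨w, hw, rfl⟩ := hr
  exact (below_support hw).resolve_right (by simp)

theorem Adversary.TimeBound.phase1 {A : Adversary} {k : ℕ} {P : Polynomial ℕ}
    (hP : A.TimeBound k P) {n N : ℕ} (hN : N < 2 ^ (2 * n)) {c₁ : Config Unit}
    (hc₁ : c₁ ∈ (exec (anyOracle (2 ^ (2 * n))) A.phase1 (start [N, n] ())).support) :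
    c₁.time ≤ P.eval n ∧ MemLE (c₁.time + (2 * n + 1)) c₁.mem := by
  have h1 := exec_support_mono _ _ hc₁ (L := 2 * n + 1)
    ((memLE_start_pair hN ()).mono (Nat.le_add_left _ _))
  obtain ⟨c₂, hc₂⟩ := (exec (anyOracle (2 ^ (2 * n))) A.phase2
    ⟨c₁.mem.write (List.replicate k 0), (), c₁.time⟩).support_nonempty
  have h2 := exec_support_mono _ _ hc₂ (L := 2 * n + 1)
    (h1.2.write fun w hw => by simp [List.eq_of_mem_replicate hw])
  refine ⟨h2.1.trans (hP n N hN c₁ hc₁ _ (by simp) (fun w hw => ?_) c₂ hc₂), h1.2⟩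
  rw [List.eq_of_mem_replicate hw]
  positivity

theorem cipherProg_loopFree (K e : ℕ) : (cipherProg K e).LoopFree := by
  simp [cipherProg, twistProg, Prog.LoopFree]

theorem convertProg_loopFree (K : ℕ) : (convertProg K).LoopFree := by
  simp [convertProg, cipherProg_loopFree, Prog.LoopFree]

/-- The possible results of `convertProg`. -/
theorem support_convertProg {K B : ℕ} (hK : 0 < K) (hB : 0 < B) {c c' : Config Unit}
    (hN : 0 < c.mem K 0) (hNB : c.mem K 0 ≤ B)
    (hc' : c' ∈ (exec (anyOracle B) (convertProg K) c).support) :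
    ∃ l : List ℕ, l.length = 5 ∧ (∀ w ∈ l, w < B) ∧
      ∀ k < K, ∀ i, c'.mem k i = c.mem.write l k i := by
  have hK0 : (0 : ℕ) ≠ K := hK.ne
  rw [convertProg] at hc'
  simp only [exec, PMF.mem_support_bind_iff, PMF.mem_support_pure_iff, exists_eq_left] at hc'
  obtain ⟨c₁, ⟨r, hr, rfl⟩, hc'⟩ := hc'
  have hr' : r.1 < B := by
    rw [anyOracle, PMF.mem_support_map_iff] at hr
    obtain ⟨w, hw, rfl⟩ := hr
    exact (below_support hw).resolve_right (by simpa using fun h : B = 0 => absurd h hB.ne')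
  have : NeZero (c.mem K 0) := ⟨hN.ne'⟩
  obtain ⟨l, h1, h2, -, h3, h4⟩ := support_cipherProg (M := c.mem K 0) _ hK
    (by simp [Mem.put, Expr.eval]) hc'
  refine ⟨l, h1, fun w hw => ?_, fun k hk i => ?_⟩
  · rcases h2 w hw with h | h
    · exact h.trans_le hNB
    · rw [h]
      simpa [Mem.put, Expr.eval] using hr'
  · rcases eq_or_ne k 0 with rfl | hk0
    · rw [h4]
      simp [Mem.write, Mem.put, hK0]
    · rw [h3 k i hk0 fun h => absurd h hk.ne]
      simp [Mem.write, Mem.put, hk.ne, hk0]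

/-- In runs of the same program, the framed memory of the first run determines a second run. -/
theorem Framed.exists_support {σ : Type} {O : Oracle σ} {K : ℕ} {P : Prog} (hP : P.Below K)
    {c₁ c₂ c₂' : Config σ} (h : Agree K c₁.mem c₂.mem) (horc : c₁.orc = c₂.orc)
    (hc₂' : c₂' ∈ (exec O P c₂).support) :
    ∃ c₁' ∈ (exec O P c₁).support, Framed K c₁.mem c₂.mem c₁.time c₂.time c₁' c₂' :=
  stepLE_top_iff.1 (Framed.stepLE O ⊤ hP (c₁ := c₁) (c₂ := c₂)
    ⟨h, horc, fun _ _ _ => rfl, fun _ _ _ => rfl, Nat.add_comm _ _⟩) c₂' hc₂'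

theorem Agree.symm {K : ℕ} {m₁ m₂ : Mem} (h : Agree K m₁ m₂) : Agree K m₂ m₁ :=
  fun k hk i => (h k hk i).symm

/-- The programs added to those of the given adversary have no loops, and the converted ciphertext
has the size for which the running time of the given adversary is bounded. -/
theorem cocksAdversary_polyTime {K : ℕ} (hK : 0 < K) {A : Adversary} (hA : A.PolyTime 5)
    (hA₁ : A.phase1.Below K) (hA₂ : A.phase2.Below K) : (cocksAdversary K A).PolyTime 2 := by
  obtain ⟨P, hP : A.TimeBound 5 P⟩ := hA
  have hl₁ : (saveModulus K).LoopFree := by simp [saveModulus, Prog.LoopFree]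
  have hl₂ : (Prog.set K (.const 1) (.load 0 (.const 0))).LoopFree := by simp [Prog.LoopFree]
  obtain ⟨C₁, hC₁, h₁⟩ := hl₁.exists_time_le
  obtain ⟨C₂, hC₂, h₂⟩ := hl₂.exists_time_le
  obtain ⟨C₃, hC₃, h₃⟩ := (convertProg_loopFree K).exists_time_le
  let X : Polynomial ℕ := Polynomial.X
  let L₀ := 2 * X + 1
  let L₁ := 2 * (Polynomial.C C₁ * L₀) + P
  refine ⟨Polynomial.C C₁ * L₀ + P + Polynomial.C C₂ * L₁ +
    Polynomial.C C₃ * (Polynomial.C C₂ * L₁) + P, fun n N hN c₁ hc₁ ct hct hct' c₂ hc₂ => ?_⟩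
  have hL₀ : L₀.eval n = 2 * n + 1 := by simp [L₀, X]
  have hL₁ : L₁.eval n = 2 * (C₁ * (2 * n + 1)) + P.eval n := by simp [L₁, hL₀]
  simp only [Polynomial.eval_add, Polynomial.eval_mul, Polynomial.eval_C, hL₀]
  set l₀ := 2 * n + 1 with hl₀
  set l₁ := L₁.eval n
  have hC₁l : l₀ ≤ C₁ * l₀ := Nat.le_mul_of_pos_left _ hC₁
  have hC₂l : l₁ ≤ C₂ * l₁ := Nat.le_mul_of_pos_left _ hC₂
  have hor {L : ℕ} (hL : l₀ ≤ L) : ∀ q v s, ∀ r ∈ (anyOracle (2 ^ (2 * n)) q v s).support,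
      r.1.size ≤ L := fun q v s r hr =>
    (size_le_of_lt_two_pow (anyOracle_size hr)).trans (by omega)
  -- the first phase
  simp only [cocksAdversary, exec, PMF.mem_support_bind_iff] at hc₁ hc₂
  obtain ⟨d₀, hd₀, d₁, hd₁, hc₁⟩ := hc₁
  obtain ⟨t₀, m₀⟩ := h₁ l₀ (by omega) _ _ (hor le_rfl) _ (memLE_start_pair hN ()) d₀ hd₀
  rw [saveModulus, exec, PMF.mem_support_pure_iff] at hd₀
  have hd₀K : d₀.mem K 0 = N + if N = 0 then 1 else 0 := by
    rw [hd₀]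
    simp [Mem.put, Expr.eval, Op.eval, start, Mem.write]
  have hd₀A : Agree K (start [N, n] ()).mem d₀.mem := by
    intro k hk i
    rw [hd₀]
    exact (Mem.put_of_ne hk.ne).symm
  obtain ⟨e₁, he₁, hf⟩ := Framed.exists_support hA₁ hd₀A rfl hd₁
  obtain ⟨t₁, -⟩ := hP.phase1 hN he₁
  have m₁ := (exec_support_mono _ _ hd₁ (L := C₁ * l₀) (m₀.mono (Nat.le_add_left _ _))).2
  have ht₁ := hf.time
  simp only [start] at ht₁ t₀
  obtain ⟨t₂, m₂⟩ := h₂ l₁ (by omega) _ _ (hor (by omega)) d₁ (m₁.mono (by omega)) c₁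
    (by rw [exec]; exact hc₁)
  rw [PMF.mem_support_pure_iff] at hc₁
  -- the second phase
  obtain ⟨d₂, hd₂, hc₂⟩ := hc₂
  obtain ⟨t₃, -⟩ := h₃ (C₂ * l₁) (by omega) _ _ (hor (by omega)) ⟨c₁.mem.write ct, (), c₁.time⟩
    (m₂.write fun w hw => (size_le_of_lt_two_pow (hct' w hw)).trans (by omega)) d₂ hd₂
  have hc₁K : c₁.mem.write ct K 0 = N + if N = 0 then 1 else 0 := by
    rw [← hd₀K, ← hf.right K le_rfl 0, hc₁]
    simp [Mem.write, Mem.put, hK.ne', Expr.eval]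
  obtain ⟨l, hl, hl', hd₂A⟩ := support_convertProg hK (by positivity)
    (by simp only [hc₁K]; split_ifs <;> omega)
    (by simp only [hc₁K]; split_ifs <;> omega) hd₂
  have hA : Agree K (e₁.mem.write l) d₂.mem := by
    intro k hk i
    have hk' : c₁.mem k i = e₁.mem k i := by
      rw [hc₁, hf.agree k hk i]
      exact Mem.put_of_ne hk.ne
    rw [hd₂A k hk i]
    simp only [Mem.write, hl, hct, hk']
    split_ifs <;> first | rfl | omega
  obtain ⟨e₂, he₂, hf₂⟩ := Framed.exists_support (c₁ := ⟨e₁.mem.write l, (), e₁.time⟩) hA₂ hA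
    rfl hc₂
  have t₄ := hP n N hN e₁ he₁ l hl hl' e₂ he₂
  have ht₄ := hf₂.time
  simp only at ht₄ t₃
  omega

/-! ### Averaging over the primes, and negligible functions -/

theorem setupMean_add (n : ℕ) (f g : ℕ → ℕ → ℝ) :
    setupMean n (fun p q => f p q + g p q) = setupMean n f + setupMean n g := by
  rw [setupMean, setupMean, setupMean, Finset.sum_add_distrib, add_div]

theorem setupMean_const_mul (n : ℕ) (c : ℝ) (f : ℕ → ℕ → ℝ) :
    setupMean n (fun p q => c * f p q) = c * setupMean n f := by
  rw [setupMean, setupMean, ← Finset.mul_sum, mul_div_assoc]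

/-- A bound for Blum integers with `n`-bit prime factors carries over to the average; here `eps` is
exponentially small. -/
theorem abs_setupMean_le {n : ℕ} {c : ℝ} (hc : 0 ≤ c) {f : ℕ → ℕ → ℝ}
    (hf : ∀ p q, Fact p.Prime → Fact q.Prime → Blum p q → p < 2 ^ n → q < 2 ^ n →
      |f p q| ≤ c * eps p q) :
    |setupMean n f| ≤ c * (64 / 2 ^ n) := by
  have hpos : 0 ≤ c * (64 / 2 ^ n) := by positivity
  have key : ∀ x ∈ primePairs n, |f x.1 x.2| ≤ c * (64 / 2 ^ n) := by
    intro x hx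
    simp only [primePairs, Finset.mem_filter, Finset.mem_product, Finset.mem_range] at hx
    obtain ⟨⟨hp, hq⟩, ⟨hp', hp4, hpn⟩, ⟨hq', hq4, hqn⟩, hne⟩ := hx
    refine (hf x.1 x.2 ⟨hp'⟩ ⟨hq'⟩ ⟨hp4, hq4, hne⟩ hp hq).trans ?_
    gcongr
    have hn : n ≠ 0 := by
      rintro rfl
      have := hp'.two_le
      omega
    have inv_le {r : ℕ} (hr : 2 ^ (n - 1) ≤ r) : (r : ℝ)⁻¹ ≤ 2 / 2 ^ n := by
      have h1 : (2 : ℝ) ^ n = 2 * 2 ^ (n - 1) := by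
        rw [← pow_succ', Nat.sub_add_cancel (Nat.one_le_iff_ne_zero.2 hn)]
      rw [h1, div_mul_cancel_left₀ two_ne_zero]
      gcongr
      exact_mod_cast hr
    have h1 := inv_le hpn
    have h2 := inv_le hqn
    calc eps x.1 x.2 ≤ 16 * (2 / 2 ^ n + 2 / 2 ^ n) := by
          unfold eps
          gcongr
      _ = 64 / 2 ^ n := by ring
  rw [setupMean, abs_div, Nat.abs_cast]
  rcases Nat.eq_zero_or_pos (primePairs n).card with h0 | h0
  · rw [h0, Nat.cast_zero, div_zero]
    exact hpos
  · rw [div_le_iff₀ (by exact_mod_cast h0)]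
    refine (Finset.abs_sum_le_sum_abs _ _).trans ((Finset.sum_le_sum key).trans (le_of_eq ?_))
    rw [Finset.sum_const, nsmul_eq_mul, mul_comm]

/-- The numerator `64` comes from `eps p q ≤ 64 / 2 ^ n` for `n`-bit primes. -/
theorem negligible_polynomial_mul_two_pow (P : Polynomial ℝ) :
    Negligible fun n => P.eval (n : ℝ) * (64 / 2 ^ n) := by
  have h1 : Negligible fun n => (64 : ℝ) / 2 ^ n := by
    intro k
    have h2 := (tendsto_pow_const_mul_const_pow_of_abs_lt_one k
      (r := (1 / 2 : ℝ)) (by rw [abs_of_pos] <;> norm_num)).const_mul 64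
    rw [mul_zero] at h2
    refine h2.congr fun n => ?_
    rw [one_div, inv_pow]
    ring
  exact h1.polynomial_mul P

theorem Negligible.of_abs_le {f g : ℕ → ℝ} (hg : Negligible g) (h : ∀ n, |f n| ≤ g n) :
    Negligible f :=
  Asymptotics.SuperpolynomialDecay.trans_abs_le hg fun n => (h n).trans (le_abs_self _)

/-- The converted adversary has the same advantage up to a negligible function. For the conversion
it uses array `K`, which the given adversary does not access. -/
theorem exists_cocksAdversary (A : Adversary) (hA : A.PolyTime 5) :
    ∃ S : Adversary, S.PolyTime 2 ∧
      Negligible fun n => advantage xhEncrypt A n - advantage cocksEncrypt S n := by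
  obtain ⟨K₁, hK₁⟩ := A.phase1.exists_below
  obtain ⟨K₂, hK₂⟩ := A.phase2.exists_below
  have hK : 0 < max 1 (max K₁ K₂) := by simp
  have h₁ := hK₁.mono (show K₁ ≤ max 1 (max K₁ K₂) by simp)
  have h₂ := hK₂.mono (show K₂ ≤ max 1 (max K₁ K₂) by simp)
  generalize max 1 (max K₁ K₂) = K at hK h₁ h₂
  refine ⟨cocksAdversary K A, cocksAdversary_polyTime hK hA h₁ h₂, ?_⟩
  refine (negligible_polynomial_mul_two_pow (.C 4)).of_abs_le fun n => ?_
  have h : advantage xhEncrypt A n - advantage cocksEncrypt (cocksAdversary K A) n =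
      setupMean n fun p q => (game xhEncrypt A n p q true).toReal -
        (game cocksEncrypt (cocksAdversary K A) n p q true).toReal := by
    simp only [advantage, sub_eq_add_neg, ← neg_one_mul (setupMean n _), ← setupMean_const_mul,
      ← setupMean_add]
    congr 1
    funext p q
    ring
  rw [h, Polynomial.eval_C]
  exact abs_setupMean_le (by norm_num) fun p q _ _ h _ _ => h.abs_game_sub_le hK h₁ h₂ n

/-! ### Changing the oracle of a program -/

/-- Oracles may be replaced by oracles with a richer state. -/
theorem expect_exec_le_of_morphism {σ₁ σ₂ : Type} {O₁ : Oracle σ₁} {O₂ : Oracle σ₂} (g : σ₁ → σ₂)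
    (h : ∀ o v s G, expect (O₂ o v (g s)) G ≤ expect (O₁ o v s) fun r => G (r.1, g r.2))
    (P : Prog) (m : Mem) (s : σ₁) (t : ℕ) (F : Config σ₂ → ℝ≥0∞) :
    expect (exec O₂ P ⟨m, g s, t⟩) F ≤
      expect (exec O₁ P ⟨m, s, t⟩) fun c => F ⟨c.mem, g c.orc, c.time⟩ := by
  obtain ⟨K, hK⟩ := P.exists_below
  have hsim : Simulation K (fun (c₁ : Config σ₁) (c₂ : Config σ₂) =>
      c₂ = ⟨c₁.mem, g c₁.orc, c₁.time⟩) fun _ _ => 1 := by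
    constructor
    · rintro c₁ _ rfl k _ i
      rfl
    · rintro c₁ _ rfl d
      exact ⟨rfl, le_rfl⟩
    · rintro c₁ _ rfl k i v d _ _
      exact ⟨rfl, le_rfl⟩
  have := hsim.stepLE (O₁ := O₁) (O₂ := O₂) (f₁ := .call) (f₂ := .call) ?_ P hK ⟨m, s, t⟩
    ⟨m, g s, t⟩ rfl
  · rw [Prog.subst_call] at this
    refine (this _ _ fun c₁ c₂ hc => ?_).trans (one_mul _).le
    rw [one_mul, hc]
  · rintro o k i e - - - c₁ _ rfl F₁ F₂ hF
    rw [one_mul, expect_call, expect_call]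
    refine (h _ _ _ _).trans (expect_mono fun r => ?_)
    exact (hF _ _ rfl).trans (one_mul _).le

/-- Oracles that behave identically until a bad event happens are equivalent with respect to
functions that vanish when the bad event has happened. -/
theorem expect_exec_le_of_good {σ : Type} {O₁ O₂ : Oracle σ} {inv good : σ → Prop}
    (h₁ : ∀ o v s, inv s → ∀ r ∈ (O₂ o v s).support, inv r.2)
    (h₂ : ∀ o v s, inv s → ¬ good s → ∀ r ∈ (O₂ o v s).support, ¬ good r.2)
    (h₃ : ∀ o v s, inv s → ∀ G : ℕ × σ → ℝ≥0∞, (∀ r, inv r.2 → ¬ good r.2 → G r = 0) →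
      expect (O₂ o v s) G ≤ expect (O₁ o v s) G)
    (P : Prog) {c : Config σ} (hc : inv c.orc) {F : Config σ → ℝ≥0∞}
    (hF : ∀ c, inv c.orc → ¬ good c.orc → F c = 0) :
    expect (exec O₂ P c) F ≤ expect (exec O₁ P c) F := by
  classical
  obtain ⟨K, hK⟩ := P.exists_below
  let w (c : Config σ) : ℝ≥0∞ := if good c.orc then 1 else 0
  have hw (c) : w c ≤ 1 := by
    simp only [w]
    split_ifs <;> simp
  have hsim : Simulation K (fun c₁ c₂ : Config σ => c₁ = c₂ ∧ inv c₂.orc) fun _ c => w c := by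
    constructor
    · rintro c₁ _ ⟨rfl, _⟩ k _ i
      rfl
    · rintro c₁ _ ⟨rfl, h⟩ d
      exact ⟨⟨rfl, h⟩, le_rfl⟩
    · rintro c₁ _ ⟨rfl, h⟩ k i v d _ _
      exact ⟨⟨rfl, h⟩, le_rfl⟩
  have := hsim.stepLE (O₁ := O₁) (O₂ := O₂) (f₁ := .call) (f₂ := .call) ?_ P hK c c ⟨rfl, hc⟩
  · rw [Prog.subst_call] at this
    refine (this F F ?_).trans (mul_le_of_le_one_left' (hw c))
    rintro c₁ _ ⟨rfl, h⟩
    simp only [w]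
    split_ifs with hg
    · rw [one_mul]
    · rw [hF _ h hg, zero_mul]
  · rintro o k i e - - - c₁ _ ⟨rfl, h⟩ F₁ F₂ hF'
    rw [expect_call, expect_call]
    by_cases hg : good c₁.orc
    · simp only [w, if_pos hg, one_mul]
      refine (expect_mono_support fun r hr => hF' _ _ ⟨rfl, h₁ _ _ _ h r hr⟩).trans
        ((h₃ _ _ _ h _ fun r _ hr' => ?_).trans (expect_mono fun r => ?_))
      · simp only [w, if_neg hr', zero_mul]
      · exact mul_le_of_le_one_left' (hw _)
    · simp only [w, if_neg hg, zero_mul]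
      refine (expect_mono_support (g := fun _ => 0) fun r hr => ?_).trans (expect_const _ _).le
      refine (hF' _ _ ⟨rfl, h₁ _ _ _ h r hr⟩).trans ?_
      simp only [w, if_neg (h₂ _ _ _ h hg r hr), zero_mul, le_refl]

/-- The runs with an oracle whose answers are below `B` are among the runs with `anyOracle B`. -/
theorem exists_support_anyOracle {σ : Type} {O : Oracle σ} {B : ℕ} {inv : ℕ → σ → Prop}
    (hmono : ∀ {t t' s}, t ≤ t' → inv t s → inv t' s)
    (h : ∀ o v t s, inv t s → ∀ r ∈ (O o v s).support, r.1 < B ∧ inv (t + 1) r.2)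
    (P : Prog) {m : Mem} {s : σ} {t : ℕ} (hs : inv t s) {c : Config σ}
    (hc : c ∈ (exec O P ⟨m, s, t⟩).support) :
    inv c.time c.orc ∧ ⟨c.mem, (), c.time⟩ ∈ (exec (anyOracle B) P ⟨m, (), t⟩).support := by
  obtain ⟨K, hK⟩ := P.exists_below
  have hsim : Simulation K (fun (c₁ : Config Unit) (c₂ : Config σ) =>
      c₁ = ⟨c₂.mem, (), c₂.time⟩ ∧ inv c₂.time c₂.orc) fun _ _ => ⊤ := by
    constructor
    · rintro _ c₂ ⟨rfl, _⟩ k _ i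
      rfl
    · rintro _ c₂ ⟨rfl, h⟩ d
      exact ⟨⟨rfl, hmono (Nat.le_add_right _ _) h⟩, le_rfl⟩
    · rintro _ c₂ ⟨rfl, h⟩ k i v d _ _
      exact ⟨⟨rfl, hmono (Nat.le_add_right _ _) h⟩, le_rfl⟩
  have := hsim.stepLE (O₁ := anyOracle B) (O₂ := O) (f₁ := .call) (f₂ := .call) ?_ P hK
    ⟨m, (), t⟩ ⟨m, s, t⟩ ⟨rfl, hs⟩
  · rw [Prog.subst_call, stepLE_top_iff] at this
    obtain ⟨_, hc', rfl, hi⟩ := this c hc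
    exact ⟨hi, hc'⟩
  · rintro o k i e - - - _ c₂ ⟨rfl, hi⟩
    rw [stepLE_top_iff]
    intro c₂' hc₂'
    simp only [exec, PMF.mem_support_bind_iff, PMF.mem_support_pure_iff] at hc₂' ⊢
    obtain ⟨r, hr, rfl⟩ := hc₂'
    obtain ⟨hrB, hri⟩ := h _ _ _ _ hi r hr
    refine ⟨_, ⟨(r.1, ()), ?_, rfl⟩, rfl, hmono (by simp only; omega) hri⟩
    rw [anyOracle, PMF.mem_support_map_iff]
    refine ⟨r.1, ?_, rfl⟩
    rw [below, mem_support_uniformOn ⟨r.1, Finset.mem_range.2 hrB⟩]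
    exact Finset.mem_range.2 hrB

/-! ### Numbering the queries to the random oracle -/

/-- The state of the challenger, together with the order in which the values of the random oracle
were fixed: `idx id` is the number of values fixed before that of `id`. -/
structure IndexedState where
  st : State
  idx : ℕ → ℕ
  cnt : ℕ

namespace IndexedState

/-- The state before the first query. -/
def empty : IndexedState := ⟨State.empty, fun _ => 0, 0⟩

/-- The state after the value `a` was chosen for `id`. -/
def assign (s : IndexedState) (id a : ℕ) : IndexedState :=
  ⟨⟨fun i => if i = id then some a else s.st.table i, s.st.keys⟩,
    fun i => if i = id then s.cnt else s.idx i, s.cnt + 1⟩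

/-- The state after the key of `id` was extracted. -/
def extract (s : IndexedState) (id : ℕ) : IndexedState :=
  ⟨⟨s.st.table, insert id s.st.keys⟩, s.idx, s.cnt⟩

/-- The properties of the states that occur in the game. -/
structure Valid (N : ℕ) (s : IndexedState) : Prop where
  mem_jac : ∀ {id a}, s.st.table id = some a → a ∈ jac N 1
  idx_lt : ∀ {id a}, s.st.table id = some a → s.idx id < s.cnt
  idx_inj : ∀ {id id' a a'}, s.st.table id = some a → s.st.table id' = some a' →
    s.idx id = s.idx id' → id = id'
  keys : ∀ {id}, id ∈ s.st.keys → ∃ a, s.st.table id = some a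

theorem valid_empty (N : ℕ) : empty.Valid N where
  mem_jac h := by simp [empty, State.empty] at h
  idx_lt h := by simp [empty, State.empty] at h
  idx_inj h := by simp [empty, State.empty] at h
  keys h := by simp [empty, State.empty] at h

theorem Valid.assign {N : ℕ} {s : IndexedState} (h : s.Valid N) {id a : ℕ}
    (ha : a ∈ jac N 1) : (s.assign id a).Valid N where
  mem_jac {i b} hi := by
    simp only [IndexedState.assign] at hi
    split_ifs at hi with h1
    · exact Option.some.inj hi ▸ ha
    · exact h.mem_jac hi
  idx_lt {i b} hi := by
    simp only [IndexedState.assign] at hi ⊢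
    split_ifs at hi ⊢ with h1
    · omega
    · exact (h.idx_lt hi).trans (Nat.lt_succ_self _)
  idx_inj {i i' b b'} hi hi' hii := by
    simp only [IndexedState.assign] at hi hi' hii
    split_ifs at hi hi' hii with h1 h2 h2
    · rw [h1, h2]
    · have := h.idx_lt hi'
      omega
    · have := h.idx_lt hi
      omega
    · exact h.idx_inj hi hi' hii
  keys {i} hi := by
    simp only [IndexedState.assign] at hi ⊢
    split_ifs with h1
    · exact ⟨a, rfl⟩
    · exact h.keys hi

theorem Valid.extract {N : ℕ} {s : IndexedState} (h : s.Valid N) {id a : ℕ}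
    (ha : s.st.table id = some a) : (s.extract id).Valid N where
  mem_jac := h.mem_jac
  idx_lt := h.idx_lt
  idx_inj := h.idx_inj
  keys {i} hi := by
    rcases Finset.mem_insert.1 hi with rfl | hi
    · exact ⟨a, ha⟩
    · exact h.keys hi

end IndexedState

/-- The random oracle, with numbered queries. -/
def indexedHash (N id : ℕ) (s : IndexedState) : PMF (ℕ × IndexedState) :=
  match s.st.table id with
  | some a => PMF.pure (a, s)
  | none => (uniformOn (jac N 1)).bind fun a => PMF.pure (a, s.assign id a)

/-- The oracles of the adversary, with numbered queries. If `plant = some j`, then key queries for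
the identity with number `j` are answered by `0`. -/
def indexedOracle (p q : ℕ) (target plant : Option ℕ) : Oracle IndexedState
  | .hash, id, s => indexedHash (p * q) id s
  | .key, id, s =>
      if target = some id then PMF.pure (0, s)
      else (indexedHash (p * q) id s).bind fun r =>
        PMF.pure (if plant = some (r.2.idx id) then 0 else secretKey p q r.1, r.2.extract id)

theorem indexedHash_of_table {N id a : ℕ} {s : IndexedState} (h : s.st.table id = some a) :
    indexedHash N id s = PMF.pure (a, s) := by
  simp [indexedHash, h]

theorem indexedHash_of_table_none {N id : ℕ} {s : IndexedState} (h : s.st.table id = none) :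
    indexedHash N id s = (uniformOn (jac N 1)).bind fun a => PMF.pure (a, s.assign id a) := by
  simp [indexedHash, h]

theorem expect_hashQuery (N id : ℕ) (s : IndexedState) (G : ℕ × State → ℝ≥0∞) :
    expect (hashQuery N id s.st) G = expect (indexedHash N id s) fun r => G (r.1, r.2.st) := by
  rcases h : s.st.table id with _ | a
  · simp only [hashQuery, h, indexedHash_of_table_none h, expect_bind, expect_pure]
    rfl
  · rw [hashQuery_of_table h, indexedHash_of_table h, expect_pure, expect_pure]

/-- What a query to the random oracle does to the state. -/
theorem support_indexedHash {N id : ℕ} (hN : (jac N 1).Nonempty) {s : IndexedState}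
    (hs : s.Valid N) {r : ℕ × IndexedState} (hr : r ∈ (indexedHash N id s).support) :
    r.2.Valid N ∧ r.2.st.table id = some r.1 ∧ r.2.st.keys = s.st.keys ∧ r.2.cnt ≤ s.cnt + 1 ∧
      ∀ i a, s.st.table i = some a → r.2.st.table i = some a ∧ r.2.idx i = s.idx i := by
  rcases h : s.st.table id with _ | a
  · rw [indexedHash_of_table_none h] at hr
    simp only [PMF.mem_support_bind_iff, PMF.mem_support_pure_iff] at hr
    obtain ⟨a, ha, rfl⟩ := hr
    rw [mem_support_uniformOn hN] at ha
    refine ⟨hs.assign ha, by simp [IndexedState.assign], rfl, le_rfl, fun i b hi => ?_⟩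
    have : i ≠ id := by
      rintro rfl
      simp [h] at hi
    simp [IndexedState.assign, this, hi]
  · rw [indexedHash_of_table h, PMF.mem_support_pure_iff] at hr
    subst hr
    exact ⟨hs, h, rfl, Nat.le_succ _, fun i b hi => ⟨hi, rfl⟩⟩

/-- What an oracle query does to the state. -/
theorem support_indexedOracle {p q : ℕ} (hN : (jac (p * q) 1).Nonempty) {target plant : Option ℕ}
    {o : Query} {v : ℕ} {s : IndexedState} (hs : s.Valid (p * q)) {r : ℕ × IndexedState}
    (hr : r ∈ (indexedOracle p q target plant o v s).support) :
    r.1 < p * q ∧ r.2.Valid (p * q) ∧ s.st.keys ⊆ r.2.st.keys ∧ r.2.cnt ≤ s.cnt + 1 ∧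
      ∀ i a, s.st.table i = some a → r.2.st.table i = some a ∧ r.2.idx i = s.idx i := by
  have hpos : 0 < p * q := by
    obtain ⟨a, ha⟩ := hN
    exact (Nat.zero_le a).trans_lt (mem_jac ha).1
  cases o with
  | hash =>
    obtain ⟨h1, h2, h3, h4, h5⟩ := support_indexedHash hN hs hr
    exact ⟨(mem_jac (h1.mem_jac h2)).1, h1, h3.ge, h4, h5⟩
  | key =>
    rw [indexedOracle] at hr
    split_ifs at hr
    · rw [PMF.mem_support_pure_iff] at hr
      subst hr
      exact ⟨hpos, hs, subset_rfl, Nat.le_succ _, fun i a hi => ⟨hi, rfl⟩⟩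
    · simp only [PMF.mem_support_bind_iff, PMF.mem_support_pure_iff] at hr
      obtain ⟨r', hr', rfl⟩ := hr
      obtain ⟨h1, h2, h3, h4, h5⟩ := support_indexedHash hN hs hr'
      refine ⟨?_, h1.extract h2, ?_, h4, h5⟩
      · simp only
        split_ifs
        · exact hpos
        · exact Nat.mod_lt _ hpos
      · rw [← h3]
        exact Finset.subset_insert _ _

/-! ### The game with numbered identities -/

/-- The part of the traced game after the first phase. -/
def tracedTail (enc : ℕ → Bool → PMF (List ℕ)) (A : Adversary) (p q : ℕ) (plant : Option ℕ)
    (c₁ : Config IndexedState) : PMF (Option (ℕ × Bool)) :=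
  (PMF.uniformOfFintype Bool).bind fun b =>
    if c₁.mem 0 0 ∈ c₁.orc.st.keys then PMF.pure none
    else
      (indexedHash (p * q) (c₁.mem 0 0) c₁.orc).bind fun r =>
      (enc r.1 (if b then decide (c₁.mem 0 2 ≠ 0) else decide (c₁.mem 0 1 ≠ 0))).bind fun ct =>
      (exec (indexedOracle p q (some (c₁.mem 0 0)) plant) A.phase2
        ⟨c₁.mem.write ct, r.2, c₁.time⟩).map
        fun c₂ => some (r.2.idx (c₁.mem 0 0), decide (b = decide (c₂.mem 0 0 ≠ 0)))

/-- The game with a more informative result: `none` if the key of the challenge identity was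
extracted, and otherwise the number of the challenge identity and whether the adversary wins. -/
def traced (enc : ℕ → Bool → PMF (List ℕ)) (A : Adversary) (n p q : ℕ) (plant : Option ℕ) :
    PMF (Option (ℕ × Bool)) :=
  (exec (indexedOracle p q none plant) A.phase1 (start [p * q, n] IndexedState.empty)).bind
    (tracedTail enc A p q plant)

/-- The probability of `v` if the result of the traced game is used for the identity with number
`j` only, and a coin is tossed otherwise. -/
def score (j : ℕ) (v : Bool) (o : Option (ℕ × Bool)) : ℝ≥0∞ :=
  if o = some (j, v) then 1 else if o = some (j, !v) then 0 else 2⁻¹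

theorem expect_congr {α : Type} {μ : PMF α} {f g : α → ℝ≥0∞} (h : ∀ a, f a = g a) :
    expect μ f = expect μ g :=
  expect_congr_support fun a _ => h a

/-- The score is an affine function of the two indicators, so that comparisons of the probabilities
of `some (j, v)` carry over to scores. -/
theorem score_add (j : ℕ) (v : Bool) (o : Option (ℕ × Bool)) :
    score j v o + 2⁻¹ * (if o = some (j, !v) then 1 else 0) =
      2⁻¹ + 2⁻¹ * (if o = some (j, v) then 1 else 0) := by
  have hv : some (j, v) ≠ some (j, !v) := by simp
  unfold score
  by_cases h1 : o = some (j, v)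
  · subst h1
    simp [ENNReal.inv_two_add_inv_two]
  · by_cases h2 : o = some (j, !v)
    · subst h2
      simp [h1]
    · simp [h1, h2]

/-- The sum of the scores over all guesses `j`: the right guess contributes the result of the game,
and the `T` wrong ones contribute a coin toss each. -/
theorem sum_score {T : ℕ} (v : Bool) {o : Option (ℕ × Bool)}
    (ho : ∀ i w, o = some (i, w) → i < T + 1) :
    (o.elim 2⁻¹ fun x => if x.2 = v then 1 else 0) + T * 2⁻¹ ≤
      ∑ j ∈ Finset.range (T + 1), score j v o := by
  rcases o with _ | ⟨i, w⟩
  · have h : ∀ j, score j v none = 2⁻¹ := fun j => by simp [score]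
    simp only [Option.elim, h, Finset.sum_const, Finset.card_range, nsmul_eq_mul]
    push_cast
    rw [add_mul, one_mul, add_comm]
  · have hi := Finset.mem_range.2 (ho i w rfl)
    rw [← Finset.add_sum_erase _ _ hi]
    refine add_le_add ?_ (le_of_eq ?_)
    · cases v <;> cases w <;> simp [score]
    · have h : ∀ j ∈ (Finset.range (T + 1)).erase i, score j v (some (i, w)) = 2⁻¹ := by
        intro j hj
        have := (Finset.mem_erase.1 hj).1.symm
        simp [score, this]
      rw [Finset.sum_congr rfl h, Finset.sum_const, Finset.card_erase_of_mem hi, Finset.card_range,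
        nsmul_eq_mul, Nat.add_sub_cancel]

section Traced

variable {p q : ℕ}

theorem expect_traced (enc : ℕ → Bool → PMF (List ℕ)) (A : Adversary) (n : ℕ) (plant : Option ℕ)
    (F : Option (ℕ × Bool) → ℝ≥0∞) : expect (traced enc A n p q plant) F =
      expect (exec (indexedOracle p q none plant) A.phase1 (start [p * q, n] IndexedState.empty))
        fun c => expect (tracedTail enc A p q plant c) F :=
  expect_bind _ _ _

/-- Forgetting the numbers of the queries gives the oracles of the game. -/
theorem expect_ibeOracle_le (target : Option ℕ) (o : Query) (v : ℕ) (s : IndexedState)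
    (G : ℕ × State → ℝ≥0∞) : expect (ibeOracle p q target o v s.st) G ≤
      expect (indexedOracle p q target none o v s) fun r => G (r.1, r.2.st) := by
  cases o with
  | hash => exact (expect_hashQuery _ _ _ _).le
  | key =>
    rw [ibeOracle, indexedOracle]
    by_cases ht : target = some v
    · rw [if_pos ht, if_pos ht, expect_pure, expect_pure]
    · simp only [if_neg ht, expect_bind, expect_hashQuery, expect_pure, reduceCtorEq, if_false]
      exact le_rfl

/-- Forgetting the number of the challenge identity, and tossing a coin where the key of the
challenge identity was extracted, gives the game. -/
theorem expect_game_le_traced (encrypt : ℕ → ℕ → Bool → PMF (List ℕ)) (A : Adversary) (n : ℕ)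
    (v : Bool) : game encrypt A n p q v ≤
      expect (traced (encrypt (p * q)) A n p q none) fun o =>
        o.elim 2⁻¹ fun x => if x.2 = v then 1 else 0 := by
  have e1 : game encrypt A n p q =
    (exec (ibeOracle p q none) A.phase1 (start [p * q, n] State.empty)).bind
      (gameTail encrypt A p q) := rfl
  rw [← expect_indicator, e1, expect_bind, expect_traced]
  refine (expect_exec_le_of_morphism IndexedState.st (expect_ibeOracle_le none) A.phase1
    (start [p * q, n] IndexedState.empty).mem IndexedState.empty 0 _).trans
    (expect_mono fun c => ?_)
  rw [gameTail, tracedTail, expect_bind, expect_bind]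
  by_cases hkeys : c.mem 0 0 ∈ c.orc.st.keys
  · simp only [if_pos hkeys, expect_pure, Option.elim]
    rw [expect_coin, expect_coin]
    cases v <;> simp [ENNReal.inv_two_add_inv_two]
  · simp only [if_neg hkeys]
    refine expect_mono fun b => ?_
    rw [expect_bind, expect_hashQuery, expect_bind]
    refine expect_mono fun r => ?_
    rw [expect_bind, expect_bind]
    refine expect_mono fun ct => ?_
    rw [expect_map, expect_map]
    exact expect_exec_le_of_morphism IndexedState.st (expect_ibeOracle_le _) A.phase2
      (c.mem.write ct) r.2 c.time _

/-- If the encryption hides the message perfectly, then the adversary wins with probability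
`1 / 2`. -/
theorem expect_traced_score_of_hiding {enc : ℕ → Bool → PMF (List ℕ)}
    (henc : ∀ a b, enc a b = enc a true) (A : Adversary) (n : ℕ) (plant : Option ℕ) (j : ℕ)
    (v : Bool) : expect (traced enc A n p q plant) (score j v) = 2⁻¹ := by
  rw [expect_traced]
  refine Eq.trans (expect_congr fun c => ?_) (expect_const _ 2⁻¹)
  rw [tracedTail, expect_bind]
  have hnone : score j v none = 2⁻¹ := by simp [score]
  by_cases hkeys : c.mem 0 0 ∈ c.orc.st.keys
  · simp only [if_pos hkeys, expect_pure, hnone]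
    exact expect_const _ _
  · simp only [if_neg hkeys, expect_bind, expect_map, henc _ (ite _ _ _)]
    rw [expect_coin, ← expect_add, ← expect_const_mul]
    refine Eq.trans (expect_congr fun r => ?_) (expect_const _ 2⁻¹)
    rw [← expect_add, ← expect_const_mul]
    refine Eq.trans (expect_congr fun ct => ?_) (expect_const _ 2⁻¹)
    rw [← expect_add, ← expect_const_mul]
    refine Eq.trans (expect_congr fun c₂ => ?_) (expect_const _ 2⁻¹)
    generalize decide (c₂.mem 0 0 ≠ 0) = g
    by_cases hj : r.2.idx (c.mem 0 0) = j
    · cases v <;> cases g <;> simp [score, hj]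
    · simp [score, hj, ENNReal.inv_two_add_inv_two]

variable [hp : Fact p.Prime] [hq : Fact q.Prime]

/-- No key of the identity with number `j` was extracted. -/
def IndexedState.Unextracted (j : ℕ) (s : IndexedState) : Prop := ∀ id ∈ s.st.keys, s.idx id ≠ j

/-- Oracles that differ only in whether they reveal the key for number `j` behave in the same way,
except when that key is extracted. -/
theorem Blum.expect_indexedOracle_le (h : Blum p q) {j : ℕ} {plant₁ plant₂ : Option ℕ}
    (hplant : ∀ i, i ≠ j → (plant₂ = some i ↔ plant₁ = some i)) (target : Option ℕ) (o : Query)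
    (v : ℕ) {s : IndexedState} (hs : s.Valid (p * q)) {G : ℕ × IndexedState → ℝ≥0∞}
    (hG : o = .key → target ≠ some v → ∀ a (s' : IndexedState), s'.Valid (p * q) →
      s'.st.table v = some a →
      (∀ i a, s.st.table i = some a → s'.st.table i = some a ∧ s'.idx i = s.idx i) →
      s'.idx v = j → ∀ w, G (w, s'.extract v) = 0) :
    expect (indexedOracle p q target plant₂ o v s) G ≤
      expect (indexedOracle p q target plant₁ o v s) G := by
  cases o with
  | hash => exact le_rfl
  | key =>
    rw [indexedOracle, indexedOracle]
    split_ifs with ht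
    · exact le_rfl
    · rw [expect_bind, expect_bind]
      refine expect_mono_support fun r hr => ?_
      obtain ⟨h1, h2, -, -, h5⟩ := support_indexedHash (h.jac_nonempty (Or.inl rfl)) hs hr
      rw [expect_pure, expect_pure]
      by_cases hj : r.2.idx v = j
      · rw [hG rfl ht _ _ h1 h2 h5 hj]
        exact bot_le
      · rw [if_congr (hplant _ hj) rfl rfl]

/-- As long as the key of the identity with number `j` is not extracted, it does not matter whether
the oracle would reveal it. -/
theorem Blum.expect_traced_le (h : Blum p q) (enc : ℕ → Bool → PMF (List ℕ)) (A : Adversary) (n : ℕ)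
    {j : ℕ} {plant₁ plant₂ : Option ℕ} (hplant : ∀ i, i ≠ j → (plant₂ = some i ↔ plant₁ = some i))
    (v : Bool) :
    expect (traced enc A n p q plant₂) (fun o => if o = some (j, v) then 1 else 0) ≤
      expect (traced enc A n p q plant₁) fun o => if o = some (j, v) then 1 else 0 := by
  have hJ : (jac (p * q) 1).Nonempty := h.jac_nonempty (Or.inl rfl)
  rw [expect_traced, expect_traced]
  set F : Option (ℕ × Bool) → ℝ≥0∞ := fun o => if o = some (j, v) then 1 else 0 with hF
  refine (expect_exec_le_of_good (O₁ := indexedOracle p q none plant₁)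
    (inv := IndexedState.Valid (p * q)) (good := IndexedState.Unextracted j)
    (fun o v s hs r hr => (support_indexedOracle hJ hs hr).2.1) (fun o v s hs hg r hr hg' => ?_)
    (fun o v s hs G hG => h.expect_indexedOracle_le hplant none o v hs
      fun _ _ a s' hs' ha _ hj w => hG _ (hs'.extract ha) fun hg =>
        hg v (Finset.mem_insert_self _ _) hj)
    A.phase1 (IndexedState.valid_empty _) fun c hc hg => ?_).trans
    (expect_mono_support fun c hc => ?_)
  · obtain ⟨-, -, h3, -, h5⟩ := support_indexedOracle hJ hs hr
    refine hg fun id hid => ?_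
    obtain ⟨a, ha⟩ := hs.keys hid
    rw [← (h5 id a ha).2]
    exact hg' id (h3 hid)
  · -- the challenge identity does not have number `j`, because its key was not extracted
    rw [tracedTail, expect_bind]
    refine le_antisymm ((expect_mono (g := fun _ => 0) fun b => ?_).trans (expect_const _ 0).le)
      bot_le
    by_cases hkeys : c.mem 0 0 ∈ c.orc.st.keys
    · rw [if_pos hkeys, expect_pure, hF]
      simp
    · rw [if_neg hkeys, expect_bind]
      refine (expect_mono_support (g := fun _ => 0) fun r hr => ?_).trans (expect_const _ 0).le
      obtain ⟨h1, h2, h3, -, h5⟩ := support_indexedHash hJ hc hr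
      have hj : r.2.idx (c.mem 0 0) ≠ j := by
        intro hj
        refine hg fun id hid hj' => ?_
        obtain ⟨a, ha⟩ := hc.keys hid
        obtain ⟨h6, h7⟩ := h5 id a ha
        have := h1.idx_inj h6 h2 (h7.trans (hj'.trans hj.symm))
        exact hkeys (this ▸ hid)
      rw [expect_bind]
      refine (expect_mono (g := fun _ => 0) fun ct => ?_).trans (expect_const _ 0).le
      rw [expect_map]
      refine (expect_mono (g := fun _ => 0) fun c₂ => ?_).trans (expect_const _ 0).le
      simp [hF, hj]
  · have hcv := (exists_support_anyOracle (B := p * q) (inv := fun _ s => s.Valid (p * q))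
      (fun _ h => h) (fun o v t s hs r hr => ⟨(support_indexedOracle hJ hs hr).1,
        (support_indexedOracle hJ hs hr).2.1⟩) A.phase1 (IndexedState.valid_empty _) hc).1
    rw [tracedTail, tracedTail, expect_bind, expect_bind]
    refine expect_mono fun b => ?_
    by_cases hkeys : c.mem 0 0 ∈ c.orc.st.keys
    · rw [if_pos hkeys, if_pos hkeys]
    · rw [if_neg hkeys, if_neg hkeys, expect_bind, expect_bind]
      refine expect_mono_support fun r hr => ?_
      obtain ⟨h1, h2, -⟩ := support_indexedHash hJ hcv hr
      rw [expect_bind, expect_bind]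
      refine expect_mono fun ct => ?_
      rw [expect_map, expect_map]
      by_cases hj : r.2.idx (c.mem 0 0) = j
      · -- the other identities, whose keys are not refused, have other numbers
        refine expect_exec_le_of_good (inv := fun s => s.Valid (p * q) ∧
            s.st.table (c.mem 0 0) = some r.1 ∧ s.idx (c.mem 0 0) = j) (good := fun _ => True)
          (fun o v s hs r hr => ?_) (fun o v s _ hg => absurd trivial hg)
          (fun o v s hs G _ => h.expect_indexedOracle_le hplant _ o v hs.1
            fun _ hv a s' hs' ha h5 hj' w => ?_) A.phase2 ⟨h1, h2, hj⟩ fun _ _ hg =>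
              absurd trivial hg
        · obtain ⟨-, h6, -, -, h7⟩ := support_indexedOracle hJ hs.1 hr
          obtain ⟨h8, h9⟩ := h7 _ _ hs.2.1
          exact ⟨h6, h8, h9.trans hs.2.2⟩
        · obtain ⟨h8, h9⟩ := h5 _ _ hs.2.1
          have := hs'.idx_inj ha h8 (hj'.trans (h9.trans hs.2.2).symm)
          exact absurd (congrArg some this.symm) hv
      · refine (expect_mono (g := fun _ => 0) fun c₂ => ?_).trans
          ((expect_const _ 0).le.trans bot_le)
        simp [hF, hj]

/-- The oracle that refuses the key for number `j` can replace the true one as far as the score for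
`j` is concerned: if that key is extracted, the score is `1 / 2` in any case. -/
theorem Blum.expect_traced_score (h : Blum p q) (enc : ℕ → Bool → PMF (List ℕ)) (A : Adversary)
    (n j : ℕ) (v : Bool) : expect (traced enc A n p q (some j)) (score j v) =
      expect (traced enc A n p q none) (score j v) := by
  have h1 (v : Bool) : expect (traced enc A n p q (some j))
      (fun o => if o = some (j, v) then 1 else 0) =
      expect (traced enc A n p q none) (fun o => if o = some (j, v) then 1 else 0) :=
    le_antisymm (h.expect_traced_le enc A n (fun i hi => by simp [hi.symm]) v)
      (h.expect_traced_le enc A n (fun i hi => by simp [hi.symm]) v)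
  have h2 (μ : PMF (Option (ℕ × Bool))) : expect μ (score j v) +
      2⁻¹ * expect μ (fun o => if o = some (j, !v) then 1 else 0) =
      2⁻¹ + 2⁻¹ * expect μ (fun o => if o = some (j, v) then 1 else 0) := by
    rw [← expect_const_mul, ← expect_const_mul, ← expect_add]
    refine (expect_congr (score_add j v)).trans ?_
    rw [expect_add, expect_const]
  have h3 := h2 (traced enc A n p q (some j))
  rw [h1, h1, ← h2] at h3
  refine (ENNReal.add_left_inj (ENNReal.mul_ne_top (by simp) ?_)).1 h3
  refine ne_top_of_le_ne_top ENNReal.one_ne_top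
    ((expect_mono (g := fun _ => 1) fun o => ?_).trans (expect_const _ 1).le)
  split_ifs <;> simp

/-- After the first phase, at most as many hash values are fixed as its running time allows, and the
run is also one with arbitrary answers of the oracles. -/
theorem Blum.support_phase1 (h : Blum p q) {A : Adversary} {P : Polynomial ℕ} (hP : A.TimeBound 5 P)
    {n : ℕ} (hN : p * q < 2 ^ (2 * n)) {plant : Option ℕ} {c : Config IndexedState}
    (hc : c ∈ (exec (indexedOracle p q none plant) A.phase1
      (start [p * q, n] IndexedState.empty)).support) :
    c.orc.Valid (p * q) ∧ c.orc.cnt ≤ P.eval n ∧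
      ⟨c.mem, (), c.time⟩ ∈ (exec (anyOracle (2 ^ (2 * n))) A.phase1
        (start [p * q, n] ())).support := by
  have hJ : (jac (p * q) 1).Nonempty := h.jac_nonempty (Or.inl rfl)
  obtain ⟨⟨h1, h2⟩, h3⟩ := exists_support_anyOracle (B := 2 ^ (2 * n))
    (inv := fun t s => s.Valid (p * q) ∧ s.cnt ≤ t) (fun ht h => ⟨h.1, h.2.trans ht⟩)
    (fun o v t s hs r hr => by
      obtain ⟨h1, h2, -, h4, -⟩ := support_indexedOracle hJ hs.1 hr
      exact ⟨h1.trans hN, h2, h4.trans (by have := hs.2; omega)⟩) A.phase1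
    ⟨IndexedState.valid_empty _, le_rfl⟩ hc
  exact ⟨h1, h2.trans (hP.phase1 hN h3).1, h3⟩

/-- Numbers of identities are at most the running time of the first phase. -/
theorem Blum.lt_of_mem_support_traced (h : Blum p q) (enc : ℕ → Bool → PMF (List ℕ)) {A : Adversary}
    {P : Polynomial ℕ} (hP : A.TimeBound 5 P) {n : ℕ} (hN : p * q < 2 ^ (2 * n))
    {plant : Option ℕ} {i : ℕ} {w : Bool}
    (hi : some (i, w) ∈ (traced enc A n p q plant).support) : i < P.eval n + 1 := by
  have hJ : (jac (p * q) 1).Nonempty := h.jac_nonempty (Or.inl rfl)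
  rw [traced, PMF.mem_support_bind_iff] at hi
  obtain ⟨c, hc, hi⟩ := hi
  obtain ⟨h1, h2, -⟩ := h.support_phase1 hP hN hc
  rw [tracedTail, PMF.mem_support_bind_iff] at hi
  obtain ⟨b, -, hi⟩ := hi
  by_cases hkeys : c.mem 0 0 ∈ c.orc.st.keys
  · rw [if_pos hkeys, PMF.mem_support_pure_iff] at hi
    exact absurd hi (by simp)
  · rw [if_neg hkeys] at hi
    simp only [PMF.mem_support_bind_iff, PMF.mem_support_map_iff] at hi
    obtain ⟨r, hr, _, _, _, _, hi⟩ := hi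
    obtain ⟨h3, h4, -, h5, -⟩ := support_indexedHash hJ h1 hr
    have h6 := h3.idx_lt h4
    simp only [Option.some.injEq, Prod.mk.injEq] at hi
    omega

/-- The hybrid argument: guessing the number of the challenge identity costs the number of
possible values as a factor of the advantage. -/
theorem Blum.game_le_sum_score (h : Blum p q) (encrypt : ℕ → ℕ → Bool → PMF (List ℕ))
    {A : Adversary} {P : Polynomial ℕ} (hP : A.TimeBound 5 P) {n : ℕ} (hN : p * q < 2 ^ (2 * n))
    (v : Bool) : game encrypt A n p q v + (P.eval n : ℕ) * 2⁻¹ ≤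
      ∑ j ∈ Finset.range (P.eval n + 1),
        expect (traced (encrypt (p * q)) A n p q (some j)) (score j v) := by
  simp only [h.expect_traced_score]
  rw [← expect_sum, ← expect_const (traced (encrypt (p * q)) A n p q none) ((P.eval n : ℕ) * 2⁻¹)]
  refine (add_le_add_left (expect_game_le_traced encrypt A n v) _).trans ?_
  rw [← expect_add]
  refine expect_mono_support fun o ho => ?_
  refine sum_score v fun i w hi => ?_
  subst hi
  exact h.lt_of_mem_support_traced _ hP hN ho

end Traced

/-! ### Simulating the oracles on the machine -/

/-!
The simulation keeps the modulus in cell `0` of array `K`. In array `K + 1` it keeps the number `j`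
of the identity for which the given element `x` is planted (cell `0`), `x` itself (cell `1`), the
challenge bit (cell `3`), the sign that was used to plant `x` (cell `4`), the number of hash values
fixed so far (cell `5`), the successor of the challenge identity, or `0` (cell `6`), and the query
that is being answered (cell `8`). The arrays `K + 2`, …, `K + 5` hold, for each identity, the
successor of its hash value (or `0`), its secret key, its number, and whether its key was extracted.
-/

/-- The query that is being answered. -/
abbrev argExpr (K : ℕ) : Expr := reg (K + 1) 8

/-- Multiply by `(-1) ^ s` and reduce modulo `M`. -/
def signedMod (M s v : ℕ) : ℕ := (1 - s + s * (M - 1)) * v % M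

/-- Reduce `(-1) ^ s * v` modulo the modulus. -/
def signedExpr (K : ℕ) (s v : Expr) : Expr := .bin .mod (.bin .mul (signExpr K s) v) (modulus K)

/-- Make sure that the hash value of the identity in `argExpr` is fixed. New hash values are
`± y ^ 4`, with the secret key `± y ^ 2`, except that it is `± x * y ^ 2`, with unknown secret key,
for the identity that is chosen to have `x` planted. -/
def hashProg (K : ℕ) : Prog :=
  let s := reg (K + 1) 10
  let sq : Expr := .bin .mul (reg (K + 1) 9) (reg (K + 1) 9)
  .ite (.bin .eq (.load (K + 2) (argExpr K)) (.const 0))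
    (.seq (.rand (K + 1) (.const 10) (.const 2)) <|
    .seq (.rand (K + 1) (.const 9) (modulus K)) <|
    .seq (.ite (.bin .eq (reg (K + 1) 5) (reg (K + 1) 0))
      (.seq (.set (K + 2) (argExpr K)
          (.bin .add (.const 1) (signedExpr K s (.bin .mul (reg (K + 1) 1) sq))))
        (.set (K + 1) (.const 4) s))
      (.seq (.set (K + 3) (argExpr K)
          (signedExpr K (.bin .mul s (.bin .eq (.bin .mod (modulus K) (.const 8)) (.const 1))) sq))
        (.set (K + 2) (argExpr K) (.bin .add (.const 1) (signedExpr K s (.bin .mul sq sq)))))) <|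
    .seq (.set (K + 4) (argExpr K) (reg (K + 1) 5))
      (.set (K + 1) (.const 5) (.bin .add (reg (K + 1) 5) (.const 1))))
    .skip

/-- The programs that replace the oracle calls of the adversary. -/
def simulateCall (K : ℕ) : Query → ℕ → Expr → Expr → Prog
  | .hash, k, i, e =>
    .seq (.set (K + 1) (.const 8) e) <|
    .seq (hashProg K) (.set k i (.bin .sub (.load (K + 2) (argExpr K)) (.const 1)))
  | .key, k, i, e =>
    .seq (.set (K + 1) (.const 8) e) <|
    .ite (.bin .eq (reg (K + 1) 6) (.bin .add (argExpr K) (.const 1))) (.set k i (.const 0)) <|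
    .seq (hashProg K) <|
    .seq (.set (K + 5) (argExpr K) (.const 1)) (.set k i (.load (K + 3) (argExpr K)))

/-- The memory after `hashProg` has made the random choices `s` and `y`. -/
def hashMem (K : ℕ) (m : Mem) (s y : ℕ) : Mem :=
  let m₁ := (m.put (K + 1) 10 s).put (K + 1) 9 y
  let id := m (K + 1) 8
  let m₂ :=
    if m (K + 1) 5 = m (K + 1) 0 then
      (m₁.put (K + 2) id (1 + signedMod (m K 0) s (m (K + 1) 1 * (y * y)))).put (K + 1) 4 s
    else
      (m₁.put (K + 3) id (signedMod (m K 0) (s * if m K 0 % 8 = 1 then 1 else 0) (y * y))).put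
        (K + 2) id (1 + signedMod (m K 0) s (y * y * (y * y)))
  (m₂.put (K + 4) id (m (K + 1) 5)).put (K + 1) 5 (m (K + 1) 5 + 1)

/-- The effect of `hashProg` in terms of `hashMem`. -/
theorem expect_hashProg_ge {σ : Type} (O : Oracle σ) {K : ℕ} {c : Config σ}
    {F : Config σ → ℝ≥0∞} {G : Mem → ℝ≥0∞} (hG : ∀ m t, G m ≤ F ⟨m, c.orc, t⟩) :
    (if c.mem (K + 2) (c.mem (K + 1) 8) = 0 then
      expect (below 2) fun s => expect (below (c.mem K 0)) fun y => G (hashMem K c.mem s y)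
    else G c.mem) ≤ expect (exec O (hashProg K) c) F := by
  rw [hashProg, expect_exec_ite]
  by_cases h0 : c.mem (K + 2) (c.mem (K + 1) 8) = 0
  · simp only [Expr.eval, Op.eval, h0, if_true, ne_eq, one_ne_zero, not_false_eq_true]
    rw [expect_seq, expect_rand]
    refine expect_mono fun s => ?_
    rw [expect_seq, expect_rand]
    have h1 : ((c.mem.put (K + 1) 10 s) K 0) = c.mem K 0 := Mem.put_of_ne (by omega)
    simp only [Expr.eval, h1]
    refine expect_mono fun y => ?_
    rw [expect_seq, expect_exec_ite]
    by_cases hj : c.mem (K + 1) 5 = c.mem (K + 1) 0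
    · simp [expect_seq, expect_set, Expr.eval, Op.eval, signedExpr, signExpr, Mem.put, hj]
      refine le_trans (le_of_eq ?_) (hG _ _)
      congr 1
      funext k i
      simp [hashMem, hj, Mem.put, signedMod]
    · simp [expect_seq, expect_set, Expr.eval, Op.eval, signedExpr, signExpr, Mem.put, hj]
      refine le_trans (le_of_eq ?_) (hG _ _)
      congr 1
      funext k i
      simp [hashMem, hj, Mem.put, signedMod]
  · simp only [Expr.eval, Op.eval, h0, if_false, ne_eq, not_true_eq_false, expect_skip]
    exact hG _ _

/-- The memory `m` of the machine represents the state `s` of the challenger, in the run with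
planted number `j`. The challenge bit is `b`; the challenge identity, once it is chosen, has
number `j` and hash value `a₀`. -/
structure Tracks (p q K j x : ℕ) (target : Option ℕ) (b a₀ : ℕ) (m : Mem) (s : IndexedState) :
    Prop where
  modulus : m K 0 = p * q
  number : m (K + 1) 0 = j
  element : m (K + 1) 1 = x
  bit : m (K + 1) 3 = b
  count : m (K + 1) 5 = s.cnt
  challenge : m (K + 1) 6 = target.elim 0 (· + 1)
  table : ∀ id, m (K + 2) id = (s.st.table id).elim 0 (· + 1)
  root : ∀ id, m (K + 3) id =
    (s.st.table id).elim 0 fun a => if s.idx id = j then 0 else secretKey p q a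
  idx : ∀ id, m (K + 4) id = s.idx id
  keys : ∀ id, m (K + 5) id ≠ 0 ↔ id ∈ s.st.keys
  planted : ∀ id a, s.st.table id = some a → s.idx id = j →
    (IsSquare (a : ZMod (p * q)) ↔ (IsSquare (x : ZMod (p * q)) ↔ m (K + 1) 4 = 0))
  sign_lt : m (K + 1) 4 < 2
  valid : s.Valid (p * q)
  pinned : ∀ id, target = some id → s.st.table id = some a₀ ∧ s.idx id = j

theorem cast_signedMod {M s : ℕ} [NeZero M] (hs : s < 2) (v : ℕ) :
    signedMod M s v = ((-1) ^ s * (v : ZMod M)).val := by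
  rw [signedMod, ← ZMod.val_natCast, Nat.cast_mul, cast_sign hs]

section Tracks

variable {p q : ℕ} [hp : Fact p.Prime] [hq : Fact q.Prime]

/-- A loss by the factor `coeps p q` makes up for the difference between the distributions of
simulated and true hash values. -/
theorem Blum.expect_hash_le (h : Blum p q) (h0 : coeps p q ≠ 0) {x : ZMod (p * q)}
    (hx : chi x = 1) (planted : Prop) [Decidable planted] {F₁ : ℕ → ℕ → ℝ≥0∞} {F₂ : ℕ → ℝ≥0∞}
    (hF : ∀ s < 2, ∀ y : ℕ, y.Coprime (p * q) →
      F₂ ((-1) ^ s * if planted then x * (y : ZMod (p * q)) ^ 2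
        else (y : ZMod (p * q)) ^ 4).val ≤ coeps p q * F₁ s y) :
    expect (uniformOn (jac (p * q) 1)) F₂ ≤
      expect (below 2) fun s => expect (below (p * q)) fun y => F₁ s y := by
  have htop : coeps p q ≠ ⊤ := ne_top_of_le_ne_top ENNReal.one_ne_top (coeps_le_one p q)
  have h1 : expect (uniformOn (jac (p * q) 1)) F₂ =
      coeps p q * expect (uniformOn (jac (p * q) 1)) fun a => (coeps p q)⁻¹ * F₂ a := by
    rw [expect_const_mul, ← mul_assoc, ENNReal.mul_inv_cancel h0 htop, one_mul]
  have h2 {y z : ℝ≥0∞} (hyz : y ≤ coeps p q * z) : (coeps p q)⁻¹ * y ≤ z := by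
    calc (coeps p q)⁻¹ * y ≤ (coeps p q)⁻¹ * (coeps p q * z) := by gcongr
      _ = z := by rw [← mul_assoc, ENNReal.inv_mul_cancel h0 htop, one_mul]
  rw [h1]
  by_cases hpl : planted
  · simp only [if_pos hpl] at hF
    refine h.coeps_mul_hash_le_mul_sq hx fun s hs y hy => ?_
    rw [mul_assoc]
    exact h2 (hF s hs y hy)
  · simp only [if_neg hpl] at hF
    exact h.coeps_mul_hash_le_pow_four fun s hs y hy => h2 (hF s hs y hy)

/-- Whether `± x y²` is a square depends on `x` and the sign only, since `-1` is not a square but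
has Jacobi symbol `1`. -/
theorem Blum.isSquare_planted (h : Blum p q) {x y : ZMod (p * q)} (hx : chi x = 1)
    (hy : IsUnit y) {s : ℕ} (hs : s < 2) :
    IsSquare ((-1) ^ s * (x * y ^ 2)) ↔ (IsSquare x ↔ s = 0) := by
  have h1 : IsSquare (x * y ^ 2) ↔ IsSquare x := by
    constructor
    · rintro ⟨z, hz⟩
      refine ⟨z * y⁻¹, ?_⟩
      have h2 : y * y⁻¹ = 1 := ZMod.mul_inv_of_unit y hy
      linear_combination (y⁻¹) ^ 2 * hz - x * (1 + y * y⁻¹) * h2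
    · rintro ⟨z, rfl⟩
      exact ⟨z * y, by ring⟩
  interval_cases s
  · simp [h1]
  · rw [pow_one, neg_one_mul, h.isSquare_neg_iff (by rw [h.chi_mul, h.chi_sq hy, hx, mul_one]), h1]
    simp

variable {K j x : ℕ} {target : Option ℕ} {b a₀ : ℕ} {m : Mem} {s : IndexedState}

/-- Fixing a new hash value on the machine corresponds to the assignment of this value by the
challenger. For a number other than `j`, the stored root is the secret key by `Blum.secretKey_eq`;
for the number `j`, the stored sign tells whether the hash value is a square. -/
theorem Tracks.hashMem (ht : Tracks p q K j x target b a₀ m s) (h : Blum p q)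
    (hx : chi (x : ZMod (p * q)) = 1) (hid : s.st.table (m (K + 1) 8) = none) {σ y : ℕ}
    (hσ : σ < 2) (hy : y.Coprime (p * q)) :
    Tracks p q K j x target b a₀ (hashMem K m σ y) (s.assign (m (K + 1) 8)
      ((-1) ^ σ * if s.cnt = j then (x : ZMod (p * q)) * (y : ZMod (p * q)) ^ 2
        else (y : ZMod (p * q)) ^ 4).val) := by
  have hyu : IsUnit (y : ZMod (p * q)) := (ZMod.isUnit_iff_coprime y (p * q)).2 hy
  have hchi : chi ((-1) ^ σ * if s.cnt = j then (x : ZMod (p * q)) * (y : ZMod (p * q)) ^ 2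
        else (y : ZMod (p * q)) ^ 4) = 1 := by
    have h1 : ∀ z : ZMod (p * q), chi ((-1) ^ σ * z) = chi z := by
      intro z
      interval_cases σ <;> simp [h.chi_neg]
    rw [h1]
    split_ifs
    · rw [h.chi_mul, h.chi_sq hyu, hx, mul_one]
    · rw [show (4 : ℕ) = 2 * 2 from rfl, pow_mul, h.chi_sq (hyu.pow 2)]
  set id := m (K + 1) 8 with hid'
  have hjac : ((-1) ^ σ * if s.cnt = j then (x : ZMod (p * q)) * (y : ZMod (p * q)) ^ 2
        else (y : ZMod (p * q)) ^ 4).val ∈ jac (p * q) 1 :=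
    Finset.mem_filter.2 ⟨Finset.mem_range.2 (ZMod.val_lt _), hchi⟩
  have hne {i a : ℕ} (hi : s.st.table i = some a) : i ≠ id := by
    rintro rfl
    simp [hid] at hi
  constructor
  · by_cases hj : s.cnt = j <;> simp [XhIBE.hashMem, Mem.put, ht.modulus, ht.count, ht.number, hj]
  · by_cases hj : s.cnt = j <;> simp [XhIBE.hashMem, Mem.put, ht.number, ht.count, hj]
  · by_cases hj : s.cnt = j <;>
      simp [XhIBE.hashMem, Mem.put, ht.element, ht.number, ht.count, hj]
  · by_cases hj : s.cnt = j <;> simp [XhIBE.hashMem, Mem.put, ht.bit, ht.number, ht.count, hj]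
  · simp [XhIBE.hashMem, Mem.put, ht.count, IndexedState.assign]
  · by_cases hj : s.cnt = j <;> simp [XhIBE.hashMem, Mem.put, ht.challenge, ht.number, ht.count, hj]
  · intro i
    by_cases hi : i = id
    · by_cases hj : s.cnt = j
      · simp [XhIBE.hashMem, Mem.put, ht.number, ht.count, hj, hi, ← hid', IndexedState.assign,
          ht.modulus, ht.element, cast_signedMod hσ, add_comm, sq]
      · have h4 : (y : ZMod (p * q)) ^ 4 = y * y * (y * y) := by ring
        simp [XhIBE.hashMem, Mem.put, ht.number, ht.count, hj, hi, ← hid', IndexedState.assign,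
          ht.modulus, cast_signedMod hσ, add_comm, h4]
    · by_cases hj : s.cnt = j <;>
        simp [XhIBE.hashMem, Mem.put, ht.number, ht.count, hj, hi, ← hid', IndexedState.assign,
          ht.table]
  · intro i
    by_cases hi : i = id
    · by_cases hj : s.cnt = j
      · simp [XhIBE.hashMem, Mem.put, ht.number, ht.count, hj, hi, ← hid', IndexedState.assign,
          ht.root, hid]
      · have hs' : (σ * if p * q % 8 = 1 then 1 else 0) =
            if σ = 1 ∧ p * q % 8 = 1 then 1 else 0 := by
          interval_cases σ <;> simp
        have hlt : (if σ = 1 ∧ p * q % 8 = 1 then 1 else 0) < 2 := by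
          split_ifs <;> omega
        simp only [XhIBE.hashMem, Mem.put, ht.number, ht.count, hj, hi, ← hid',
          IndexedState.assign, ht.modulus, if_true, if_false, Option.elim]
        rw [h.secretKey_eq hyu hσ, hs', cast_signedMod hlt]
        simp [sq]
    · by_cases hj : s.cnt = j <;>
        simp [XhIBE.hashMem, Mem.put, ht.number, ht.count, hj, hi, ← hid', IndexedState.assign,
          ht.root]
  · intro i
    by_cases hi : i = id <;> by_cases hj : s.cnt = j <;>
        simp [XhIBE.hashMem, Mem.put, ht.number, ht.count, hj, hi, ← hid', IndexedState.assign,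
          ht.idx]
  · intro i
    rw [← show i ∈ s.st.keys ↔ i ∈ (s.assign id _).st.keys from Iff.rfl, ← ht.keys]
    by_cases hj : s.cnt = j <;> simp [XhIBE.hashMem, Mem.put, ht.number, ht.count, hj]
  · intro i a hi hij
    by_cases hj : s.cnt = j
    · have hi' : i = id := by
        by_contra hne'
        simp only [IndexedState.assign, if_neg hne'] at hi hij
        have := ht.valid.idx_lt hi
        omega
      have ha : a = ((-1) ^ σ * ((x : ZMod (p * q)) * (y : ZMod (p * q)) ^ 2)).val := by
        simpa [IndexedState.assign, hi', hj] using hi.symm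
      have h4 : XhIBE.hashMem K m σ y (K + 1) 4 = σ := by
        simp [XhIBE.hashMem, Mem.put, ht.number, ht.count, hj]
      rw [h4, ha, ZMod.natCast_zmod_val, h.isSquare_planted hx hyu hσ]
    · have hi' : i ≠ id := by
        rintro rfl
        simp [IndexedState.assign, hj] at hij
      have h4 : XhIBE.hashMem K m σ y (K + 1) 4 = m (K + 1) 4 := by
        simp [XhIBE.hashMem, Mem.put, ht.number, ht.count, hj]
      simp only [IndexedState.assign, if_neg hi'] at hi hij
      rw [h4, ht.planted i a hi hij]
  · by_cases hj : s.cnt = j <;>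
      simp [XhIBE.hashMem, Mem.put, ht.number, ht.count, hj, ht.sign_lt, hσ]
  · exact ht.valid.assign hjac
  · intro i hi
    obtain ⟨h1, h2⟩ := ht.pinned i hi
    simp [IndexedState.assign, hne h1, h1, h2]

/-- The simulation of a query to the random oracle. -/
theorem Tracks.expect_indexedHash_le (ht : Tracks p q K j x target b a₀ m s) (h : Blum p q)
    (h0 : coeps p q ≠ 0) (hx : chi (x : ZMod (p * q)) = 1) {t : ℕ}
    {F₁ : Config Unit → ℝ≥0∞} {F₂ : ℕ × IndexedState → ℝ≥0∞}
    (hF : ∀ a s' m' t', Tracks p q K j x target b a₀ m' s' → s'.st.table (m (K + 1) 8) = some a →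
      Agree K m' m → m' (K + 1) 8 = m (K + 1) 8 → F₂ (a, s') ≤ coeps p q * F₁ ⟨m', (), t'⟩) :
    expect (indexedHash (p * q) (m (K + 1) 8) s) F₂ ≤
      expect (exec noOracle (hashProg K) ⟨m, (), t⟩) F₁ := by
  -- the hypothesis holds for all times, so the running time of `hashProg` need not be known
  refine le_trans ?_ (expect_hashProg_ge noOracle (G := fun m' => ⨅ t', F₁ ⟨m', (), t'⟩)
    fun m' t' => iInf_le _ t')
  have hF' : ∀ a s' m', Tracks p q K j x target b a₀ m' s' → s'.st.table (m (K + 1) 8) = some a →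
      Agree K m' m → m' (K + 1) 8 = m (K + 1) 8 →
      F₂ (a, s') ≤ coeps p q * ⨅ t', F₁ ⟨m', (), t'⟩ := by
    intro a s' m' h1 h2 h3 h4
    rw [ENNReal.mul_iInf_of_ne h0
      (ne_top_of_le_ne_top ENNReal.one_ne_top (coeps_le_one p q))]
    exact le_iInf fun t' => hF a s' m' t' h1 h2 h3 h4
  simp only [ht.modulus]
  rcases hid : s.st.table (m (K + 1) 8) with _ | a
  · rw [if_pos (by rw [ht.table, hid]; rfl), indexedHash_of_table_none hid, expect_bind]
    refine h.expect_hash_le h0 hx (s.cnt = j) fun σ hσ y hy => ?_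
    rw [expect_pure]
    refine hF' _ _ _ (ht.hashMem h hx hid hσ hy) (by simp [IndexedState.assign]) ?_ ?_
    · intro k hk i
      have h1 : k ≠ K + 1 := by omega
      have h2 : k ≠ K + 2 := by omega
      have h3 : k ≠ K + 3 := by omega
      have h4 : k ≠ K + 4 := by omega
      by_cases hj : s.cnt = j <;>
        simp [XhIBE.hashMem, Mem.put, ht.number, ht.count, hj, h1, h2, h3, h4]
    · by_cases hj : s.cnt = j <;> simp [XhIBE.hashMem, Mem.put, ht.number, ht.count, hj]
  · rw [if_neg (by rw [ht.table, hid]; simp), indexedHash_of_table hid, expect_pure]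
    refine (hF' a s m ht hid (fun _ _ _ => rfl) rfl).trans ?_
    exact mul_le_of_le_one_left' (coeps_le_one p q)

end Tracks

section Simulation

variable {p q : ℕ} {K j x : ℕ} {target : Option ℕ} {b a₀ : ℕ} {m : Mem} {s : IndexedState}

theorem Tracks.congr (ht : Tracks p q K j x target b a₀ m s) {m' : Mem}
    (hK : m' K 0 = m K 0)
    (h₁ : ∀ i < 8, m' (K + 1) i = m (K + 1) i)
    (h : ∀ k, K + 2 ≤ k → k ≤ K + 5 → ∀ i, m' k i = m k i) : Tracks p q K j x target b a₀ m' s where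
  modulus := hK.trans ht.modulus
  number := (h₁ 0 (by norm_num)).trans ht.number
  element := (h₁ 1 (by norm_num)).trans ht.element
  bit := (h₁ 3 (by norm_num)).trans ht.bit
  count := (h₁ 5 (by norm_num)).trans ht.count
  challenge := (h₁ 6 (by norm_num)).trans ht.challenge
  table id := (h (K + 2) (by omega) (by omega) id).trans (ht.table id)
  root id := (h (K + 3) (by omega) (by omega) id).trans (ht.root id)
  idx id := (h (K + 4) (by omega) (by omega) id).trans (ht.idx id)
  keys id := by rw [h (K + 5) (by omega) (by omega) id, ht.keys]
  planted id a := by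
    rw [h₁ 4 (by norm_num)]
    exact ht.planted id a
  sign_lt := (h₁ 4 (by norm_num)).trans_lt ht.sign_lt
  valid := ht.valid
  pinned := ht.pinned

theorem Tracks.put (ht : Tracks p q K j x target b a₀ m s) {k : ℕ} (hk : k < K) (i v : ℕ) :
    Tracks p q K j x target b a₀ (m.put k i v) s :=
  ht.congr (Mem.put_of_ne hk.ne') (fun _ _ => Mem.put_of_ne (by omega))
    fun _ _ _ _ => Mem.put_of_ne (by omega)

theorem Tracks.put_arg (ht : Tracks p q K j x target b a₀ m s) {i : ℕ} (hi : 8 ≤ i) (v : ℕ) :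
    Tracks p q K j x target b a₀ (m.put (K + 1) i v) s := by
  refine ht.congr (Mem.put_of_ne (by omega)) (fun i' hi' => ?_) fun _ _ _ _ =>
    Mem.put_of_ne (by omega)
  have : i' ≠ i := by omega
  simp [Mem.put, this]

theorem Tracks.extract (ht : Tracks p q K j x target b a₀ m s) {id a : ℕ}
    (ha : s.st.table id = some a) :
    Tracks p q K j x target b a₀ (m.put (K + 5) id 1) (s.extract id) where
  modulus := (Mem.put_of_ne (by omega)).trans ht.modulus
  number := (Mem.put_of_ne (by omega)).trans ht.number
  element := (Mem.put_of_ne (by omega)).trans ht.element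
  bit := (Mem.put_of_ne (by omega)).trans ht.bit
  count := (Mem.put_of_ne (by omega)).trans ht.count
  challenge := (Mem.put_of_ne (by omega)).trans ht.challenge
  table i := (Mem.put_of_ne (by omega)).trans (ht.table i)
  root i := (Mem.put_of_ne (by omega)).trans (ht.root i)
  idx i := (Mem.put_of_ne (by omega)).trans (ht.idx i)
  keys i := by
    have := ht.keys i
    by_cases hi : i = id <;> simp_all [Mem.put, IndexedState.extract]
  planted i b hi hj := by
    rw [Mem.put_of_ne (by omega)]
    exact ht.planted i b hi hj
  sign_lt := by
    rw [Mem.put_of_ne (by omega)]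
    exact ht.sign_lt
  valid := ht.valid.extract ha
  pinned := ht.pinned

/-- The relation between the machine that simulates the oracles and the machine that has them. -/
def Simulates (p q K j x : ℕ) (target : Option ℕ) (b a₀ : ℕ) (c₁ : Config Unit)
    (c₂ : Config IndexedState) : Prop :=
  Agree K c₁.mem c₂.mem ∧ Tracks p q K j x target b a₀ c₁.mem c₂.orc

/-- The weight `coeps p q ^ time` decreases along a run, since each step takes time. -/
theorem simulation_simulates : Simulation K (Simulates p q K j x target b a₀)
    fun _ c₂ => coeps p q ^ c₂.time where
  agree h := h.1
  tick h d := ⟨h, pow_le_pow_right_of_le_one' (coeps_le_one p q) (Nat.le_add_right _ d)⟩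
  put h k i v d hk _ := ⟨⟨h.1.put k i v, h.2.put hk i v⟩,
    pow_le_pow_right_of_le_one' (coeps_le_one p q) (Nat.le_add_right _ d)⟩

variable [hp : Fact p.Prime] [hq : Fact q.Prime]

/-- Each oracle call loses at most one factor `coeps p q`, which the weight pays for because the
call takes at least one unit of time. -/
theorem Blum.simulateCall_stepLE (h : Blum p q) (h0 : coeps p q ≠ 0)
    (hx : chi (x : ZMod (p * q)) = 1) (o : Query) (k : ℕ) (i e : Expr) (hk : k < K)
    (hi : i.Below K) (he : e.Below K) {c₁ : Config Unit} {c₂ : Config IndexedState}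
    (hc : Simulates p q K j x target b a₀ c₁ c₂) :
    StepLE (Simulates p q K j x target b a₀) (fun _ c₂ => coeps p q ^ c₂.time) c₁ c₂
      (exec noOracle (simulateCall K o k i e) c₁)
      (exec (indexedOracle p q target (some j)) (.call o k i e) c₂) := by
  obtain ⟨hA, hT⟩ := hc
  intro F₁ F₂ hF
  have hput (v : ℕ) : Agree K (c₁.mem.put (K + 1) 8 v) c₂.mem := fun k' hk' i' =>
    (Mem.put_of_ne (by omega)).trans (hA k' hk' i')
  have harg (v : ℕ) : (c₁.mem.put (K + 1) 8 v) (K + 1) 8 = v := by simp [Mem.put]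
  have hpow (t d : ℕ) (hd : 0 < d) (X : ℝ≥0∞) :
      coeps p q ^ (t + d) * X ≤ coeps p q * (coeps p q ^ t * X) := by
    rw [← mul_assoc, ← pow_succ']
    exact mul_le_mul_left (pow_le_pow_right_of_le_one' (coeps_le_one p q)
      (show t + 1 ≤ t + d by omega)) X
  have hF' (m₁ t₁ m₂ s t) (hA : Agree K m₁ m₂) (hT : Tracks p q K j x target b a₀ m₁ s) :
      F₂ ⟨m₂, s, t⟩ ≤ coeps p q ^ t * F₁ ⟨m₁, (), t₁⟩ := hF ⟨m₁, (), t₁⟩ ⟨m₂, s, t⟩ ⟨hA, hT⟩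
  rw [expect_call, ← hA.eval_eq he, ← expect_const_mul]
  cases o with
  | hash =>
    simp only [simulateCall, indexedOracle]
    rw [expect_seq, expect_set, expect_seq]
    simp only [Expr.eval]
    have := (hT.put_arg le_rfl (e.eval c₁.mem)).expect_indexedHash_le h h0 hx
      (t := c₁.time + (1 + Expr.cost c₁.mem (.const 8) + Expr.cost c₁.mem e))
      (F₂ := fun r => F₂ ⟨c₂.mem.put k (i.eval c₂.mem) r.1, r.2,
        c₂.time + (1 + i.cost c₂.mem + e.cost c₂.mem + r.1.size)⟩)
      (F₁ := fun c => expect (exec noOracle (.set k i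
        (.bin .sub (.load (K + 2) (argExpr K)) (.const 1))) c)
        fun c => coeps p q ^ c₂.time * F₁ c) ?_
    · rw [harg] at this
      exact this
    · intro a s' m' t' hT' ha hA' harg'
      have hA₂ : Agree K m' c₂.mem := fun k' hk' i' => (hA' k' hk' i').trans (hput _ k' hk' i')
      rw [harg] at ha harg'
      have hans : m' (K + 2) (e.eval c₁.mem) = a + 1 := by rw [hT'.table, ha]; rfl
      rw [expect_set]
      simp only [Expr.eval, Op.eval, harg', hans, Nat.add_sub_cancel, hA₂.eval_eq hi]
      exact (hF' _ _ _ _ _ (hA₂.put k _ a) (hT'.put hk _ a)).trans (hpow _ _ (by omega) _)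
  | key =>
    simp only [simulateCall, indexedOracle]
    rw [expect_seq, expect_set, expect_exec_ite]
    have h6 : (c₁.mem.put (K + 1) 8 (e.eval c₁.mem)) (K + 1) 6 = target.elim 0 (· + 1) := by
      rw [← hT.challenge]
      simp [Mem.put]
    simp only [Expr.eval, Op.eval, harg, h6]
    by_cases ht : target = some (e.eval c₁.mem)
    · have h7 : (target.elim 0 (· + 1)) = e.eval c₁.mem + 1 := by rw [ht]; rfl
      simp only [if_pos ht, if_pos h7, ne_eq, one_ne_zero, not_false_eq_true, if_true, expect_pure,
        expect_set, Expr.eval, (hput _).eval_eq hi]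
      exact (hF' _ _ _ _ _ ((hput _).put k _ 0)
        ((hT.put_arg le_rfl (e.eval c₁.mem)).put hk _ 0)).trans
        (mul_le_mul_left (pow_le_pow_right_of_le_one' (coeps_le_one p q) (Nat.le_add_right _ _)) _)
    · have h7 : (target.elim 0 (· + 1)) ≠ e.eval c₁.mem + 1 := by
        cases target with
        | none => simp
        | some v => simpa using ht
      simp only [if_neg ht, if_neg h7, ne_eq, not_true_eq_false, if_false]
      rw [expect_bind, expect_seq]
      simp only [expect_pure]
      have := (hT.put_arg le_rfl (e.eval c₁.mem)).expect_indexedHash_le h h0 hx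
        (t := c₁.time + (1 + Expr.cost c₁.mem (.const 8) + Expr.cost c₁.mem e) +
          (1 + Expr.cost (c₁.mem.put (K + 1) 8 (e.eval c₁.mem))
            (.bin .eq (reg (K + 1) 6) (.bin .add (argExpr K) (.const 1)))))
        (F₂ := fun r => F₂ ⟨c₂.mem.put k (i.eval c₂.mem)
          (if some j = some (r.2.idx (e.eval c₁.mem)) then 0 else secretKey p q r.1),
          r.2.extract (e.eval c₁.mem),
          c₂.time + (1 + i.cost c₂.mem + e.cost c₂.mem +
            (if some j = some (r.2.idx (e.eval c₁.mem)) then 0 else secretKey p q r.1).size)⟩)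
        (F₁ := fun c => expect (exec noOracle
          (.seq (.set (K + 5) (argExpr K) (.const 1)) (.set k i (.load (K + 3) (argExpr K)))) c)
          fun c => coeps p q ^ c₂.time * F₁ c)
        ?_
      · rw [harg] at this
        exact this
      · intro a s' m' t' hT' ha hA' harg'
        have hA₂ : Agree K (m'.put (K + 5) (e.eval c₁.mem) 1) c₂.mem := fun k' hk' i' =>
          (Mem.put_of_ne (by omega)).trans ((hA' k' hk' i').trans (hput _ k' hk' i'))
        rw [harg] at ha harg'
        have hans : m' (K + 3) (e.eval c₁.mem) =
            if some j = some (s'.idx (e.eval c₁.mem)) then 0 else secretKey p q a := by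
          rw [hT'.root, ha]
          simp [eq_comm]
        have h8 : (m'.put (K + 5) (e.eval c₁.mem) 1) (K + 1) 8 = e.eval c₁.mem := by
          rw [Mem.put_of_ne (by omega), harg']
        have h9 : (m'.put (K + 5) (e.eval c₁.mem) 1) (K + 3) (e.eval c₁.mem) =
            m' (K + 3) (e.eval c₁.mem) := Mem.put_of_ne (by omega)
        rw [expect_seq, expect_set, expect_set]
        simp only [Expr.eval, harg', h8, h9, hans, hA₂.eval_eq hi]
        exact (hF' _ _ _ _ _ (hA₂.put k _ _) ((hT'.extract ha).put hk _ _)).trans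
          (hpow _ _ (by omega) _)

/-- The simulation of a whole program. -/
theorem Blum.simulate_stepLE (h : Blum p q) (h0 : coeps p q ≠ 0)
    (hx : chi (x : ZMod (p * q)) = 1) {P : Prog} (hP : P.Below K) {c₁ : Config Unit}
    {c₂ : Config IndexedState} (hc : Simulates p q K j x target b a₀ c₁ c₂) :
    StepLE (Simulates p q K j x target b a₀) (fun _ c₂ => coeps p q ^ c₂.time) c₁ c₂
      (exec noOracle (P.subst (simulateCall K)) c₁)
      (exec (indexedOracle p q target (some j)) P c₂) := by
  have := simulation_simulates.stepLE (O₁ := noOracle) (f₂ := .call)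
    (fun o k i e hk hi he _ _ hc => h.simulateCall_stepLE h0 hx o k i e hk hi he hc) P hP c₁ c₂ hc
  rwa [Prog.subst_call] at this

end Simulation

/-! ### The algorithm for quadratic residuosity -/

/-- Save the input in registers, choose the number of the identity for which the input is planted
below the value of `e`, and prepare the input of the adversary. -/
def initProg (K : ℕ) (e : Expr) : Prog :=
  .seq (saveModulus K) <|
  .seq (.rand (K + 1) (.const 0) e) <|
  .seq (.set (K + 1) (.const 1) (.load 0 (.const 2))) (.set 0 (.const 2) (.const 0))

/-- Answer at random. -/
def tossCoin : Prog := .rand 0 (.const 0) (.const 2)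

/-- The power of `u` (which is in cell `2` of array `K + 1`) that encodes a message. -/
def encodeExpr (K : ℕ) (e : Expr) : Expr :=
  let z : Expr := .bin .eq e (.const 0)
  .bin .add z (.bin .mul (.bin .sub (.const 1) z) (reg (K + 1) 2))

/-- Choose `u` and the challenge bit `b` and produce the challenge. Its first polynomial encrypts
`m_b` and its second one the other message. -/
def embedProg (K : ℕ) : Prog :=
  .seq (.set (K + 1) (.const 6) (.bin .add (argExpr K) (.const 1))) <|
  .seq (.rand (K + 1) (.const 2) (modulus K)) <|
  .seq (.rand (K + 1) (.const 3) (.const 2)) <|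
  .seq (.set K (.const 2) (.bin .sub (.load (K + 2) (argExpr K)) (.const 1))) <|
  .seq (.set K (.const 3) (encodeExpr K (.load 0 (.bin .add (.const 1) (reg (K + 1) 3))))) <|
  .seq (.set K (.const 4) (encodeExpr K (.load 0 (.bin .sub (.const 2) (reg (K + 1) 3)))))
    (cipherProg K 0)

/-- Turn the guess of the adversary into an answer: it is a square if the guess equals the bit,
or the opposite if the sign at the planted place is negative. -/
def verdictProg (K : ℕ) : Prog :=
  .set 0 (.const 0) (.bin .eq
    (.bin .eq (.bin .lt (.const 0) (.load 0 (.const 0))) (reg (K + 1) 3))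
    (.bin .sub (.const 1) (reg (K + 1) 4)))

/-- The challenge, the second phase and the answer. -/
def challengeProg (K : ℕ) (P : Prog) : Prog :=
  .seq (.set (K + 1) (.const 8) (.load 0 (.const 0))) <|
  .ite (.load (K + 5) (argExpr K)) tossCoin <|
  .seq (hashProg K) <|
  .ite (.bin .eq (.load (K + 4) (argExpr K)) (reg (K + 1) 0))
    (.seq (embedProg K) (.seq P (verdictProg K))) tossCoin

/-- The algorithm for quadratic residuosity that is made from an adversary against `xhIBE`. -/
def distinguisher (K : ℕ) (e : Expr) (A : Adversary) : Prog :=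
  .seq (initProg K e) <| .seq (A.phase1.subst (simulateCall K)) <|
    challengeProg K (A.phase2.subst (simulateCall K))

open Classical in
/-- The indicator of the event that the correctness of the answer on `x` is `v`. -/
def verdict {N : ℕ} (x : ZMod N) (v : Bool) (c : Config Unit) : ℝ≥0∞ :=
  if (c.mem 0 0 ≠ 0 ↔ IsSquare x) ↔ v = true then 1 else 0

theorem expect_comm {α β : Type} (μ : PMF α) (ν : PMF β) (f : α → β → ℝ≥0∞) :
    (expect μ fun a => expect ν (f a)) = expect ν fun b => expect μ fun a => f a b := by
  simp only [expect, ← ENNReal.tsum_mul_left]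
  rw [ENNReal.tsum_comm]
  exact tsum_congr fun b => tsum_congr fun a => by ring

theorem expect_tossCoin {N : ℕ} (x : ZMod N) (v : Bool) (c : Config Unit) :
    expect (exec noOracle tossCoin c) (verdict x v) = 2⁻¹ := by
  rw [tossCoin, expect_rand]
  simp only [Expr.eval]
  rw [expect_below (by norm_num)]
  by_cases hx : IsSquare x <;> cases v <;>
    simp [Finset.sum_range_succ, verdict, Mem.put, hx]

/-- A coin toss of the game as a coin toss of the machine, possibly reversed. -/
theorem expect_coin_eq_below (f : Bool → ℝ≥0∞) (p : Prop) [Decidable p] :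
    expect (PMF.uniformOfFintype Bool) f =
      expect (below 2) fun β => f (if p then decide (β = 1) else decide (β ≠ 1)) := by
  rw [expect_coin, expect_below (by norm_num), Finset.sum_range_succ, Finset.sum_range_one]
  by_cases hp : p <;> simp [hp, add_comm]

/-- If the hash value is not a square, then the bit of the game is the opposite of the bit of the
machine, since the second polynomial is the one that carries information. -/
theorem verdict_iff {β σ g : ℕ} (hβ : β < 2) (hσ : σ < 2) {sa sx : Prop} [Decidable sa]
    (h : sa ↔ (sx ↔ σ = 0)) :
    ((if (if (if 0 < g then 1 else 0) = β then 1 else 0) = 1 - σ then 1 else 0) ≠ 0 ↔ sx) ↔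
      (if sa then decide (β = 1) else decide (β ≠ 1)) = decide (g ≠ 0) := by
  rcases Nat.eq_zero_or_pos g with rfl | hg
  · by_cases hx : sx <;> interval_cases β <;> interval_cases σ <;> simp_all
  · have := hg.ne'
    by_cases hx : sx <;> interval_cases β <;> interval_cases σ <;> simp_all

section Distinguisher

variable {p q : ℕ} {K j x : ℕ} {m : Mem} {s : IndexedState}

/-- Choosing the challenge identity `id`, which has number `j`. -/
theorem Tracks.pin {b₀ a₀ : ℕ} (ht : Tracks p q K j x none b₀ a₀ m s) {m' : Mem} {id a b : ℕ}
    (hK : m' K 0 = m K 0) (h₁ : ∀ i, i ≠ 2 → i ≠ 3 → i ≠ 6 → m' (K + 1) i = m (K + 1) i)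
    (h3 : m' (K + 1) 3 = b) (h6 : m' (K + 1) 6 = id + 1)
    (h : ∀ k, K + 2 ≤ k → ∀ i, m' k i = m k i)
    (ha : s.st.table id = some a) (hj : s.idx id = j) : Tracks p q K j x (some id) b a m' s where
  modulus := hK.trans ht.modulus
  number := (h₁ 0 (by norm_num) (by norm_num) (by norm_num)).trans ht.number
  element := (h₁ 1 (by norm_num) (by norm_num) (by norm_num)).trans ht.element
  bit := h3
  count := (h₁ 5 (by norm_num) (by norm_num) (by norm_num)).trans ht.count
  challenge := h6
  table id := (h (K + 2) (by omega) id).trans (ht.table id)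
  root id := (h (K + 3) (by omega) id).trans (ht.root id)
  idx id := (h (K + 4) (by omega) id).trans (ht.idx id)
  keys id := by rw [h (K + 5) (by omega) id, ht.keys]
  planted id a := by
    rw [h₁ 4 (by norm_num) (by norm_num) (by norm_num)]
    exact ht.planted id a
  sign_lt := (h₁ 4 (by norm_num) (by norm_num) (by norm_num)).trans_lt ht.sign_lt
  valid := ht.valid
  pinned i hi := by
    rw [← Option.some.inj hi]
    exact ⟨ha, hj⟩

theorem cast_encode {N u w : ℕ} : (((if w = 0 then 1 else 0) + (1 - if w = 0 then 1 else 0) * u :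
    ℕ) : ZMod N) = if decide (w ≠ 0) then (u : ZMod N) else 1 := by
  by_cases hw : w = 0 <;> simp [hw]

/-- The machine chooses `u` and the bit `β`, and samples the mixed encryption. -/
theorem expect_embedProg [NeZero (p * q)] (hK : 0 < K) {b₀ a₀ id : ℕ}
    (ht : Tracks p q K j x none b₀ a₀ m s) (harg : m (K + 1) 8 = id) {a : ℕ}
    (ha : s.st.table id = some a) (hj : s.idx id = j) {m₂ : Mem} (hm : Agree K m m₂) {t : ℕ}
    {F₁ : Config Unit → ℝ≥0∞} {F₂ : ℕ → ℕ → List ℕ → ℝ≥0∞}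
    (hF : ∀ u β l m' t', l.length = 5 → (∀ w ∈ l, w < p * q) → Agree K m' (m₂.write l) →
      Tracks p q K j x (some id) β a m' s → F₂ u β l ≤ F₁ ⟨m', (), t'⟩) :
    (expect (below (p * q)) fun u => expect (below 2) fun β =>
      expect (mixedEncrypt (u : ZMod (p * q)) a (decide (m₂ 0 (1 + β) ≠ 0))
        (decide (m₂ 0 (2 - β) ≠ 0))) (F₂ u β)) ≤
      expect (exec noOracle (embedProg K) ⟨m, (), t⟩) F₁ := by
  have hK0 : (0 : ℕ) ≠ K := hK.ne
  have haN : a < p * q := (mem_jac (ht.valid.mem_jac ha)).1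
  rw [embedProg]
  simp only [expect_seq, expect_set, expect_rand, Expr.eval, Op.eval, encodeExpr]
  have e1 : ((m.put (K + 1) 6 (m (K + 1) 8 + 1)) K 0) = p * q :=
    (Mem.put_of_ne (by omega)).trans ht.modulus
  rw [e1]
  refine expect_mono fun u => expect_mono fun β => ?_
  have e2 (i : ℕ) : m 0 i = m₂ 0 i := hm 0 hK i
  rw [mixedEncrypt, ← cast_encode, ← cast_encode]
  have h0 : (0 : ZMod (p * q)) = ((0 : ℕ) : ZMod (p * q)) := by simp
  have hC (z : ZMod (p * q)) : (.C z : Quad (a : ZMod (p * q))) =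
      ⟨z, ((0 : ℕ) : ZMod (p * q))⟩ := by
    rw [← h0]
    rfl
  rw [hC, show (.C _ : Quad (-(a : ZMod (p * q)))) = ⟨_, ((0 : ℕ) : ZMod (p * q))⟩ by
    rw [← h0]; rfl]
  refine expect_cipherProg noOracle hK ?_ ?_ ?_ ?_ fun z z' c' h1 h2 h3 => ?_
  · simp [Mem.put, ht.modulus]
  · simp [Mem.put, harg, ht.table, ha]
  · simp [Mem.put, hK0, e2]
  · simp [Mem.put, hK0, e2]
  · refine hF u β _ c'.mem c'.time rfl ?_ ?_ ?_
    · simp [words, ZMod.val_lt, haN]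
    · intro k hk i
      rcases eq_or_ne k 0 with rfl | hk0
      · rw [h3]
        simp [Mem.write, Mem.put, hK0, e2]
      · rw [h2 k i hk0 fun h => absurd h hk.ne]
        simp [Mem.write, Mem.put, hk.ne, hk0, show k ≠ K + 1 by omega, hm k hk i]
    · have h4 (k i : ℕ) (hk : K < k) : c'.mem k i =
          (((m.put (K + 1) 6 (id + 1)).put (K + 1) 2 u).put (K + 1) 3 β) k i := by
        rw [h2 k i (by omega) fun h => absurd h hk.ne']
        simp [Mem.put, hk.ne', harg]
      refine ht.pin ?_ ?_ ?_ ?_ ?_ ha hj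
      · rw [h2 K 0 hK.ne' fun _ => by norm_num]
        simp [Mem.put]
      · intro i hi2 hi3 hi6
        rw [h4 _ _ (by omega)]
        simp [Mem.put, hi2, hi3, hi6]
      · rw [h4 _ _ (by omega)]
        simp [Mem.put]
      · rw [h4 _ _ (by omega)]
        simp [Mem.put]
      · intro k hk i
        rw [h4 _ _ (by omega)]
        simp [Mem.put, show k ≠ K + 1 by omega]

end Distinguisher

section Challenge

variable {p q : ℕ} [hp : Fact p.Prime] [hq : Fact q.Prime] {K j x : ℕ}

/-- The encryption `enc` can be replaced by the mixed encryption with the element `u`. -/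
def Embeddable (p q u : ℕ) (enc : ℕ → Bool → PMF (List ℕ)) : Prop :=
  ∀ a ∈ jac (p * q) 1, ∀ b b' c : Bool,
    (IsSquare (a : ZMod (p * q)) ∧ c = b ∨ ¬ IsSquare (a : ZMod (p * q)) ∧ c = b') →
    ∀ F, coeps p q * coeps p q * expect (enc a c) F ≤
      expect (mixedEncrypt (u : ZMod (p * q)) a b b') F

/-- The second phase and the verdict, compared with the second phase of the game. -/
theorem Blum.expect_phase2_le (h : Blum p q) (h0 : coeps p q ≠ 0)
    (hx : chi (x : ZMod (p * q)) = 1) (hK : 0 < K) {A : Adversary} (hA : A.phase2.Below K)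
    {n : ℕ} {P : Polynomial ℕ} (hP : A.TimeBound 5 P) (hN : p * q < 2 ^ (2 * n)) {id a β : ℕ}
    (hβ : β < 2) {c₂ : Config IndexedState} {s : IndexedState}
    (hc₂ : ⟨c₂.mem, (), c₂.time⟩ ∈ (exec (anyOracle (2 ^ (2 * n))) A.phase1
      (start [p * q, n] ())).support) {l : List ℕ} (hl : l.length = 5) (hl' : ∀ w ∈ l, w < p * q)
    {m : Mem} (hm : Agree K m (c₂.mem.write l)) (ht : Tracks p q K j x (some id) β a m s) (v : Bool)
    (t : ℕ) {b : Bool} (hb : (b = decide (β = 1) ∧ IsSquare (a : ZMod (p * q))) ∨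
      (b = decide (β ≠ 1) ∧ ¬ IsSquare (a : ZMod (p * q)))) :
    coeps p q ^ P.eval n * expect (exec (indexedOracle p q (some id) (some j)) A.phase2
      ⟨c₂.mem.write l, s, c₂.time⟩)
        (fun c => if decide (b = decide (c.mem 0 0 ≠ 0)) = v then 1 else 0) ≤
      coeps p q ^ c₂.time * expect (exec noOracle
        (.seq (A.phase2.subst (simulateCall K)) (verdictProg K)) ⟨m, (), t⟩)
          (verdict (x : ZMod (p * q)) v) := by
  classical
  have hJ : (jac (p * q) 1).Nonempty := h.jac_nonempty (Or.inl rfl)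
  rw [← expect_const_mul, expect_seq]
  refine (h.simulate_stepLE h0 hx hA (c₁ := ⟨m, (), t⟩) ⟨hm, ht⟩).expect_le
    fun c₁' c₂' hc hsupp => ?_
  obtain ⟨hm', ht'⟩ := hc
  have h1 := (exists_support_anyOracle (B := 2 ^ (2 * n)) (inv := fun _ s => s.Valid (p * q))
    (fun _ h => h) (fun o v t s hs r hr => ⟨(support_indexedOracle hJ hs hr).1.trans hN,
      (support_indexedOracle hJ hs hr).2.1⟩) A.phase2 ht.valid hsupp).2
  have h2 := hP n _ hN _ hc₂ l hl (fun w hw => (hl' w hw).trans hN) _ h1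
  refine mul_le_mul' (pow_le_pow_right_of_le_one' (coeps_le_one p q) h2) ?_
  rw [verdictProg, expect_set]
  have h3 : (IsSquare (a : ZMod (p * q)) ↔ (IsSquare (x : ZMod (p * q)) ↔ c₁'.mem (K + 1) 4 = 0)) :=
    ht'.planted id a (ht'.pinned id rfl).1 (ht'.pinned id rfl).2
  have h4 : (if IsSquare (a : ZMod (p * q)) then decide (β = 1) else decide (β ≠ 1)) = b := by
    rcases hb with ⟨h4, h5⟩ | ⟨h4, h5⟩
    · rw [if_pos h5, h4]
    · rw [if_neg h5, h4]
  have h5 := verdict_iff (g := c₁'.mem 0 0) hβ ht'.sign_lt h3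
  rw [h4] at h5
  have h6 (m : Mem) (w : ℕ) : m.put 0 0 w 0 0 = w := by simp [Mem.put]
  simp only [verdict, Expr.eval, Op.eval, ht'.bit, h6, ← hm' 0 hK 0]
  refine (if_congr (Iff.trans ?_ (iff_congr h5 Iff.rfl).symm) rfl rfl).le
  cases v <;> simp

/-- The challenge, the second phase and the verdict, compared with the rest of the traced game. -/
theorem Blum.expect_tracedTail_le (h : Blum p q) (h0 : coeps p q ≠ 0)
    (hx : chi (x : ZMod (p * q)) = 1) (hK : 0 < K) {A : Adversary} (hA : A.phase2.Below K)
    {n : ℕ} {P : Polynomial ℕ} (hP : A.TimeBound 5 P) (hN : p * q < 2 ^ (2 * n))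
    {c₁ : Config Unit} {c₂ : Config IndexedState} (hc : Simulates p q K j x none 0 0 c₁ c₂)
    (hc₂ : ⟨c₂.mem, (), c₂.time⟩ ∈ (exec (anyOracle (2 ^ (2 * n))) A.phase1
      (start [p * q, n] ())).support) (v : Bool) {good : ℕ → Prop} [DecidablePred good]
    {enc : ℕ → ℕ → Bool → PMF (List ℕ)} (henc : ∀ u, good u → Embeddable p q u (enc u)) :
    (expect (below (p * q)) fun u => if good u then coeps p q ^ (P.eval n + 3) *
      expect (tracedTail (enc u) A p q (some j) c₂) (score j v) else 0) ≤
      coeps p q ^ c₂.time *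
        expect (exec noOracle (challengeProg K (A.phase2.subst (simulateCall K))) c₁)
          (verdict (x : ZMod (p * q)) v) := by
  classical
  obtain ⟨hA₁, hT⟩ := hc
  have htime : c₂.time ≤ P.eval n := (hP.phase1 hN hc₂).1
  have hpow {t : ℕ} (ht : t ≤ P.eval n + 3) : coeps p q ^ (P.eval n + 3) ≤ coeps p q ^ t :=
    pow_le_pow_right_of_le_one' (coeps_le_one p q) ht
  have hhalf {X : ℝ≥0∞} (hX : coeps p q ^ (P.eval n + 3) * 2⁻¹ ≤ X) {Y : ℕ → ℝ≥0∞}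
      (hY : ∀ u, Y u = 2⁻¹) :
      (expect (below (p * q)) fun u => if good u then coeps p q ^ (P.eval n + 3) * Y u else 0) ≤
        X := by
    refine le_trans ((expect_mono fun u => ?_).trans (expect_const _ _).le) hX
    rw [hY]
    split_ifs
    · exact le_rfl
    · exact bot_le
  set id := c₂.mem 0 0 with hid
  have hput : Agree K (c₁.mem.put (K + 1) 8 id) c₂.mem := fun k' hk' i' =>
    (Mem.put_of_ne (by omega)).trans (hA₁ k' hk' i')
  have harg : (c₁.mem.put (K + 1) 8 id) (K + 1) 8 = id := by simp [Mem.put]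
  have hkey : (c₁.mem.put (K + 1) 8 id) (K + 5) id = c₁.mem (K + 5) id :=
    Mem.put_of_ne (by omega)
  rw [challengeProg, expect_seq, expect_set, expect_exec_ite]
  simp only [Expr.eval, hA₁ 0 hK 0, ← hid, harg, hkey, hT.keys]
  by_cases hkeys : id ∈ c₂.orc.st.keys
  · rw [if_pos hkeys, expect_tossCoin]
    refine hhalf (mul_le_mul_left (hpow (t := c₂.time) (by omega)) _) fun u => ?_
    simp only [tracedTail, ← hid, if_pos hkeys, expect_bind, expect_pure]
    exact (expect_const _ _).trans (by simp [score])
  rw [if_neg hkeys, expect_seq, ← expect_const_mul]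
  -- the random choices of the game in the order of those of the machine
  have horder : (expect (below (p * q)) fun u => if good u then coeps p q ^ (P.eval n + 3) *
      expect (tracedTail (enc u) A p q (some j) c₂) (score j v) else 0) =
      expect (indexedHash (p * q) id c₂.orc) fun r => expect (below (p * q)) fun u =>
        if good u then coeps p q ^ (P.eval n + 3) * expect (PMF.uniformOfFintype Bool) (fun b =>
          expect (enc u r.1 (if b then decide (c₂.mem 0 2 ≠ 0) else decide (c₂.mem 0 1 ≠ 0)))
            fun ct => expect (exec (indexedOracle p q (some id) (some j)) A.phase2
              ⟨c₂.mem.write ct, r.2, c₂.time⟩) fun c =>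
                score j v (some (r.2.idx id, decide (b = decide (c.mem 0 0 ≠ 0))))) else 0 := by
    rw [expect_comm (indexedHash (p * q) id c₂.orc)]
    refine expect_congr fun u => ?_
    by_cases hu : good u
    · simp only [if_pos hu, expect_const_mul]
      rw [expect_comm (indexedHash (p * q) id c₂.orc)]
      simp only [tracedTail, ← hid, if_neg hkeys, expect_bind, expect_map]
    · simp only [if_neg hu]
      exact (expect_const _ _).symm
  rw [horder]
  have key := (hT.put_arg le_rfl id).expect_indexedHash_le h h0 hx
    (t := c₁.time + (1 + Expr.cost c₁.mem (.const 8) + Expr.cost c₁.mem (.load 0 (.const 0))) +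
      (1 + Expr.cost (c₁.mem.put (K + 1) 8 id) (.load (K + 5) (argExpr K))))
    (F₁ := fun c => coeps p q ^ c₂.time * expect (exec noOracle
      (.ite (.bin .eq (.load (K + 4) (argExpr K)) (reg (K + 1) 0))
        (.seq (embedProg K) (.seq (A.phase2.subst (simulateCall K)) (verdictProg K))) tossCoin) c)
      (verdict (x : ZMod (p * q)) v))
    (F₂ := fun r => expect (below (p * q)) fun u =>
        if good u then coeps p q ^ (P.eval n + 3) * expect (PMF.uniformOfFintype Bool) (fun b =>
          expect (enc u r.1 (if b then decide (c₂.mem 0 2 ≠ 0) else decide (c₂.mem 0 1 ≠ 0)))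
            fun ct => expect (exec (indexedOracle p q (some id) (some j)) A.phase2
              ⟨c₂.mem.write ct, r.2, c₂.time⟩) fun c =>
                score j v (some (r.2.idx id, decide (b = decide (c.mem 0 0 ≠ 0))))) else 0) ?_
  · rw [harg] at key
    exact key
  intro a s m t ht hta hm harg'
  rw [harg] at hta harg'
  have hm₂ : Agree K m c₂.mem := fun k hk i => (hm k hk i).trans (hput k hk i)
  rw [expect_exec_ite]
  simp only [Expr.eval, Op.eval, harg', ht.idx, ht.number]
  by_cases hj : s.idx id = j
  swap
  · rw [if_neg hj, if_neg (by simp), expect_tossCoin, ← mul_assoc, ← pow_succ']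
    refine hhalf (mul_le_mul_left (hpow (t := c₂.time + 1) (by omega)) _) fun u => ?_
    have hscore (w : Bool) : score j v (some (s.idx id, w)) = 2⁻¹ := by simp [score, hj]
    simp only [hscore, expect_const]
  rw [if_pos hj, if_pos one_ne_zero, expect_seq, ← expect_const_mul]
  have ha : a ∈ jac (p * q) 1 := ht.valid.mem_jac hta
  have hscore (w : Bool) : score j v (some (s.idx id, w)) = if w = v then 1 else 0 := by
    cases v <;> cases w <;> simp [score, hj]
  simp only [hscore]
  have hembed := expect_embedProg hK ht harg' hta hj hm₂
    (t := t + (1 + Expr.cost m (.bin .eq (.load (K + 4) (argExpr K)) (reg (K + 1) 0))))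
    (F₁ := fun c => coeps p q ^ c₂.time * expect (exec noOracle
      (.seq (A.phase2.subst (simulateCall K)) (verdictProg K)) c) (verdict (x : ZMod (p * q)) v))
    (F₂ := fun u β ct => if β < 2 then coeps p q ^ P.eval n *
      expect (exec (indexedOracle p q (some id) (some j)) A.phase2 ⟨c₂.mem.write ct, s, c₂.time⟩)
        (fun c => if decide ((if IsSquare (a : ZMod (p * q)) then decide (β = 1)
          else decide (β ≠ 1)) = decide (c.mem 0 0 ≠ 0)) = v then 1 else 0) else 0) ?_
  · refine le_trans ?_ (mul_le_mul_right hembed (coeps p q))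
    rw [← expect_const_mul]
    refine expect_mono fun u => ?_
    by_cases hu : good u
    swap
    · simp only [if_neg hu]
      exact bot_le
    simp only [if_pos hu]
    rw [expect_coin_eq_below _ (IsSquare (a : ZMod (p * q))), ← expect_const_mul,
      ← expect_const_mul]
    refine expect_mono_support fun β hβ => ?_
    have hβ2 : β < 2 := (below_support hβ).resolve_right (by simp)
    simp only [if_pos hβ2]
    set b := if IsSquare (a : ZMod (p * q)) then decide (β = 1) else decide (β ≠ 1) with hb
    refine le_trans (le_of_eq ?_) (mul_le_mul_right (henc u hu a ha _ _
      (if b then decide (c₂.mem 0 2 ≠ 0) else decide (c₂.mem 0 1 ≠ 0)) ?_ _) (coeps p q))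
    · rw [expect_const_mul]
      ring
    · interval_cases β <;> by_cases hs : IsSquare (a : ZMod (p * q)) <;> simp [hb, hs]
  · intro u β l m' t' hl hl' hm' ht'
    by_cases hβ : β < 2
    swap
    · simp only [if_neg hβ]
      exact bot_le
    simp only [if_pos hβ]
    refine h.expect_phase2_le h0 hx hK hA hP hN hβ hc₂ hl hl' hm' ht' v t' ?_
    by_cases hs : IsSquare (a : ZMod (p * q)) <;> simp [hs]

end Challenge

section Distinguisher

/-- After the initialization, a random number `j < T` and the input `x` are stored, and the
adversary finds its own input `[N, n]`. -/
theorem expect_initProg_ge {K N n x T : ℕ} (hK : 0 < K) {e : Expr} (he : e.Below K)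
    (heT : e.eval (start [N, n, x] ()).mem = T) {F : Config Unit → ℝ≥0∞} {G : ℕ → ℝ≥0∞}
    (hF : ∀ j m t, Agree K m (start [N, n] ()).mem → m K 0 = N + (if N = 0 then 1 else 0) →
      m (K + 1) 0 = j → m (K + 1) 1 = x → (∀ i, 2 ≤ i → m (K + 1) i = 0) →
      (∀ k, K + 2 ≤ k → ∀ i, m k i = 0) → G j ≤ F ⟨m, (), t⟩) :
    expect (below T) G ≤ expect (exec noOracle (initProg K e) (start [N, n, x] ())) F := by
  have hK0 : (0 : ℕ) ≠ K := hK.ne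
  have h0 : (start [N, n, x] ()).mem 0 0 = N := by simp [start, Mem.write]
  rw [initProg, saveModulus]
  simp only [expect_seq, expect_set, expect_rand, Expr.eval, h0, Op.eval]
  have h1 : Agree K ((start [N, n, x] ()).mem.put K 0 (N + if N = 0 then 1 else 0))
      (start [N, n, x] ()).mem :=
    fun k hk i => Mem.put_of_ne hk.ne
  rw [h1.eval_eq he, heT]
  refine expect_mono fun j => hF j _ _ ?_ ?_ ?_ ?_ ?_ ?_
  · intro k hk i
    by_cases h : k = 0 ∧ i = 2
    · simp [h, Mem.put, start, Mem.write]
    · rw [Mem.put, if_neg h, Mem.put_of_ne (by omega), Mem.put_of_ne (by omega),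
        Mem.put_of_ne (by omega)]
      by_cases hk0 : k = 0
      · rcases i with _ | _ | _ | i
        · simp [start, Mem.write, hk0]
        · simp [start, Mem.write, hk0]
        · simp [hk0] at h
        · simp [start, Mem.write]
      · simp [start, Mem.write, hk0]
  · simp [Mem.put, hK.ne']
  · simp [Mem.put]
  · simp [Mem.put, start, Mem.write, hK0]
  · intro i hi
    simp [Mem.put, start, Mem.write, show i ≠ 0 by omega, show i ≠ 1 by omega]
  · intro k hk i
    simp [Mem.put, start, Mem.write, show k ≠ 0 by omega, show k ≠ K by omega,
      show k ≠ K + 1 by omega]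

theorem simulates_start {p q K j x : ℕ} {m : Mem} {n t : ℕ}
    (hA : Agree K m (start [p * q, n] ()).mem)
    (h0 : m K 0 = p * q) (h1 : m (K + 1) 0 = j) (h2 : m (K + 1) 1 = x)
    (h3 : ∀ i, 2 ≤ i → m (K + 1) i = 0) (h4 : ∀ k, K + 2 ≤ k → ∀ i, m k i = 0) :
    Simulates p q K j x none 0 0 ⟨m, (), t⟩ (start [p * q, n] IndexedState.empty) :=
  ⟨hA,
    { modulus := h0
      number := h1
      element := h2
      bit := h3 3 (by norm_num)
      count := h3 5 (by norm_num)
      challenge := h3 6 (by norm_num)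
      table := fun id => h4 _ le_rfl id
      root := fun id => h4 _ (by omega) id
      idx := fun id => h4 _ (by omega) id
      keys := fun id => by
        simp [h4 (K + 5) (by omega), start, IndexedState.empty, State.empty]
      planted := fun id a h => by simp [start, IndexedState.empty, State.empty] at h
      sign_lt := by simp [h3]
      valid := IndexedState.valid_empty _
      pinned := fun id h => by simp at h }⟩

variable {p q : ℕ} [hp : Fact p.Prime] [hq : Fact q.Prime] {K j x : ℕ}

/-- The run of the machine after the number `j` was chosen, compared with the traced game. The
element `u` of the game is the one that the machine uses for the mixed encryption. -/
theorem Blum.expect_traced_le_main (h : Blum p q) (h0 : coeps p q ≠ 0)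
    (hx : chi (x : ZMod (p * q)) = 1) (hK : 0 < K) {A : Adversary} (hA₁ : A.phase1.Below K)
    (hA₂ : A.phase2.Below K) {n : ℕ} {P : Polynomial ℕ} (hP : A.TimeBound 5 P)
    (hN : p * q < 2 ^ (2 * n)) {c₁ : Config Unit}
    (hc : Simulates p q K j x none 0 0 c₁ (start [p * q, n] IndexedState.empty)) (v : Bool)
    {good : ℕ → Prop} [DecidablePred good] {enc : ℕ → ℕ → Bool → PMF (List ℕ)}
    (henc : ∀ u, good u → Embeddable p q u (enc u)) :
    (expect (below (p * q)) fun u => if good u then coeps p q ^ (P.eval n + 3) *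
      expect (traced (enc u) A n p q (some j)) (score j v) else 0) ≤
      expect (exec noOracle (.seq (A.phase1.subst (simulateCall K))
        (challengeProg K (A.phase2.subst (simulateCall K)))) c₁)
          (verdict (x : ZMod (p * q)) v) := by
  have horder : (expect (below (p * q)) fun u => if good u then coeps p q ^ (P.eval n + 3) *
      expect (traced (enc u) A n p q (some j)) (score j v) else 0) =
      expect (exec (indexedOracle p q none (some j)) A.phase1
        (start [p * q, n] IndexedState.empty)) fun c => expect (below (p * q)) fun u =>
          if good u then coeps p q ^ (P.eval n + 3) *
            expect (tracedTail (enc u) A p q (some j) c) (score j v) else 0 := by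
    rw [expect_comm (exec _ _ _)]
    refine expect_congr fun u => ?_
    by_cases hu : good u
    · simp only [if_pos hu, expect_const_mul, expect_traced]
    · simp only [if_neg hu]
      exact (expect_const _ _).symm
  rw [horder, expect_seq]
  refine ((h.simulate_stepLE h0 hx hA₁ hc).expect_le fun c₁' c₂' hc' hsupp => ?_).trans
    (le_of_eq (one_mul _))
  exact h.expect_tracedTail_le h0 hx hK hA₂ hP hN hc' (h.support_phase1 hP hN hsupp).2.2 v henc

/-- A random residue has Jacobi symbol `-1` and `1` with almost equal probabilities. -/
theorem Blum.sum_unit_values_ge (h : Blum p q) {f : ℤ → ℝ≥0∞} (hf : f 0 = 0) :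
    coeps p q * (2⁻¹ * (f (-1) + f 1)) ≤
      expect (below (p * q)) fun u => f (chi (u : ZMod (p * q))) := by
  have hpos : p * q ≠ 0 := mul_ne_zero hp.out.ne_zero hq.out.ne_zero
  have : NeZero (p * q) := ⟨hpos⟩
  rw [expect_below (Nat.pos_of_ne_zero hpos), sum_range_eq_sum_zmod]
  simp only [ZMod.natCast_zmod_val]
  have h1 (z : ZMod (p * q)) : f (chi z) =
      (if chi z = -1 then f (-1) else 0) + if chi z = 1 then f 1 else 0 := by
    rcases chi_trichotomy z with h | h | h <;> simp [h, hf]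
  simp only [h1, Finset.sum_add_distrib, ← Finset.sum_filter, Finset.sum_const, nsmul_eq_mul]
  have h2 (s : ℤ) : (Finset.univ.filter fun z : ZMod (p * q) => chi z = s).card =
    (chiSet (p * q) s).card := rfl
  have h3 {s : ℤ} (hs : s = 1 ∨ s = -1) : coeps p q * (p * q : ℕ) ≤
      2 * ((chiSet (p * q) s).card : ℝ≥0∞) := by
    have h4 := h.coeps_mul_le_two_mul_totient
    rw [← h.card_chiSet hs] at h4
    push_cast at h4 ⊢
    have h5 : 2 * (coeps p q * (p * q)) ≤ 2 * (2 * ((chiSet (p * q) s).card : ℝ≥0∞)) :=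
      (le_of_eq (by ring)).trans h4
    exact (ENNReal.mul_le_mul_iff_right two_ne_zero ENNReal.ofNat_ne_top).1 h5
  rw [h2, h2]
  have h4 {s : ℤ} (hs : s = 1 ∨ s = -1) (X : ℝ≥0∞) : coeps p q * (2⁻¹ * X) ≤
      ((p * q : ℕ) : ℝ≥0∞)⁻¹ * ((chiSet (p * q) s).card * X) := by
    have h6 : coeps p q ≤ ((p * q : ℕ) : ℝ≥0∞)⁻¹ * (2 * ((chiSet (p * q) s).card : ℝ≥0∞)) := by
      rw [mul_comm, ← div_eq_mul_inv, ENNReal.le_div_iff_mul_le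
        (Or.inl (Nat.cast_ne_zero.2 hpos)) (Or.inl (ENNReal.natCast_ne_top _))]
      exact h3 hs
    calc coeps p q * (2⁻¹ * X)
        ≤ ((p * q : ℕ) : ℝ≥0∞)⁻¹ * (2 * ((chiSet (p * q) s).card : ℝ≥0∞)) * (2⁻¹ * X) := by gcongr
      _ = ((p * q : ℕ) : ℝ≥0∞)⁻¹ * ((chiSet (p * q) s).card * X) * (2 * 2⁻¹) := by ring
      _ = _ := by rw [ENNReal.mul_inv_cancel two_ne_zero ENNReal.ofNat_ne_top, mul_one]
  rw [mul_add, mul_add, mul_add]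
  exact add_le_add (h4 (Or.inr rfl) _) (h4 (Or.inl rfl) _)

/-- For a `u` with Jacobi symbol `-1` the machine plays the game, for a `u` with Jacobi symbol `1`
its challenge does not depend on the message. -/
theorem Blum.expect_main_ge (h : Blum p q) (h0 : coeps p q ≠ 0)
    (hx : chi (x : ZMod (p * q)) = 1) (hK : 0 < K) {A : Adversary} (hA₁ : A.phase1.Below K)
    (hA₂ : A.phase2.Below K) {n : ℕ} {P : Polynomial ℕ} (hP : A.TimeBound 5 P)
    (hN : p * q < 2 ^ (2 * n)) {c₁ : Config Unit}
    (hc : Simulates p q K j x none 0 0 c₁ (start [p * q, n] IndexedState.empty)) (v : Bool) :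
    coeps p q ^ (P.eval n + 4) * (2⁻¹ *
      (expect (traced (xhEncrypt (p * q)) A n p q (some j)) (score j v) + 2⁻¹)) ≤
      expect (exec noOracle (.seq (A.phase1.subst (simulateCall K))
        (challengeProg K (A.phase2.subst (simulateCall K)))) c₁)
          (verdict (x : ZMod (p * q)) v) := by
  -- the non-units `u` are dropped; for the others, the encryption depends on the Jacobi symbol
  have key := h.expect_traced_le_main h0 hx hK hA₁ hA₂ hP hN hc v
    (good := fun u => chi (u : ZMod (p * q)) ≠ 0)
    (enc := fun u => if chi (u : ZMod (p * q)) = -1 then xhEncrypt (p * q)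
      else fun a _ => mixedEncrypt (u : ZMod (p * q)) a true true) fun u hu a ha b b' c hc F => by
    rcases (chi_trichotomy (u : ZMod (p * q))).resolve_left hu with h1 | h1
    · rw [if_neg (by simp [h1]), h.expect_mixedEncrypt_of_chi_eq_one h1 true true b b']
      exact mul_le_of_le_one_left' (mul_le_one' (coeps_le_one p q) (coeps_le_one p q))
    · rw [if_pos h1]
      exact h.expect_xhEncrypt_le_mixed (mem_jac ha).2 h1 hc F
  refine le_trans ?_ key
  set f : ℤ → ℝ≥0∞ := fun s => if s = 0 then 0 else coeps p q ^ (P.eval n + 3) * if s = -1 then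
    expect (traced (xhEncrypt (p * q)) A n p q (some j)) (score j v) else 2⁻¹ with hf
  refine le_trans (le_of_eq ?_) ((h.sum_unit_values_ge (f := f) (by simp [hf])).trans
    (le_of_eq (expect_congr fun u => ?_)))
  · simp only [hf]
    norm_num
    ring
  · by_cases hu : chi (u : ZMod (p * q)) = 0
    · simp [hf, hu]
    · by_cases h1 : chi (u : ZMod (p * q)) = -1
      · simp [hf, h1]
      · simp only [hf, hu, h1, if_false, ne_eq, not_false_eq_true, if_true]
        rw [expect_traced_score_of_hiding fun _ _ => rfl]

/-- The result of the game with probability `1 / T`, and a coin toss otherwise. -/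
def diluted (T : ℕ) (μ : PMF Bool) : PMF Bool :=
  (below T).bind fun j => if j = 0 then μ else PMF.uniformOfFintype Bool

theorem diluted_apply {T : ℕ} (μ : PMF Bool) (v : Bool) :
    diluted (T + 1) μ v = (T + 1 : ℝ≥0∞)⁻¹ * (μ v + T * 2⁻¹) := by
  rw [← expect_indicator, diluted, expect_bind, expect_below T.succ_pos, Finset.sum_range_succ']
  simp only [Nat.add_eq_zero_iff, one_ne_zero, and_false, if_false, if_true,
    expect_indicator, Finset.sum_const, Finset.card_range, nsmul_eq_mul]
  push_cast
  congr 1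
  rw [add_comm]
  cases v <;> simp

/-- Only one in `2 (T + 1)` runs, where `T` bounds the running time of the adversary, is a run with
the right number `j` and with an element `u` of Jacobi symbol `-1`; the others are coin tosses. -/
theorem Blum.expect_distinguisher_ge (h : Blum p q) (h0 : coeps p q ≠ 0)
    (hx : chi (x : ZMod (p * q)) = 1) (hK : 0 < K) {A : Adversary} (hA₁ : A.phase1.Below K)
    (hA₂ : A.phase2.Below K) {n : ℕ} {P : Polynomial ℕ} (hP : A.TimeBound 5 P)
    (hN : p * q < 2 ^ (2 * n)) {e : Expr} (he : e.Below K)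
    (heT : e.eval (start [p * q, n, x] ()).mem = P.eval n + 1) (v : Bool) :
    coeps p q ^ (P.eval n + 4) *
      diluted (2 * P.eval n + 1 + 1) (game xhEncrypt A n p q) v ≤
      expect (exec noOracle (distinguisher K e A) (start [p * q, n, x] ()))
        (verdict (x : ZMod (p * q)) v) := by
  have hpos : p * q ≠ 0 := mul_ne_zero hp.out.ne_zero hq.out.ne_zero
  rw [distinguisher, expect_seq]
  refine le_trans ?_ (expect_initProg_ge hK he heT fun j m t h1 h2 h3 h4 h5 h6 =>
    h.expect_main_ge h0 hx hK hA₁ hA₂ hP hN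
      (simulates_start h1 (by simpa [hpos] using h2) h3 h4 h5 h6) v)
  rw [expect_const_mul, expect_const_mul]
  gcongr
  rw [expect_add, expect_const, expect_below (Nat.succ_pos _), diluted_apply]
  set T : ℝ≥0∞ := ((P.eval n + 1 : ℕ) : ℝ≥0∞) with hT
  have hT0 : T ≠ 0 := by simp [hT]
  have hTtop : T ≠ ⊤ := by simp [hT]
  have e1 : (((2 * P.eval n + 1 : ℕ) : ℝ≥0∞) + 1)⁻¹ = 2⁻¹ * T⁻¹ := by
    rw [← ENNReal.mul_inv (Or.inl two_ne_zero) (Or.inl ENNReal.ofNat_ne_top), hT]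
    congr 1
    push_cast
    ring
  have e2 : (((2 * P.eval n + 1 : ℕ) : ℝ≥0∞) * 2⁻¹) = (P.eval n : ℕ) * 2⁻¹ + T * 2⁻¹ := by
    rw [hT, ← add_mul, ← Nat.cast_add]
    congr 2
    ring
  rw [e1, e2, ← add_assoc, mul_assoc]
  gcongr
  rw [mul_add, ← mul_assoc, ENNReal.inv_mul_cancel hT0 hTtop, one_mul]
  gcongr
  exact h.game_le_sum_score xhEncrypt hP hN v

theorem qrGame_apply (D : Prog) (n : ℕ) (v : Bool) : qrGame D n p q v =
    expect (uniformOn (jac (p * q) 1)) fun x =>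
      expect (exec noOracle D (start [p * q, n, x] ())) (verdict (x : ZMod (p * q)) v) := by
  rw [← expect_indicator, qrGame, expect_bind]
  refine expect_congr fun x => ?_
  rw [expect_map]
  refine expect_congr fun c => ?_
  by_cases hx : c.mem 0 0 ≠ 0 ↔ IsSquare (x : ZMod (p * q)) <;> cases v <;> simp [verdict, hx]

/-- Up to a multiple of `eps`, the advantage of the machine is the advantage of the adversary
divided by a polynomial. -/
theorem Blum.abs_qrGame_sub_le (h : Blum p q) (hK : 0 < K) {A : Adversary}
    (hA₁ : A.phase1.Below K) (hA₂ : A.phase2.Below K) {n : ℕ} {P : Polynomial ℕ}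
    (hP : A.TimeBound 5 P) (hN : p * q < 2 ^ (2 * n)) {e : Expr} (he : e.Below K)
    (heT : ∀ x, e.eval (start [p * q, n, x] ()).mem = P.eval n + 1) :
    |((diluted (2 * P.eval n + 1 + 1) (game xhEncrypt A n p q) true).toReal -
      (qrGame (distinguisher K e A) n p q true).toReal)| ≤ (P.eval n + 4 : ℕ) * eps p q := by
  have hε := eps_nonneg p q
  refine abs_sub_le_of_dominated (by positivity) fun v => ?_
  rcases le_total 1 (eps p q) with h1 | h1
  · rw [ENNReal.ofReal_of_nonpos, zero_mul]
    · exact bot_le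
    · have : (1 : ℝ) ≤ (P.eval n + 4 : ℕ) := by exact_mod_cast Nat.le_add_left 1 _
      nlinarith
  by_cases h0 : coeps p q = 0
  · rw [coeps, ENNReal.ofReal_eq_zero] at h0
    rw [ENNReal.ofReal_of_nonpos, zero_mul]
    · exact bot_le
    · have : (1 : ℝ) ≤ (P.eval n + 4 : ℕ) := by exact_mod_cast Nat.le_add_left 1 _
      nlinarith
  have hJ : (jac (p * q) 1).Nonempty := h.jac_nonempty (Or.inl rfl)
  have h2 : ENNReal.ofReal (1 - (P.eval n + 4 : ℕ) * eps p q) ≤ coeps p q ^ (P.eval n + 4) := by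
    rw [coeps, ← ENNReal.ofReal_pow (by linarith)]
    refine ENNReal.ofReal_le_ofReal ?_
    have := one_add_mul_le_pow (a := -eps p q) (by linarith) (P.eval n + 4)
    rw [← sub_eq_add_neg 1 (eps p q)] at this
    linarith
  refine (mul_le_mul_left h2 _).trans ?_
  rw [qrGame_apply, ← expect_const (uniformOn (jac (p * q) 1))
    (coeps p q ^ (P.eval n + 4) * diluted (2 * P.eval n + 1 + 1) (game xhEncrypt A n p q) v)]
  refine expect_mono_support fun x hx => ?_
  exact h.expect_distinguisher_ge h0 (mem_jac ((mem_support_uniformOn hJ).1 hx)).2 hK hA₁ hA₂ hP hN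
    he (heT x) v

end Distinguisher

/-! ### The running time of the algorithm for quadratic residuosity -/

/-- The words in the memory have at most `L` bits, and the hash values and the keys of the
simulated oracles are residues modulo `M`. -/
structure Residues (K M L : ℕ) (m : Mem) : Prop where
  modulus : m K 0 = M
  table : ∀ i, m (K + 2) i ≤ M
  root : ∀ i, m (K + 3) i < M
  memLE : MemLE L m

section Residues

variable {K M L : ℕ} {m : Mem}

theorem Residues.mono (h : Residues K M L m) {L' : ℕ} (hL : L ≤ L') : Residues K M L' m :=
  ⟨h.modulus, h.table, h.root, h.memLE.mono hL⟩

theorem Residues.put (h : Residues K M L m) {k v : ℕ} (i : ℕ) (hv : v.size ≤ L)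
    (h0 : k ≠ K) (h2 : k ≠ K + 2) (h3 : k ≠ K + 3) : Residues K M L (m.put k i v) where
  modulus := (Mem.put_of_ne h0.symm).trans h.modulus
  table j := (Mem.put_of_ne h2.symm).trans_le (h.table j)
  root j := (Mem.put_of_ne h3.symm).trans_lt (h.root j)
  memLE := h.memLE.put hv _ _

theorem signedMod_lt (hM : 0 < M) (s v : ℕ) : signedMod M s v < M := Nat.mod_lt _ hM

/-- The bit lengths grow by at most one, since a residue does not exceed the modulus in length and
the counter of the hash values grows by one. -/
theorem Residues.hashMem (h : Residues K M L m) (hM : 0 < M) (hL : M.size ≤ L) {s y : ℕ}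
    (hs : s < 2) (hy : y < M) : Residues K M (L + 1) (hashMem K m s y) := by
  have size_le {w : ℕ} (hw : w ≤ M) : w.size ≤ L + 1 :=
    (Nat.size_le_size hw).trans (hL.trans (Nat.le_succ L))
  have hs' : s.size ≤ L + 1 := size_le (by omega)
  have hcnt : (m (K + 1) 5 + 1).size ≤ L + 1 := by
    have h1 := Nat.size_le.1 (h.memLE (K + 1) 5)
    refine Nat.size_le.2 ?_
    rw [pow_succ]
    have := Nat.one_le_two_pow (n := L)
    omega
  have h1 : Residues K M (L + 1) ((m.put (K + 1) 10 s).put (K + 1) 9 y) :=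
    ((h.mono (Nat.le_succ L)).put _ hs' (by omega) (by omega) (by omega)).put _ (size_le hy.le)
      (by omega) (by omega) (by omega)
  have htable {m : Mem} (h : Residues K M (L + 1) m) (i s v : ℕ) :
      Residues K M (L + 1) (m.put (K + 2) i (1 + signedMod M s v)) := by
    have h2 : 1 + signedMod M s v ≤ M := by
      have := signedMod_lt hM s v
      omega
    refine ⟨(Mem.put_of_ne (by omega)).trans h.modulus, fun j => ?_,
      fun j => (Mem.put_of_ne (by omega)).trans_lt (h.root j), h.memLE.put (size_le h2) _ _⟩
    by_cases hj : j = i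
    · simpa [Mem.put, hj] using h2
    · simpa [Mem.put, hj] using h.table j
  have hroot {m : Mem} (h : Residues K M (L + 1) m) (i s v : ℕ) :
      Residues K M (L + 1) (m.put (K + 3) i (signedMod M s v)) := by
    have h2 := signedMod_lt hM s v
    refine ⟨(Mem.put_of_ne (by omega)).trans h.modulus,
      fun j => (Mem.put_of_ne (by omega)).trans_le (h.table j), fun j => ?_,
      h.memLE.put (size_le h2.le) _ _⟩
    by_cases hj : j = i
    · simpa [Mem.put, hj] using h2
    · simpa [Mem.put, hj] using h.root j
  rw [XhIBE.hashMem]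
  simp only [h.modulus]
  refine (Residues.put ?_ _ ((h.memLE _ _).trans (Nat.le_succ L)) (by omega) (by omega)
    (by omega)).put _ hcnt (by omega) (by omega) (by omega)
  split_ifs
  · exact (htable h1 _ _ _).put _ hs' (by omega) (by omega) (by omega)
  all_goals exact htable (hroot h1 _ _ _) _ _ _

theorem hashMem_agree (K : ℕ) (m : Mem) (s y : ℕ) : Agree K m (hashMem K m s y) := by
  intro k hk i
  rw [hashMem]
  split_ifs <;> simp [Mem.put, show k ≠ K + 1 by omega, show k ≠ K + 2 by omega,
    show k ≠ K + 3 by omega, show k ≠ K + 4 by omega]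

/-- The possible results of `hashProg`. -/
theorem support_hashProg {σ : Type} {O : Oracle σ} (hM : 0 < M) (hL : M.size ≤ L) {c c' : Config σ}
    (hc : Residues K M L c.mem) (hc' : c' ∈ (exec O (hashProg K) c).support) :
    Agree K c.mem c'.mem ∧ Residues K M (L + 1) c'.mem := by
  classical
  refine forall_support_of_one_le
    (p := fun c' : Config σ => Agree K c.mem c'.mem ∧ Residues K M (L + 1) c'.mem) ?_ c' hc'
  refine le_trans ?_ (expect_hashProg_ge O (c := c)
    (G := fun m => if Agree K c.mem m ∧ Residues K M (L + 1) m then 1 else 0) fun m t => le_rfl)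
  by_cases h0 : c.mem (K + 2) (c.mem (K + 1) 8) = 0
  · rw [if_pos h0]
    refine (expect_const (below 2) 1).ge.trans (expect_mono_support fun s hs => ?_)
    refine (expect_const (below (c.mem K 0)) 1).ge.trans (expect_mono_support fun y hy => ?_)
    rw [hc.modulus] at hy
    rw [if_pos ⟨hashMem_agree K c.mem s y, hc.hashMem hM hL
      ((below_support hs).resolve_right (by simp))
      ((below_support hy).resolve_right fun h => hM.ne' h.1)⟩]
  · rw [if_neg h0, if_pos ⟨fun _ _ _ => rfl, hc.mono (Nat.le_succ L)⟩]

theorem hashProg_loopFree (K : ℕ) : (hashProg K).LoopFree := by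
  simp [hashProg, Prog.LoopFree]

/-- The possible results of a simulated oracle call. -/
theorem exists_support_simulateCall (K : ℕ) : ∃ C, ∀ (o : Query) (k : ℕ) (i e : Expr), k < K →
    i.Below K → ∀ M L, 0 < M → M.size ≤ L → 4 ≤ L → ∀ c : Config Unit, Residues K M L c.mem →
    ∀ c' ∈ (exec noOracle (simulateCall K o k i e) c).support,
      ∃ v < M, Agree K c'.mem (c.mem.put k (i.eval c.mem) v) ∧
        Residues K M (L + (e.cost c.mem + 1)) c'.mem ∧
        c'.time ≤ c.time + (1 + i.cost c.mem + e.cost c.mem) + C * (L + (e.cost c.mem + 1)) := by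
  obtain ⟨C₁, -, h₁⟩ := (hashProg_loopFree K).exists_time_le
  obtain ⟨C₂, h₂⟩ := (Expr.bin .sub (.load (K + 2) (argExpr K)) (.const 1)).exists_cost_le
  obtain ⟨C₃, h₃⟩ :=
    (Expr.bin .eq (reg (K + 1) 6) (.bin .add (argExpr K) (.const 1))).exists_cost_le
  obtain ⟨C₄, h₄⟩ := (argExpr K).exists_cost_le
  obtain ⟨C₅, h₅⟩ := (Expr.load (K + 3) (argExpr K)).exists_cost_le
  have hno {L : ℕ} : ∀ q v s, ∀ r ∈ (noOracle q v s).support, r.1.size ≤ L := by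
    intro q v s r hr
    rw [noOracle, PMF.mem_support_pure_iff] at hr
    simp [hr]
  refine ⟨C₁ + C₂ + C₃ + C₄ + C₅ + 20, fun o k i e hk hi M L hM hML hL c hc c' hc' => ?_⟩
  set E := e.cost c.mem with hE
  set m₁ := c.mem.put (K + 1) (Expr.eval c.mem (.const 8)) (e.eval c.mem) with hm₁
  have hA₁ : Agree K c.mem m₁ := fun k hk i => (Mem.put_of_ne (by omega)).symm
  have hR₁ : Residues K M (L + E) m₁ := (hc.mono (Nat.le_add_right _ _)).put _
    ((size_eval_le_cost _ _).trans (by omega)) (by omega) (by omega) (by omega)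
  have e8 : Expr.cost c.mem (.const 8) ≤ 5 := by
    rw [Expr.cost, show Nat.size 8 = 4 by decide]
  have c1 (m : Mem) : Expr.cost m (.const 1) ≤ 2 := by
    rw [Expr.cost, Nat.size_one]
  have c0 (m : Mem) : Expr.cost m (.const 0) ≤ 2 := by
    rw [Expr.cost, Nat.size_zero]
    omega
  have hLL : L + E + 1 = L + (E + 1) := by omega
  simp only [add_mul]
  cases o with
  | hash =>
    simp only [simulateCall, exec, PMF.mem_support_bind_iff, PMF.mem_support_pure_iff,
      exists_eq_left] at hc'
    obtain ⟨d, hd, rfl⟩ := hc'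
    obtain ⟨t, -⟩ := h₁ (L + E) (by omega) _ _ hno _ hR₁.memLE d hd
    obtain ⟨hA, hR⟩ := support_hashProg hM (by omega) hR₁ hd
    have hA' : Agree K c.mem d.mem := fun k hk i => (hA₁ k hk i).trans (hA k hk i)
    have hv : d.mem (K + 2) (d.mem (K + 1) 8) - 1 < M := by
      have := hR.table (d.mem (K + 1) 8)
      omega
    refine ⟨_, hv, ?_, ?_, ?_⟩
    · rw [← hA'.eval_eq hi]
      exact (hA'.put _ _ _).symm
    · exact (hR.mono hLL.le).put _ ((Nat.size_le_size hv.le).trans (by omega)) hk.ne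
        (by omega) (by omega)
    · have t2 := h₂ (L + (E + 1)) (by omega) _ (hR.memLE.mono hLL.le)
      have t3 : C₁ * (L + E) ≤ C₁ * (L + (E + 1)) := Nat.mul_le_mul_left _ (by omega)
      rw [← hA'.cost_eq hi]
      simp only at t ⊢
      omega
  | key =>
    simp only [simulateCall, exec, PMF.mem_support_bind_iff, PMF.mem_support_pure_iff,
      exists_eq_left, ← hm₁] at hc'
    have t1 := h₃ (L + (E + 1)) (by omega) m₁ (hR₁.memLE.mono (by omega))
    split_ifs at hc'
    · rw [PMF.mem_support_pure_iff] at hc'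
      subst hc'
      refine ⟨0, hM, ?_, ?_, ?_⟩
      · rw [← hA₁.eval_eq hi]
        exact (hA₁.put _ _ _).symm
      · exact (hR₁.mono (by omega)).put _ (by simp [Expr.eval]) hk.ne (by omega) (by omega)
      · have t2 := c0 m₁
        rw [← hA₁.cost_eq hi]
        simp only
        omega
    · simp only [PMF.mem_support_bind_iff, PMF.mem_support_pure_iff, exists_eq_left] at hc'
      obtain ⟨d, hd, rfl⟩ := hc'
      obtain ⟨t, -⟩ := h₁ (L + E) (by omega) _ _ hno _ hR₁.memLE d hd
      obtain ⟨hA, hR⟩ := support_hashProg hM (by omega) hR₁ hd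
      set m₂ := d.mem.put (K + 5) (Expr.eval d.mem (argExpr K)) (Expr.eval d.mem (.const 1))
        with hm₂
      have hR₂ : Residues K M (L + (E + 1)) m₂ := (hR.mono hLL.le).put _
        (by rw [Expr.eval, Nat.size_one]; omega) (by omega) (by omega) (by omega)
      have hA' : Agree K c.mem m₂ := fun k hk i =>
        ((hA₁ k hk i).trans (hA k hk i)).trans (Mem.put_of_ne (by omega)).symm
      have hv : m₂ (K + 3) (m₂ (K + 1) 8) < M := hR₂.root _
      refine ⟨_, hv, ?_, ?_, ?_⟩
      · simp only
        rw [← hA'.eval_eq hi]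
        exact (hA'.put _ _ _).symm
      · exact hR₂.put _ ((Nat.size_le_size hv.le).trans (by omega)) hk.ne (by omega) (by omega)
      · have t2 := h₄ (L + (E + 1)) (by omega) _ (hR.memLE.mono hLL.le)
        have t3 : C₁ * (L + E) ≤ C₁ * (L + (E + 1)) := Nat.mul_le_mul_left _ (by omega)
        have t4 := h₅ (L + (E + 1)) (by omega) _ hR₂.memLE
        have t5 := c1 d.mem
        simp only
        rw [← hA'.cost_eq hi]
        simp only at t ⊢
        omega

end Residues

section PolyTime

variable {K M : ℕ}

/-- The relation between a run of the adversary with arbitrary oracle answers and a run of the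
machine that simulates the oracles. -/
structure Paced (K M L C t₀ : ℕ) (c₁ c₂ : Config Unit) : Prop where
  agree : Agree K c₁.mem c₂.mem
  residues : Residues K M (c₁.time + L) c₂.mem
  time : c₂.time ≤ t₀ + c₁.time * (1 + C * (c₁.time + L))

/-- The bound `t₀ + t (1 + C (t + L))` for the running time increases by at least `d` if `t`
increases by `d`. -/
theorem paced_simulation (K M L C t₀ : ℕ) : Simulation K (Paced K M L C t₀) fun _ _ => ⊤ := by
  have htime {c₁ c₂ : Config Unit} (h : Paced K M L C t₀ c₁ c₂) (d : ℕ) : c₂.time + d ≤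
      t₀ + (c₁.time + d) * (1 + C * (c₁.time + d + L)) := by
    have h1 := h.time
    nlinarith [Nat.zero_le (C * (c₁.time * d)), Nat.zero_le (C * (d * (c₁.time + d + L)))]
  refine ⟨fun h => h.agree, fun h d => ⟨⟨h.agree, h.residues.mono (by simp only; omega),
    htime h d⟩, le_rfl⟩, fun h k i v d hk hv => ⟨⟨h.agree.put k i v,
    (h.residues.mono (by simp only; omega)).put _ (by simp only; omega) hk.ne (by omega)
      (by omega), htime h d⟩, le_rfl⟩⟩

/-- Simulating the oracles is possible with polynomial overhead. -/
theorem exists_simulation_time (K : ℕ) : ∃ C, ∀ P : Prog, P.Below K → ∀ M B L, 0 < M → M ≤ B →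
    M.size ≤ L → 4 ≤ L → ∀ c₁ c₂ : Config Unit, Agree K c₁.mem c₂.mem →
    Residues K M (c₁.time + L) c₂.mem →
    ∀ c₂' ∈ (exec noOracle (P.subst (simulateCall K)) c₂).support,
      ∃ c₁' ∈ (exec (anyOracle B) P c₁).support, Paced K M L C c₂.time c₁' c₂' := by
  obtain ⟨C, hC⟩ := exists_support_simulateCall K
  refine ⟨C, fun P hP M B L hM hMB hML hL c₁ c₂ hA hR c₂' hc₂' => ?_⟩
  have key := (paced_simulation K M L C c₂.time).stepLE (O₁ := anyOracle B) (O₂ := noOracle)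
    (f₁ := .call) (f₂ := simulateCall K) (fun o k i e hk hi he c₁ c₂ hc => ?_) P hP c₁ c₂
    ⟨hA, hR, Nat.le_add_right _ _⟩
  · rw [Prog.subst_call] at key
    exact stepLE_top_iff.1 key c₂' hc₂'
  · refine stepLE_top_iff.2 fun c₂' hc₂' => ?_
    obtain ⟨v, hv, hA', hR', ht⟩ := hC o k i e hk hi M (c₁.time + L) hM (by omega) (by omega) c₂
      hc.residues c₂' hc₂'
    have hiA := hc.agree.eval_eq hi
    have hiC := hc.agree.cost_eq hi
    have heC := hc.agree.cost_eq he
    refine ⟨⟨c₁.mem.put k (i.eval c₁.mem) v, (),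
      c₁.time + (1 + i.cost c₁.mem + e.cost c₁.mem + v.size)⟩, ?_, ?_, ?_, ?_⟩
    · simp only [exec, PMF.mem_support_bind_iff, PMF.mem_support_pure_iff]
      refine ⟨(v, ()), ?_, rfl⟩
      rw [anyOracle, PMF.mem_support_map_iff]
      refine ⟨v, ?_, rfl⟩
      rw [below, mem_support_uniformOn (by simpa using (hM.trans_le hMB).ne')]
      simpa using hv.trans_le hMB
    · rw [hiA]
      exact fun k' hk' i' => (hc.agree.put _ _ _ k' hk' i').trans (hA' k' hk' i').symm
    · exact hR'.mono (by simp only; omega)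
    · have h1 := hc.time
      simp only
      rw [hiC, heC]
      set t := c₁.time
      set a := i.cost c₂.mem
      set b := e.cost c₂.mem
      have h2 : C * (t + L + (b + 1)) ≤ C * (t + (1 + a + b + v.size) + L) :=
        Nat.mul_le_mul_left _ (by omega)
      have h3 : C * (t + L) ≤ C * (t + (1 + a + b + v.size) + L) :=
        Nat.mul_le_mul_left _ (by omega)
      set X := C * (t + (1 + a + b + v.size) + L)
      have h4 : t * (1 + C * (t + L)) ≤ t * (1 + X) := Nat.mul_le_mul_left _ (by omega)
      nlinarith [Nat.zero_le (X * (a + b + v.size))]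

/-- The possible results of `embedProg`. -/
theorem support_embedProg {L B : ℕ} (hK : 0 < K) (hM : 0 < M) (hMB : M ≤ B) {c c' : Config Unit}
    (hc : Residues K M L c.mem) (hc' : c' ∈ (exec noOracle (embedProg K) c).support) {L' : ℕ}
    (hL' : MemLE L' c'.mem) :
    ∃ l : List ℕ, l.length = 5 ∧ (∀ w ∈ l, w < B) ∧ Agree K (c.mem.write l) c'.mem ∧
      Residues K M L' c'.mem := by
  have hK0 : (0 : ℕ) ≠ K := hK.ne
  have : NeZero M := ⟨hM.ne'⟩
  rw [embedProg] at hc'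
  simp only [exec, PMF.mem_support_bind_iff, PMF.mem_support_pure_iff, exists_eq_left] at hc'
  obtain ⟨_, ⟨u, hu, rfl⟩, _, ⟨β, hβ, rfl⟩, hc'⟩ := hc'
  obtain ⟨l, h1, h2, -, h3, h4⟩ := support_cipherProg (M := M) _ hK
    (by simp [Mem.put, hc.modulus, Expr.eval]) hc'
  have h5 (k i : ℕ) (hk : k ≠ 0) (hkK : k ≠ K) (hkK1 : k ≠ K + 1) : c'.mem k i = c.mem k i := by
    rw [h3 k i hk fun h => absurd h hkK]
    simp [Mem.put, hkK, hkK1]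
  refine ⟨l, h1, fun w hw => ?_, fun k hk i => ?_, ?_, fun i => ?_, fun i => ?_, hL'⟩
  · rcases h2 w hw with h | h
    · exact h.trans_le hMB
    · have := hc.table (c.mem (K + 1) 8)
      rw [h]
      simp [Mem.put, Expr.eval, Op.eval]
      omega
  · rcases eq_or_ne k 0 with rfl | hk0
    · rw [h4]
      simp [Mem.write, Mem.put, hK0]
    · rw [h5 k i hk0 hk.ne (by omega)]
      simp [Mem.write, hk0]
  · rw [h3 K 0 hK.ne' fun _ => by norm_num]
    simp [Mem.put, hc.modulus, Expr.eval]
  · rw [h5 _ _ (by omega) (by omega) (by omega)]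
    exact hc.table i
  · rw [h5 _ _ (by omega) (by omega) (by omega)]
    exact hc.root i

theorem embedProg_loopFree (K : ℕ) : (embedProg K).LoopFree := by
  simp [embedProg, cipherProg_loopFree, Prog.LoopFree]

/-- The possible results of `initProg`. -/
theorem support_initProg {N n x L : ℕ} (hK : 0 < K) {e : Expr} (he : e.Below K) {c : Config Unit}
    (hc : c ∈ (exec noOracle (initProg K e) (start [N, n, x] ())).support) (hL : MemLE L c.mem) :
    Agree K (start [N, n] ()).mem c.mem ∧ Residues K (N + if N = 0 then 1 else 0) L c.mem := by
  classical
  have hpos : 0 < N + if N = 0 then 1 else 0 := by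
    split_ifs <;> omega
  have key := forall_support_of_one_le (p := fun c : Config Unit =>
    Agree K c.mem (start [N, n] ()).mem ∧ c.mem K 0 = (N + if N = 0 then 1 else 0) ∧
      ∀ k, K + 2 ≤ k → ∀ i, c.mem k i = 0) ((expect_const _ 1).ge.trans
    (expect_initProg_ge (G := fun _ => 1) hK he rfl fun j m t h1 h2 _ _ _ h6 => ?_)) c hc
  · obtain ⟨h1, h2, h3⟩ := key
    refine ⟨h1.symm, h2, fun i => ?_, fun i => ?_, hL⟩
    · rw [h3 _ le_rfl]
      exact bot_le
    · rw [h3 _ (by omega)]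
      exact hpos
  · rw [if_pos ⟨h1, h2, h6⟩]

theorem initProg_loopFree (K : ℕ) (e : Expr) : (initProg K e).LoopFree := by
  simp [initProg, saveModulus, Prog.LoopFree]

/-- The two phases of the adversary are simulated with polynomial overhead, and the rest of the
program has no loops, so that its running time is linear in the length of the words in the memory.
-/
theorem distinguisher_qrPolyTime (hK : 0 < K) {A : Adversary} {P : Polynomial ℕ}
    (hP : A.TimeBound 5 P) (hA₁ : A.phase1.Below K) (hA₂ : A.phase2.Below K) {e : Expr}
    (he : e.Below K) : QRPolyTime (distinguisher K e A) := by
  have hset : (Prog.set (K + 1) (.const 8) (.load 0 (.const 0))).LoopFree := by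
    simp [Prog.LoopFree]
  have hcoin : tossCoin.LoopFree := by simp [tossCoin, Prog.LoopFree]
  have hverdict : (verdictProg K).LoopFree := by simp [verdictProg, Prog.LoopFree]
  obtain ⟨C₀, hC₀, h₀⟩ := (initProg_loopFree K e).exists_time_le
  obtain ⟨C₁, hC₁, h₁⟩ := hset.exists_time_le
  obtain ⟨C₂, h₂⟩ := (Expr.load (K + 5) (argExpr K)).exists_cost_le
  obtain ⟨C₃, -, h₃⟩ := hcoin.exists_time_le
  obtain ⟨C₄, hC₄, h₄⟩ := (hashProg_loopFree K).exists_time_le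
  obtain ⟨C₅, h₅⟩ :=
    (Expr.bin .eq (.load (K + 4) (argExpr K)) (reg (K + 1) 0)).exists_cost_le
  obtain ⟨C₆, hC₆, h₆⟩ := (embedProg_loopFree K).exists_time_le
  obtain ⟨C₇, -, h₇⟩ := hverdict.exists_time_le
  obtain ⟨C, hC⟩ := exists_simulation_time K
  have hno {L : ℕ} : ∀ q v s, ∀ r ∈ (noOracle q v s).support, r.1.size ≤ L := by
    intro q v s r hr
    rw [noOracle, PMF.mem_support_pure_iff] at hr
    simp [hr]
  -- bounds for the bit lengths of the words in the memory at the various stages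
  let L₀ : Polynomial ℕ := .C C₀ * (2 * .X + 4)
  let L₁ := P + L₀
  let L₂ := Polynomial.C C₁ * L₁
  let L₃ := Polynomial.C C₄ * L₂
  let L₄ := Polynomial.C C₆ * L₃
  let L₅ := P + L₄
  refine ⟨L₀ + P * (1 + .C C * L₁) + L₂ + (1 + .C C₂ * L₂) + .C C₃ * L₂ + L₃ + (1 + .C C₅ * L₃) +
    .C C₃ * L₃ + L₄ + P * (1 + .C C * L₅) + .C C₇ * L₅, fun n N x hN hx c hc => ?_⟩
  have e₀ : L₀.eval n = C₀ * (2 * n + 4) := by simp [L₀]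
  have e₁ : L₁.eval n = P.eval n + L₀.eval n := by simp [L₁]
  have e₂ : L₂.eval n = C₁ * L₁.eval n := by simp [L₂]
  have e₃ : L₃.eval n = C₄ * L₂.eval n := by simp [L₃]
  have e₄ : L₄.eval n = C₆ * L₃.eval n := by simp [L₄]
  have e₅ : L₅.eval n = P.eval n + L₄.eval n := by simp [L₅]
  simp only [Polynomial.eval_add, Polynomial.eval_mul, Polynomial.eval_C, Polynomial.eval_one]
  have l₀ : 2 * n + 4 ≤ L₀.eval n := e₀ ▸ Nat.le_mul_of_pos_left _ hC₀
  have l₂ : L₁.eval n ≤ L₂.eval n := e₂ ▸ Nat.le_mul_of_pos_left _ hC₁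
  have l₃ : L₂.eval n ≤ L₃.eval n := e₃ ▸ Nat.le_mul_of_pos_left _ hC₄
  have l₄ : L₃.eval n ≤ L₄.eval n := e₄ ▸ Nat.le_mul_of_pos_left _ hC₆
  clear_value L₀ L₁ L₂ L₃ L₄ L₅
  generalize L₀.eval n = b₀ at *
  generalize L₁.eval n = b₁ at *
  generalize L₂.eval n = b₂ at *
  generalize L₃.eval n = b₃ at *
  generalize L₄.eval n = b₄ at *
  generalize L₅.eval n = b₅ at *
  set M := N + if N = 0 then 1 else 0 with hM
  have hM0 : 0 < M := by
    rw [hM]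
    split_ifs <;> omega
  have hMB : M ≤ 2 ^ (2 * n) := by
    rw [hM]
    split_ifs <;> omega
  have hMs : M.size ≤ 2 * n + 1 :=
    Nat.size_le.2 (hMB.trans_lt (Nat.pow_lt_pow_right (by norm_num) (by omega)))
  have hpace {t L : ℕ} (ht : t ≤ P.eval n) : t * (1 + C * (t + L)) ≤
      P.eval n * (1 + C * (P.eval n + L)) := by gcongr
  -- the first phase
  simp only [distinguisher, exec, PMF.mem_support_bind_iff] at hc
  obtain ⟨d₀, hd₀, d₁, hd₁, hc⟩ := hc
  obtain ⟨t₀, m₀⟩ := h₀ (2 * n + 4) (by omega) _ _ hno _ (memLE_start (fun w hw => by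
    have h1 := size_le_of_lt_two_pow hN
    have h2 := size_le_of_lt_two_pow hx
    have h3 := Nat.size_le.2 (Nat.lt_two_pow_self (n := n))
    simp only [List.mem_cons, List.not_mem_nil, or_false] at hw
    rcases hw with rfl | rfl | rfl <;> omega) ()) d₀ hd₀
  obtain ⟨A₀, R₀⟩ := support_initProg hK he hd₀ m₀
  rw [← e₀] at t₀ R₀
  obtain ⟨c₁, hc₁, p₁⟩ := hC A.phase1 hA₁ M _ b₀ hM0 hMB (by omega) (by omega)
    (start [N, n] ()) d₀ A₀ (R₀.mono (Nat.le_add_left _ _)) d₁ hd₁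
  have t₁ := (hP.phase1 hN hc₁).1
  have s₁ := p₁.time.trans (Nat.add_le_add_left (hpace t₁) _)
  rw [← e₁] at s₁
  have R₁ := p₁.residues.mono (L' := b₁) (by omega)
  -- the challenge
  simp only [challengeProg] at hc
  rw [exec, PMF.mem_support_bind_iff] at hc
  obtain ⟨d₂, hd₂, hc⟩ := hc
  obtain ⟨t₂, m₂⟩ := h₁ b₁ (by omega) _ _ hno d₁ R₁.memLE d₂ hd₂
  rw [← e₂] at t₂ m₂
  have hd₂' : d₂.mem = d₁.mem.put (K + 1) 8 (d₁.mem 0 0) := by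
    rw [exec, PMF.mem_support_pure_iff] at hd₂
    rw [hd₂]
    rfl
  have R₂ : Residues K M b₂ d₂.mem := by
    rw [hd₂']
    exact (R₁.mono l₂).put _ ((R₁.memLE _ _).trans l₂) (by omega) (by omega) (by omega)
  have k₂ := h₂ b₂ (by omega) _ m₂
  simp only [start] at t₀
  rw [exec] at hc
  split_ifs at hc
  · have t₃ := (h₃ b₂ (by omega) _ _ hno _ (by exact m₂) c hc).1
    simp only at t₃
    omega
  rw [exec, PMF.mem_support_bind_iff] at hc
  obtain ⟨d₃, hd₃, hc⟩ := hc
  obtain ⟨t₃, m₃⟩ := h₄ b₂ (by omega) _ _ hno _ (by exact m₂) d₃ hd₃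
  rw [← e₃] at t₃ m₃
  obtain ⟨A₃, R₃⟩ := support_hashProg (L := b₂) hM0 (by omega) (by exact R₂) hd₃
  have k₃ := h₅ b₃ (by omega) _ m₃
  rw [exec] at hc
  simp only at t₃
  split_ifs at hc
  swap
  · have t₄ := (h₃ b₃ (by omega) _ _ hno _ (by exact m₃) c hc).1
    simp only at t₄
    omega
  simp only [exec, PMF.mem_support_bind_iff] at hc
  obtain ⟨d₄, hd₄, d₅, hd₅, hc⟩ := hc
  obtain ⟨t₄, m₄⟩ := h₆ b₃ (by omega) _ _ hno _ (by exact m₃) d₄ hd₄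
  rw [← e₄] at t₄ m₄
  obtain ⟨l, hl, hl', A₄, R₄⟩ := support_embedProg hK hM0 hMB (by exact R₃) hd₄ m₄
  have A₅ : Agree K (c₁.mem.write l) d₄.mem := by
    intro k hk i
    rw [← A₄ k hk i]
    simp only [Mem.write]
    split_ifs
    · rfl
    · rw [← A₃ k hk i, hd₂', Mem.put_of_ne (by omega)]
      exact p₁.agree k hk i
  -- the second phase
  obtain ⟨c₂, hc₂, p₂⟩ := hC A.phase2 hA₂ M _ b₄ hM0 hMB (by omega) (by omega)
    ⟨c₁.mem.write l, (), c₁.time⟩ d₄ A₅ (R₄.mono (Nat.le_add_left _ _)) d₅ hd₅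
  have t₅ := hP n N hN c₁ hc₁ l hl hl' c₂ hc₂
  have s₅ := p₂.time.trans (Nat.add_le_add_left (hpace t₅) _)
  rw [← e₅] at s₅
  have t₆ := (h₇ b₅ (by omega) _ _ hno d₅ (p₂.residues.memLE.mono (by omega)) c hc).1
  simp only at t₄
  omega

end PolyTime

/-! ### The security of `xhIBE` -/

/-- Dilution divides the advantage by the number of terms. -/
theorem toReal_diluted_sub (T : ℕ) (μ : PMF Bool) (v : Bool) :
    (T + 1) * ((diluted (T + 1) μ v).toReal - 1 / 2) = (μ v).toReal - 1 / 2 := by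
  have h1 : (diluted (T + 1) μ v).toReal = (T + 1 : ℝ)⁻¹ * ((μ v).toReal + T * 2⁻¹) := by
    rw [diluted_apply, ENNReal.toReal_mul, ENNReal.toReal_inv,
      ENNReal.toReal_add (μ.apply_ne_top _) (ENNReal.mul_ne_top (by simp) (by simp)),
      ENNReal.toReal_add (by simp) (by simp)]
    simp
  have h2 : (T + 1 : ℝ) ≠ 0 := by positivity
  rw [h1, mul_sub, ← mul_assoc, mul_inv_cancel₀ h2]
  ring

/-- The advantage of an adversary is a polynomial multiple of that of `distinguisher`, up to a
negligible function. -/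
theorem indIdCpaSecure_of_qrAssumption (h : QRAssumption) : IndIdCpaSecure xhEncrypt 5 := by
  rintro A ⟨P, hP : A.TimeBound 5 P⟩
  obtain ⟨K₁, hK₁⟩ := A.phase1.exists_below
  obtain ⟨K₂, hK₂⟩ := A.phase2.exists_below
  have hK : 0 < max 1 (max K₁ K₂) := by simp
  have h₁ := hK₁.mono (show K₁ ≤ max 1 (max K₁ K₂) by simp)
  have h₂ := hK₂.mono (show K₂ ≤ max 1 (max K₁ K₂) by simp)
  generalize max 1 (max K₁ K₂) = K at hK h₁ h₂
  obtain ⟨e, he, heP⟩ := exists_expr_polynomial (P + 1) (K := K) (.load 0 (.const 1)) ⟨hK, trivial⟩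
  have heT (N n x : ℕ) : e.eval (start [N, n, x] ()).mem = P.eval n + 1 := by
    simp [heP, Expr.eval, start, Mem.write]
  have hD := h _ (distinguisher_qrPolyTime hK hP h₁ h₂ he)
  set D := distinguisher K e A
  -- the loss by the guess of the number of the challenge identity and of `u`
  let T : Polynomial ℝ := 2 * P.map (Nat.castRingHom ℝ) + 2
  have hT (n : ℕ) : T.eval (n : ℝ) = (2 * P.eval n + 1 : ℕ) + 1 := by
    simp only [T, Polynomial.eval_add, Polynomial.eval_mul, Polynomial.eval_ofNat,
      Polynomial.eval_natCast_map]
    push_cast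
    ring
  let Q : Polynomial ℝ := T * (P.map (Nat.castRingHom ℝ) + 4)
  have hQ (n : ℕ) : Q.eval (n : ℝ) = T.eval (n : ℝ) * (P.eval n + 4 : ℕ) := by
    simp [Q, Polynomial.eval_natCast_map]
  have hdiff : Negligible fun n => advantage xhEncrypt A n - T.eval (n : ℝ) *
      setupMean n fun p q => (qrGame D n p q true).toReal - 1 / 2 := by
    refine (negligible_polynomial_mul_two_pow Q).of_abs_le fun n => ?_
    have e1 : (advantage xhEncrypt A n - T.eval (n : ℝ) *
        setupMean n fun p q => (qrGame D n p q true).toReal - 1 / 2) =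
        setupMean n fun p q => ((game xhEncrypt A n p q true).toReal - 1 / 2) -
          T.eval (n : ℝ) * ((qrGame D n p q true).toReal - 1 / 2) := by
      rw [← setupMean_const_mul, advantage, sub_eq_add_neg, ← neg_one_mul (setupMean n _),
        ← setupMean_const_mul, ← setupMean_add]
      congr 1
      funext p q
      ring
    have hT0 : 0 ≤ T.eval (n : ℝ) := by
      rw [hT]
      positivity
    rw [e1, hQ]
    refine abs_setupMean_le (by positivity) fun p q _ _ hpq hp hq => ?_
    have hN : p * q < 2 ^ (2 * n) := by
      rw [two_mul, pow_add]
      exact Nat.mul_lt_mul'' hp hq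
    rw [← toReal_diluted_sub (2 * P.eval n + 1), ← hT, ← mul_sub, abs_mul, abs_of_nonneg hT0,
      mul_assoc]
    refine mul_le_mul_of_nonneg_left ?_ hT0
    rw [sub_sub_sub_cancel_right]
    exact hpq.abs_qrGame_sub_le hK h₁ h₂ hP hN he fun x => heT _ n x
  refine (hdiff.add (hD.polynomial_mul T)).congr fun n => ?_
  simp

end XhIBE

end

theorem mainTheorem3 :
    (XhIBE.QRAssumption → XhIBE.IndIdCpaSecure XhIBE.xhEncrypt 5) ∧
    (∀ A : XhIBE.Adversary, A.PolyTime 5 →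
      ∃ S : XhIBE.Adversary, S.PolyTime 2 ∧
        XhIBE.Negligible fun n =>
          XhIBE.advantage XhIBE.xhEncrypt A n - XhIBE.advantage XhIBE.cocksEncrypt S n) := by
  exact ⟨XhIBE.indIdCpaSecure_of_qrAssumption, XhIBE.exists_cocksAdversary⟩
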